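/- For $t\in\mathbb{C}$ let $V_t=\{z\in\mathbb{C}^4 : \sum_{i=1}^4 z_i^2=t\}$, put $\|z\|^2=\sum_i|z_i|^2$ and $r(z)=\|z\|^{2/3}$, and for $R>0$ let $D_t(R)=\{z\in V_t : r(z)\le R\}$. For $\rho>0$ put $\beta_{t,\rho}=\big(\rho^3+\tfrac{|t|^2}{4\rho^3}\big)^{1/3}$. For $t\neq 0$ let $g_{\mathrm{co},t}$ be the Candelas--de la Ossa metric on the smooth complex threefold $V_t$, i.e. the Kähler metric with Kähler form $\omega_{\mathrm{co},t}=\sqrt{-1}\,\partial\bar\partial f_t(\|z\|^2)|_{V_t}$ (with $g(v,w)=\omega(v,Jw)$), where $$f_t(x)=\frac13\Big(\frac{|t|^2}{2}\Big)^{1/3}\int_0^{\cosh^{-1}(x/|t|)}\big(\sinh(2y)-2y\big)^{1/3}\,dy,\qquad x\ge|t|.$$ Let $g_{\mathrm{co},0}$ be the Calabi--Yau cone metric on $V_0\setminus\{0\}$, with Kähler form $\omega_{\mathrm{co},0}=\tfrac12\sqrt{-1}\,\partial\bar\partial r^2$. For every $t\in\mathbb{C}$ let $d_{\mathrm{co},t}(p,q)$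 be the infimum of the $g_{\mathrm{co},t}$-lengths of the piecewise continuously differentiable curves in $V_t$ from $p$ to $q$ (for $t=0$ curves may pass through the cone point $0$, which does not contribute to lengths). **Theorem.** For every $t\ne 0$ the space $\big(D_t(\beta_{t,1}),d_{\mathrm{co},t}\big)$ is a nonempty compact metric space, so is $\big(D_0(1),d_{\mathrm{co},0}\big)$, and as $t\to 0$ in $\mathbb{C}\setminus\{0\}$ the spaces $\big(D_t(\beta_{t,1}),d_{\mathrm{co},t}\big)$ converge in the Gromov--Hausdorff topology to $\big(D_0(1),d_{\mathrm{co},0}\big)$. -/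

import Mathlib

open Filter Topology MeasureTheory
open scoped ENNReal

noncomputable section

namespace Conifold

/-- The ambient space `ℂ⁴` with its Hermitian norm `‖z‖² = ∑ |z_i|²`. -/
abbrev C4 : Type := EuclideanSpace ℂ (Fin 4)

/-- The affine quadric `V_t = {z ∈ ℂ⁴ : ∑ z_i² = t}`; `V_0` is the conifold and `V_t`, `t ≠ 0`,
its smoothings. -/
def quadric (t : ℂ) : Set C4 := {z | ∑ i, z i ^ 2 = t}

/-- The radius function `r(z) = ‖z‖^{2/3}`. -/
def radius (z : C4) : ℝ := ‖z‖ ^ (2 / 3 : ℝ)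

/-- The disc `D_t(R) = {r ≤ R} ⊆ V_t`. -/
def disc (t : ℂ) (R : ℝ) : Set C4 := {z | z ∈ quadric t ∧ radius z ≤ R}

/-- `β_{t,ρ} = (ρ³ + |t|² / (4 ρ³))^{1/3}`. -/
def beta (t : ℂ) (ρ : ℝ) : ℝ := (ρ ^ 3 + ‖t‖ ^ 2 / (4 * ρ ^ 3)) ^ (1 / 3 : ℝ)

/-- The function `f_t` of one real variable `x = ‖z‖²` whose composite with `‖z‖²` is the Kähler
potential of the Candelas–de la Ossa metric. For `t = 0` it is the potential `r² / 2` of the cone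
metric, and for `t ≠ 0`, on its domain `x ≥ |t|`, it is
`(1/3) (|t|²/2)^{1/3} ∫_0^{arcosh (x/|t|)} (sinh 2y - 2y)^{1/3} dy`,
where the factor `1/3` is the normalisation `f_t(x) ∼ x^{2/3} / 2` for `x → ∞`. -/
def potentialFun (t : ℂ) (x : ℝ) : ℝ :=
  open Classical in
  if t = 0 then x ^ (2 / 3 : ℝ) / 2
  else (1 / 3) * (‖t‖ ^ 2 / 2) ^ (1 / 3 : ℝ) *
    ∫ y in (0 : ℝ)..Real.arcosh (x / ‖t‖), (Real.sinh (2 * y) - 2 * y) ^ (1 / 3 : ℝ)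

/-- The Kähler potential `φ_t(z) = f_t(‖z‖²)`. -/
def potential (t : ℂ) (z : C4) : ℝ := potentialFun t (‖z‖ ^ 2)

/-- The closed region `{‖z‖² ≥ |t|}` of `ℂ⁴`, on which `φ_t` is defined. It contains `V_t`. -/
def region (t : ℂ) : Set C4 := {z | ‖t‖ ≤ ‖z‖ ^ 2}

theorem quadric_subset_region (t : ℂ) : quadric t ⊆ region t := by
  intro z hz
  have hz' : ∑ i, z i ^ 2 = t := hz
  show ‖t‖ ≤ ‖z‖ ^ 2
  rw [← hz', EuclideanSpace.norm_sq_eq]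
  refine (norm_sum_le _ _).trans (le_of_eq ?_)
  simp [norm_pow]

/-- The real `(1,1)`-form `√-1 ∂∂̄ φ` of a function `φ` on a region `S` of `ℂ⁴`, at `z`,
evaluated on the vectors `v, w`. In terms of the real second derivative `D²φ` it is
`(D²φ(iv, w) - D²φ(v, iw)) / 2`. At a boundary point of `S` the derivatives are those within `S`,
that is, those of any `C²` extension of `φ`. -/
def ddbar (φ : C4 → ℝ) (S : Set C4) (z v w : C4) : ℝ :=
  (iteratedFDerivWithin ℝ 2 φ S z ![Complex.I • v, w]
    - iteratedFDerivWithin ℝ 2 φ S z ![v, Complex.I • w]) / 2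

/-- The Kähler form `ω_{co,t} = √-1 ∂∂̄ φ_t`. As `√-1 ∂∂̄` commutes with the restriction to complex
submanifolds, the Kähler form of `V_t` is the restriction of this form to vectors tangent to
`V_t`. -/
def coForm (t : ℂ) (z v w : C4) : ℝ := ddbar (potential t) (region t) z v w

/-- The Candelas–de la Ossa metric `g_{co,t}(v, w) = ω_{co,t}(v, J w)`, for `z ∈ V_t` and `v, w`
tangent to `V_t` at `z`. For `t = 0` it is the cone metric `dr² + r² g_L` on `V_0 \ {0}`
(its value at the cone point is irrelevant for lengths of curves). -/
def coMetric (t : ℂ) (z v w : C4) : ℝ := coForm t z v (Complex.I • w)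

/-- `γ` is piecewise continuously differentiable on `[0, 1]`. -/
def PiecewiseC1 (γ : ℝ → C4) : Prop :=
  ContinuousOn γ (Set.Icc 0 1) ∧
    ∃ (n : ℕ) (p : Fin (n + 1) → ℝ), StrictMono p ∧ p 0 = 0 ∧ p (Fin.last n) = 1 ∧
      ∀ i : Fin n, ContDiffOn ℝ 1 γ (Set.Icc (p i.castSucc) (p i.succ))

/-- `γ`, on the time interval `[0, 1]`, is an admissible curve in `V_t` from `p` to `q`. -/
def IsCurve (t : ℂ) (p q : C4) (γ : ℝ → C4) : Prop :=
  PiecewiseC1 γ ∧ (∀ s ∈ Set.Icc (0 : ℝ) 1, γ s ∈ quadric t) ∧ γ 0 = p ∧ γ 1 = q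

/-- The length `L_{co,t}(γ) = ∫_0^1 |γ'(s)|_{g_{co,t}} ds ∈ [0, ∞]`. -/
def coLength (t : ℂ) (γ : ℝ → C4) : ℝ≥0∞ :=
  ∫⁻ s in Set.Icc (0 : ℝ) 1, ENNReal.ofReal √(coMetric t (γ s) (deriv γ s) (deriv γ s))

/-- The distance function `d_{co,t}` on `V_t` induced by `g_{co,t}`: the infimum of the lengths of
the admissible curves in `V_t` between two points. -/
def coDist (t : ℂ) (p q : C4) : ℝ≥0∞ := ⨅ (γ : ℝ → C4) (_ : IsCurve t p q γ), coLength t γ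

/-- `(A, d)` is a nonempty compact metric space, and its isometry class is the point `x` of the
Gromov–Hausdorff space: there is a bijection from the (nonempty, compact, metric) representative
of `x` onto `A` that carries its distance to `d`. -/
def HasGHClass (A : Set C4) (d : C4 → C4 → ℝ≥0∞) (x : GromovHausdorff.GHSpace) : Prop :=
  ∃ e : x.Rep ≃ A, ∀ p q : x.Rep, edist p q = d (e p) (e q)

end Conifold

end

noncomputable section

namespace Conifold

open Set

/-! The cone V_0 is compared with V_t through F_t(z) = z + t z̄ / (2‖z‖²) (`toSmoothing`), which
maps the null vectors with ‖z‖² > |t|/2 bijectively onto V_t minus its vanishing sphere ‖z‖² = |t|.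
It changes squared norms by x ↦ x + |t|²/(4x), so radius ρ becomes β_{t,ρ}; hence D_t(β_{t,1}) is
the counterpart of D_0(1).

Metric. For the potential f_t(‖z‖²) one has g(v,v) = A‖v‖² + B|⟨z,v⟩|² with A = 2f_t', B = 2f_t''
(`coMetric_eq`). Scaling reduces A and B to t = 1, where u = cosh τ makes them elementary. The
first-order equation `profile_add` then shows that on tangent vectors g lies between (4/9)‖v‖²/r and
(2/3)‖v‖²/r for every t (`le_coMetric`, `coMetric_le`). As ‖z‖²/|t| → ∞ the coefficients approach
those of the cone, so F_t is nearly isometric where ‖z‖² ≥ K|t|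
(`exists_coMetric_toSmoothing_close`).

Core. By the lower bound r is 1-Lipschitz for every d_{co,t}. Images of rays under F_t join a point
p to the vanishing sphere with length at most 3r(p), and by scaling that sphere has diameter
O(|t|^{1/3}). So d_{co,t}(p,q) ≤ C(r(p)+r(q)) with C independent of t (`exists_coDist_le_radius`).

Convergence. Fix δ and let t be small. A curve that stays outside radius about δ can be moved
between V_0 and V_t at the cost of a factor 1+2δ. A curve that enters the core has length at least
r(p)+r(q)-O(δ), and travelling along rays through the core achieves (1+2δ)(r(p)+r(q))+O(δ). Hence
F_t on {r ≥ δ} distorts distances by O(δ); its domain and its image are O(δ)-dense, which bounds the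
Gromov–Hausdorff distance (`IsCloseAt.ghDist_le`).

The discs are compact metric spaces: r and a bounded Lipschitz map separate points, connectedness of
S³ makes distances finite, and the inverse function theorem makes d_{co,t} continuous for the
Euclidean topology. -/

/-- `γ` is continuously differentiable on each interval of a finite subdivision of `[a, b]`. -/
inductive PwC1 {E : Type*} [NormedAddCommGroup E] [NormedSpace ℝ E] (γ : ℝ → E) : ℝ → ℝ → Prop
  | single {a b : ℝ} (h : a < b) (hγ : ContDiffOn ℝ 1 γ (Icc a b)) : PwC1 γ a b
  | cons {a b c : ℝ} (h : a < b) (hγ : ContDiffOn ℝ 1 γ (Icc a b)) (hbc : PwC1 γ b c) : PwC1 γ a c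

/-! ### Calculus of piecewise C¹ curves. -/

namespace PwC1

variable {E F : Type*} [NormedAddCommGroup E] [NormedSpace ℝ E] [NormedAddCommGroup F]
  [NormedSpace ℝ F] {γ : ℝ → E} {a b c : ℝ}

theorem lt (h : PwC1 γ a b) : a < b := by
  induction h with
  | single h _ => exact h
  | cons h _ _ ih => exact h.trans ih

theorem trans (h : PwC1 γ a b) (h' : PwC1 γ b c) : PwC1 γ a c := by
  induction h with
  | single h hγ => exact cons h hγ h'
  | cons h hγ _ ih => exact cons h hγ (ih h')

theorem continuousOn (h : PwC1 γ a b) : ContinuousOn γ (Icc a b) := by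
  induction h with
  | single h hγ => exact hγ.continuousOn
  | cons h hγ hbc ih =>
    rw [← Icc_union_Icc_eq_Icc h.le hbc.lt.le]
    exact hγ.continuousOn.union_of_isClosed ih isClosed_Icc isClosed_Icc

theorem congr {γ' : ℝ → E} (h : PwC1 γ a b) (hγ' : EqOn γ' γ (Icc a b)) : PwC1 γ' a b := by
  induction h with
  | single h hγ => exact single h (hγ.congr hγ')
  | cons h hγ hbc ih =>
    exact cons h (hγ.congr (hγ'.mono (Icc_subset_Icc_right hbc.lt.le)))
      (ih (hγ'.mono (Icc_subset_Icc_left h.le)))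

theorem map {Φ : E → F} {U : Set E} (hΦ : ContDiffOn ℝ 1 Φ U) (h : PwC1 γ a b)
    (hU : MapsTo γ (Icc a b) U) : PwC1 (Φ ∘ γ) a b := by
  induction h with
  | single h hγ => exact single h (hΦ.comp hγ hU)
  | cons h hγ hbc ih =>
    exact cons h (hΦ.comp hγ (hU.mono_left (Icc_subset_Icc_right hbc.lt.le)))
      (ih (hU.mono_left (Icc_subset_Icc_left h.le)))

theorem comp_affine {k : ℝ} (hk : 0 < k) (d : ℝ) (h : PwC1 γ (k * a + d) (k * b + d)) :
    PwC1 (fun s => γ (k * s + d)) a b := by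
  have key : ∀ x y : ℝ, PwC1 γ x y →
      PwC1 (fun s => γ (k * s + d)) ((x - d) / k) ((y - d) / k) := by
    have hsm : ∀ x y : ℝ, ContDiffOn ℝ 1 γ (Icc x y) →
        ContDiffOn ℝ 1 (fun s => γ (k * s + d)) (Icc ((x - d) / k) ((y - d) / k)) := by
      intro x y hγ
      refine hγ.comp (by fun_prop) ?_
      rintro s ⟨h1, h2⟩
      rw [div_le_iff₀ hk] at h1
      rw [le_div_iff₀ hk] at h2
      constructor <;> linarith
    intro x y hxy
    induction hxy with
    | single h hγ =>
      exact single (by gcongr) (hsm _ _ hγ)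
    | cons h hγ hbc ih =>
      exact cons (by gcongr) (hsm _ _ hγ) ih
  convert key _ _ h using 1 <;> field_simp <;> ring

theorem comp_neg (h : PwC1 γ a b) : PwC1 (fun s => γ (-s)) (-b) (-a) := by
  have hsm : ∀ x y : ℝ, ContDiffOn ℝ 1 γ (Icc x y) →
      ContDiffOn ℝ 1 (fun s => γ (-s)) (Icc (-y) (-x)) := by
    intro x y hγ
    refine hγ.comp (by fun_prop) ?_
    rintro s ⟨h1, h2⟩
    constructor <;> linarith
  induction h with
  | single h hγ => exact single (by linarith) (hsm _ _ hγ)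
  | cons h hγ hbc ih => exact ih.trans (single (by linarith) (hsm _ _ hγ))

theorem ae_differentiableAt (h : PwC1 γ a b) :
    ∀ᵐ s ∂volume.restrict (Icc a b), DifferentiableAt ℝ γ s := by
  have hsm : ∀ x y : ℝ, ContDiffOn ℝ 1 γ (Icc x y) →
      ∀ᵐ s ∂volume.restrict (Icc x y), DifferentiableAt ℝ γ s := by
    intro x y hγ
    rw [Measure.restrict_congr_set Ioo_ae_eq_Icc.symm]
    filter_upwards [ae_restrict_mem measurableSet_Ioo] with s hs
    exact (hγ.differentiableOn one_ne_zero).differentiableAt (Icc_mem_nhds hs.1 hs.2)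
  induction h with
  | single h hγ => exact hsm _ _ hγ
  | cons h hγ hbc ih =>
    rw [← Icc_union_Icc_eq_Icc h.le hbc.lt.le, ae_restrict_union_iff]
    exact ⟨hsm _ _ hγ, ih⟩

theorem enorm_sub_le (h : PwC1 γ a b) [CompleteSpace E] :
    ‖γ b - γ a‖ₑ ≤ ∫⁻ s in Icc a b, ‖deriv γ s‖ₑ := by
  induction h with
  | single h hγ => exact enorm_sub_le_lintegral_deriv_of_contDiffOn_Icc hγ h.le
  | @cons a b c h hγ hbc ih =>
    have h1 := enorm_sub_le_lintegral_deriv_of_contDiffOn_Icc hγ h.le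
    have h2 : γ c - γ a = (γ c - γ b) + (γ b - γ a) := by abel
    rw [← Icc_union_Ioc_eq_Icc h.le hbc.lt.le,
      lintegral_union measurableSet_Ioc
        (by rw [disjoint_left]; rintro x ⟨_, h1⟩ ⟨h2, _⟩; exact absurd h1 (not_le.2 h2)),
      Measure.restrict_congr_set (Ioc_ae_eq_Icc (a := b) (b := c))]
    rw [h2, add_comm (lintegral _ _)]
    exact (enorm_add_le _ _).trans (add_le_add ih h1)

end PwC1

theorem pwC1_of_partition {γ : ℝ → C4} (n : ℕ) (p : Fin (n + 1) → ℝ) (hp : StrictMono p)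
    (hn : 0 < n) (hγ : ∀ i : Fin n, ContDiffOn ℝ 1 γ (Icc (p i.castSucc) (p i.succ))) :
    PwC1 γ (p 0) (p (Fin.last n)) := by
  induction n with
  | zero => omega
  | succ n ih =>
    have h0 : p 0 < p 1 := hp (by simp)
    have hγ0 : ContDiffOn ℝ 1 γ (Icc (p 0) (p 1)) := by simpa using hγ 0
    rcases Nat.eq_zero_or_pos n with rfl | hn'
    · exact .single h0 hγ0
    · refine .cons h0 hγ0 ?_
      have := ih (fun i => p i.succ) (hp.comp (Fin.strictMono_succ)) hn' (fun i => by
        have := hγ i.succ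
        rwa [Fin.castSucc_succ] at this)
      simpa using this

theorem PwC1.exists_partition {γ : ℝ → C4} {a b : ℝ} (h : PwC1 γ a b) :
    ∃ (n : ℕ) (p : Fin (n + 1) → ℝ), StrictMono p ∧ p 0 = a ∧ p (Fin.last n) = b ∧
      ∀ i : Fin n, ContDiffOn ℝ 1 γ (Icc (p i.castSucc) (p i.succ)) := by
  induction h with
  | @single a b h hγ =>
    refine ⟨1, ![a, b], ?_, rfl, rfl, ?_⟩
    · rw [Fin.strictMono_iff_lt_succ]; intro i; fin_cases i; simpa using h
    · intro i; fin_cases i; simpa using hγ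
  | @cons a b c h hγ hbc ih =>
    obtain ⟨n, p, hp, h0, h1, hpc⟩ := ih
    refine ⟨n + 1, Fin.cons a p, ?_, rfl, ?_, ?_⟩
    · rw [Fin.strictMono_iff_lt_succ]
      intro i
      refine Fin.cases ?_ (fun j => ?_) i
      · simpa [h0] using h
      · simpa [← Fin.succ_castSucc] using hp (Fin.castSucc_lt_succ)
    · rw [← Fin.succ_last, Fin.cons_succ, h1]
    · intro i
      refine Fin.cases ?_ (fun j => ?_) i
      · simpa [h0] using hγ
      · simpa [← Fin.succ_castSucc] using hpc j

/-- Passes from partitions indexed by `Fin` to the inductive form, so that facts about curves can be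
proved by induction on the pieces. -/
theorem piecewiseC1_iff {γ : ℝ → C4} : PiecewiseC1 γ ↔ PwC1 γ 0 1 := by
  constructor
  · rintro ⟨-, n, p, hp, h0, h1, h⟩
    have hn : 0 < n := by
      rcases Nat.eq_zero_or_pos n with rfl | hn
      · simp_all
      · exact hn
    simpa [h0, h1] using pwC1_of_partition n p hp hn h
  · intro h
    exact ⟨h.continuousOn, h.exists_partition⟩

/-! ### The profile functions of the Candelas-de la Ossa potential -/

section Profile

/-- `sinh 2y - 2y`. -/
def sinhDefect (y : ℝ) : ℝ := Real.sinh (2 * y) - 2 * y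

/-- `(4/3) sinh³ y - (sinh 2y - 2y) cosh y`. -/
def sinhCubeDefect (y : ℝ) : ℝ :=
  2 * (y * Real.cosh y - Real.sinh y) - 2 / 3 * Real.sinh y ^ 3

/-- Divided by sinh³ this reads `profile u * u = 2 - 2h / sinh³` with h = y cosh y - sinh y ≥ 0; the
upper bound 2 and the limit 2 at infinity both come from it. -/
theorem sinhDefect_mul_cosh (y : ℝ) :
    sinhDefect y * Real.cosh y
      = 2 * Real.sinh y ^ 3 - 2 * (y * Real.cosh y - Real.sinh y) := by
  have := Real.cosh_sq y
  rw [sinhDefect, Real.sinh_two_mul]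
  linear_combination 2 * Real.sinh y * this

theorem hasDerivAt_sinhDefect (y : ℝ) : HasDerivAt sinhDefect (4 * Real.sinh y ^ 2) y := by
  have h := (((hasDerivAt_id y).const_mul 2).sinh).sub ((hasDerivAt_id y).const_mul 2)
  refine h.congr_deriv ?_
  have := Real.cosh_sq y
  simp only [id, Real.cosh_two_mul]
  linear_combination 2 * this

theorem hasDerivAt_mul_cosh_sub_sinh (y : ℝ) :
    HasDerivAt (fun y => y * Real.cosh y - Real.sinh y) (y * Real.sinh y) y := by
  refine (((hasDerivAt_id y).mul (Real.hasDerivAt_cosh y)).sub (Real.hasDerivAt_sinh y)).congr_deriv ?_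
  simp

theorem hasDerivAt_sinhCubeDefect (y : ℝ) :
    HasDerivAt sinhCubeDefect (-(Real.sinh y * sinhDefect y)) y := by
  refine (((hasDerivAt_mul_cosh_sub_sinh y).const_mul 2).sub
    (((Real.hasDerivAt_sinh y).pow 3).const_mul (2 / 3))).congr_deriv ?_
  rw [sinhDefect, Real.sinh_two_mul]
  simp
  ring

theorem continuous_sinhDefect : Continuous sinhDefect := by
  unfold sinhDefect; fun_prop

theorem sinhDefect_pos {y : ℝ} (hy : 0 < y) : 0 < sinhDefect y := by
  have h := Real.self_lt_sinh_iff.2 (show 0 < 2 * y by linarith)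
  unfold sinhDefect; linarith

theorem sinh_le_mul_cosh {y : ℝ} (hy : 0 ≤ y) : Real.sinh y ≤ y * Real.cosh y := by
  have hm : MonotoneOn (fun y => y * Real.cosh y - Real.sinh y) (Ici 0) := by
    refine monotoneOn_of_deriv_nonneg (convex_Ici 0) (by fun_prop) (by fun_prop) ?_
    intro x hx
    rw [interior_Ici] at hx
    rw [(hasDerivAt_mul_cosh_sub_sinh x).deriv]
    exact mul_nonneg (le_of_lt hx) (Real.sinh_nonneg_iff.2 (le_of_lt hx))
  have := hm (mem_Ici.2 le_rfl) (mem_Ici.2 hy) hy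
  simp at this
  linarith

theorem sinhCubeDefect_nonpos {y : ℝ} (hy : 0 ≤ y) : sinhCubeDefect y ≤ 0 := by
  have hm : AntitoneOn sinhCubeDefect (Ici 0) := by
    refine antitoneOn_of_deriv_nonpos (convex_Ici 0)
      (fun x _ => (hasDerivAt_sinhCubeDefect x).continuousAt.continuousWithinAt)
      (fun x _ => (hasDerivAt_sinhCubeDefect x).differentiableAt.differentiableWithinAt) ?_
    intro x hx
    rw [interior_Ici] at hx
    rw [(hasDerivAt_sinhCubeDefect x).deriv]
    exact neg_nonpos.2 (mul_nonneg (Real.sinh_nonneg_iff.2 (le_of_lt hx)) (sinhDefect_pos hx).le)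
  have := hm (mem_Ici.2 le_rfl) (mem_Ici.2 hy) hy
  simpa [sinhCubeDefect] using this

/-- Numerator and denominator vanish to order 3 at 0, and one use of l'Hôpital's rule already
cancels sinh², leaving 4 / (3 cosh y). -/
theorem tendsto_sinhDefect_div :
    Tendsto (fun y => sinhDefect y / Real.sinh y ^ 3) (𝓝[>] 0) (𝓝 (4 / 3)) := by
  have hpos : ∀ᶠ y : ℝ in 𝓝[>] 0, 0 < Real.sinh y := by
    filter_upwards [self_mem_nhdsWithin] with y hy using Real.sinh_pos_iff.2 hy
  refine HasDerivAt.lhopital_zero_nhdsGT (f' := fun y => 4 * Real.sinh y ^ 2)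
    (g' := fun y => 3 * Real.sinh y ^ 2 * Real.cosh y)
    (.of_forall hasDerivAt_sinhDefect) (.of_forall fun y => ?_) ?_ ?_ ?_ ?_
  · simpa using (Real.hasDerivAt_sinh y).fun_pow 3
  · filter_upwards [hpos] with y hy
    have := Real.cosh_pos y
    positivity
  · refine (Continuous.tendsto' continuous_sinhDefect _ _ ?_).mono_left nhdsWithin_le_nhds
    simp [sinhDefect]
  · refine (Continuous.tendsto' (by fun_prop) _ _ ?_).mono_left nhdsWithin_le_nhds
    simp
  · have : Tendsto (fun y : ℝ => 4 / (3 * Real.cosh y)) (𝓝[>] 0) (𝓝 (4 / 3)) := by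
      refine tendsto_nhdsWithin_of_tendsto_nhds (Continuous.tendsto' ?_ _ _ (by simp))
      exact continuous_const.div (by fun_prop) (fun y => by have := Real.cosh_pos y; positivity)
    refine this.congr' ?_
    filter_upwards [hpos] with y hy
    have := Real.cosh_pos y
    field_simp

theorem tendsto_sinhCubeDefect_div :
    Tendsto (fun y => sinhCubeDefect y / Real.sinh y ^ 5) (𝓝[>] 0) (𝓝 (-(4 / 15))) := by
  have hpos : ∀ᶠ y : ℝ in 𝓝[>] 0, 0 < Real.sinh y := by
    filter_upwards [self_mem_nhdsWithin] with y hy using Real.sinh_pos_iff.2 hy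
  refine HasDerivAt.lhopital_zero_nhdsGT (f' := fun y => -(Real.sinh y * sinhDefect y))
    (g' := fun y => 5 * Real.sinh y ^ 4 * Real.cosh y)
    (.of_forall hasDerivAt_sinhCubeDefect) (.of_forall fun y => ?_) ?_ ?_ ?_ ?_
  · simpa using (Real.hasDerivAt_sinh y).fun_pow 5
  · filter_upwards [hpos] with y hy
    have := Real.cosh_pos y
    positivity
  · refine (Continuous.tendsto' ?_ _ _ ?_).mono_left nhdsWithin_le_nhds
    · unfold sinhCubeDefect; fun_prop
    · simp [sinhCubeDefect]
  · refine (Continuous.tendsto' (by fun_prop) _ _ ?_).mono_left nhdsWithin_le_nhds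
    simp
  · have : Tendsto (fun y : ℝ => -1 / (5 * Real.cosh y)) (𝓝[>] 0) (𝓝 (-1 / 5)) := by
      refine tendsto_nhdsWithin_of_tendsto_nhds (Continuous.tendsto' ?_ _ _ (by simp))
      exact continuous_const.div (by fun_prop) (fun y => by have := Real.cosh_pos y; positivity)
    have h := this.mul tendsto_sinhDefect_div
    rw [show (-1 / 5 : ℝ) * (4 / 3) = -(4 / 15) by norm_num] at h
    refine h.congr' ?_
    filter_upwards [hpos] with y hy
    have := Real.cosh_pos y
    field_simp

/-- `(sinh 2τ - 2τ) / sinh³ τ` as a function of `u = cosh τ ≥ 1`. -/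
def profile (u : ℝ) : ℝ :=
  open Classical in
  if u = 1 then 4 / 3 else sinhDefect (Real.arcosh u) / Real.sinh (Real.arcosh u) ^ 3

/-- A third of the derivative of `profile`. -/
def profileDeriv (u : ℝ) : ℝ :=
  open Classical in
  if u = 1 then -(4 / 15) else sinhCubeDefect (Real.arcosh u) / Real.sinh (Real.arcosh u) ^ 5

theorem profile_of_lt {u : ℝ} (hu : 1 < u) :
    profile u = sinhDefect (Real.arcosh u) / Real.sinh (Real.arcosh u) ^ 3 := if_neg hu.ne'

theorem profileDeriv_of_lt {u : ℝ} (hu : 1 < u) :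
    profileDeriv u = sinhCubeDefect (Real.arcosh u) / Real.sinh (Real.arcosh u) ^ 5 :=
  if_neg hu.ne'

theorem tendsto_arcosh_one : Tendsto Real.arcosh (𝓝[>] 1) (𝓝[>] 0) := by
  refine tendsto_nhdsWithin_iff.2 ⟨?_, ?_⟩
  · have := (Real.continuousOn_arcosh 1 (mem_Ici.2 le_rfl)).tendsto
    rw [Real.arcosh_zero] at this
    exact this.mono_left (nhdsWithin_mono _ Ioi_subset_Ici_self)
  · filter_upwards [self_mem_nhdsWithin] with u hu using Real.arcosh_pos hu

theorem tendsto_profile_one : Tendsto profile (𝓝[>] 1) (𝓝 (4 / 3)) := by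
  refine (tendsto_sinhDefect_div.comp tendsto_arcosh_one).congr' ?_
  filter_upwards [self_mem_nhdsWithin] with u hu using (profile_of_lt hu).symm

theorem tendsto_profileDeriv_one : Tendsto profileDeriv (𝓝[>] 1) (𝓝 (-(4 / 15))) := by
  refine (tendsto_sinhCubeDefect_div.comp tendsto_arcosh_one).congr' ?_
  filter_upwards [self_mem_nhdsWithin] with u hu using (profileDeriv_of_lt hu).symm

theorem profile_one : profile 1 = 4 / 3 := if_pos rfl

theorem profileDeriv_one : profileDeriv 1 = -(4 / 15) := if_pos rfl

theorem hasDerivAt_profile {u : ℝ} (hu : 1 < u) : HasDerivAt profile (3 * profileDeriv u) u := by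
  have hτ := Real.arcosh_pos hu
  have hs : 0 < Real.sinh (Real.arcosh u) := Real.sinh_pos_iff.2 hτ
  have h1 := ((hasDerivAt_sinhDefect (Real.arcosh u)).fun_div
    ((Real.hasDerivAt_sinh (Real.arcosh u)).fun_pow 3) (pow_pos hs 3).ne').comp u
    (Real.hasDerivAt_arcosh hu)
  rw [← Real.sinh_arcosh hu.le] at h1
  refine (h1.congr_of_eventuallyEq ?_).congr_deriv ?_
  · filter_upwards [lt_mem_nhds hu] with v hv using profile_of_lt hv
  · rw [profileDeriv_of_lt hu]
    have := sinhDefect_mul_cosh (Real.arcosh u)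
    rw [sinhCubeDefect]
    field_simp
    simp
    linear_combination (-3 * Real.sinh (Real.arcosh u) ^ 2) * this

/-- At u = 1 the chain rule fails because `arcosh` is not differentiable there, but `profile` is:
its one-sided derivative is the limit of the derivatives from the right. -/
theorem hasDerivWithinAt_profile {u : ℝ} (hu : 1 ≤ u) :
    HasDerivWithinAt profile (3 * profileDeriv u) (Ici 1) u := by
  rcases hu.eq_or_lt with rfl | hu
  · refine hasDerivWithinAt_Ici_of_tendsto_deriv (s := Ioi 1)
      (fun v hv => (hasDerivAt_profile hv).differentiableAt.differentiableWithinAt)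
      (by rw [ContinuousWithinAt, profile_one]; exact tendsto_profile_one)
      self_mem_nhdsWithin ?_
    rw [profileDeriv_one]
    refine (tendsto_profileDeriv_one.const_mul 3).congr' ?_
    filter_upwards [self_mem_nhdsWithin] with v hv using (hasDerivAt_profile hv).deriv.symm
  · exact (hasDerivAt_profile hu).hasDerivWithinAt

theorem profile_mul_self_le {u : ℝ} (hu : 1 ≤ u) : profile u * u ≤ 2 := by
  rcases hu.eq_or_lt with rfl | hu
  · rw [profile_one]; norm_num
  have hτ := Real.arcosh_pos hu
  have hs : 0 < Real.sinh (Real.arcosh u) := Real.sinh_pos_iff.2 hτ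
  have h := sinhDefect_mul_cosh (Real.arcosh u)
  have h2 := sinh_le_mul_cosh hτ.le
  rw [profile_of_lt hu, div_mul_eq_mul_div, div_le_iff₀ (by positivity)]
  nth_rewrite 2 [← Real.cosh_arcosh hu.le]
  linarith

/-- This is the Ricci-flat equation for the potential at t = 1, after its first integration. As
`profile` = 54 f'³, it says that f'² (u f' + (u² - 1) f'') is constant, and it eliminates f'' from
all later estimates. -/
theorem profile_add {u : ℝ} (hu : 1 ≤ u) :
    profile u * u + profileDeriv u * (u ^ 2 - 1) = 4 / 3 := by
  rcases hu.eq_or_lt with rfl | hu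
  · rw [profile_one]; norm_num
  have hτ := Real.arcosh_pos hu
  have hs : 0 < Real.sinh (Real.arcosh u) := Real.sinh_pos_iff.2 hτ
  have h := sinhDefect_mul_cosh (Real.arcosh u)
  have h2 : u ^ 2 - 1 = Real.sinh (Real.arcosh u) ^ 2 := by
    rw [Real.sinh_sq, Real.cosh_arcosh hu.le]
  rw [profile_of_lt hu, profileDeriv_of_lt hu, h2, sinhCubeDefect]
  rw [Real.cosh_arcosh hu.le] at h ⊢
  field_simp
  linear_combination 3 * h

theorem profileDeriv_nonpos {u : ℝ} (hu : 1 ≤ u) : profileDeriv u ≤ 0 := by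
  rcases hu.eq_or_lt with rfl | hu
  · rw [profileDeriv_one]; norm_num
  rw [profileDeriv_of_lt hu]
  exact div_nonpos_of_nonpos_of_nonneg (sinhCubeDefect_nonpos (Real.arcosh_nonneg hu.le))
    (pow_nonneg (Real.sinh_nonneg_iff.2 (Real.arcosh_nonneg hu.le)) _)

theorem le_profile_mul_self {u : ℝ} (hu : 1 ≤ u) : 4 / 3 ≤ profile u * u := by
  have h := profile_add hu
  have := mul_nonpos_of_nonpos_of_nonneg (profileDeriv_nonpos hu) (show 0 ≤ u ^ 2 - 1 by nlinarith)
  linarith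

theorem profile_pos {u : ℝ} (hu : 1 ≤ u) : 0 < profile u := by
  have := le_profile_mul_self hu
  by_contra! h
  nlinarith

/-- Since τ ≤ sinh τ, the correction 2(τ cosh τ - sinh τ) / sinh³ τ is at most 2u/(u² - 1), which
tends to 0. -/
theorem tendsto_profile_mul_self : Tendsto (fun u => profile u * u) atTop (𝓝 2) := by
  have hlow : Tendsto (fun u : ℝ => 2 - 2 * (u / (u ^ 2 - 1))) atTop (𝓝 2) := by
    have h1 : Tendsto (fun u : ℝ => u⁻¹ / (1 - (u⁻¹) ^ 2)) atTop (𝓝 (0 / (1 - 0 ^ 2))) :=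
      tendsto_inv_atTop_zero.div (tendsto_const_nhds.sub (tendsto_inv_atTop_zero.pow 2)) (by norm_num)
    have h2 : Tendsto (fun u : ℝ => u / (u ^ 2 - 1)) atTop (𝓝 0) := by
      rw [zero_div] at h1
      refine h1.congr' ?_
      filter_upwards [eventually_gt_atTop 1] with u hu
      have : u ^ 2 - 1 ≠ 0 := by nlinarith
      field_simp
    simpa using tendsto_const_nhds.sub (h2.const_mul (2 : ℝ))
  refine tendsto_of_tendsto_of_tendsto_of_le_of_le' hlow tendsto_const_nhds ?_ ?_
  · filter_upwards [eventually_gt_atTop 1] with u hu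
    have hτ := Real.arcosh_pos hu
    have hs : 0 < Real.sinh (Real.arcosh u) := Real.sinh_pos_iff.2 hτ
    have h := sinhDefect_mul_cosh (Real.arcosh u)
    have h2 : u ^ 2 - 1 = Real.sinh (Real.arcosh u) ^ 2 := by
      rw [Real.sinh_sq, Real.cosh_arcosh hu.le]
    have h3 := Real.self_le_sinh_iff.2 hτ.le
    rw [profile_of_lt hu, h2]
    rw [Real.cosh_arcosh hu.le] at h
    rw [div_mul_eq_mul_div, h, le_div_iff₀ (by positivity)]
    set σ := Real.sinh (Real.arcosh u)
    have : (2 - 2 * (u / σ ^ 2)) * σ ^ 3 = 2 * σ ^ 3 - 2 * (σ * u) := by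
      field_simp
    rw [this]
    nlinarith
  · filter_upwards [eventually_ge_atTop 1] with u hu using profile_mul_self_le hu

/-- Twice the derivative of the potential at `t = 1`. -/
def coefA (u : ℝ) : ℝ := 2 / 3 * (profile u / 2) ^ (1 / 3 : ℝ)

/-- Twice the second derivative of the potential at `t = 1`. -/
def coefB (u : ℝ) : ℝ := 1 / 3 * profileDeriv u * (profile u / 2) ^ (-2 / 3 : ℝ)

theorem hasDerivWithinAt_coefA {u : ℝ} (hu : 1 ≤ u) :
    HasDerivWithinAt coefA (coefB u) (Ici 1) u := by
  have h := (((hasDerivWithinAt_profile hu).div_const 2).rpow_const (p := 1 / 3)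
    (Or.inl (by have := profile_pos hu; positivity))).const_mul (2 / 3)
  refine h.congr_deriv ?_
  rw [coefB, show (1 / 3 - 1 : ℝ) = -2 / 3 by norm_num]
  ring

/-- The derivative 1 / sinh τ of `arcosh` goes inside the cube root as 1 / sinh³ τ and turns the
integrand into a power of `profile`. -/
theorem hasDerivAt_potentialFun_one {u : ℝ} (hu : 1 < u) :
    HasDerivAt (potentialFun 1) (coefA u / 2) u := by
  have hτ := Real.arcosh_pos hu
  have hs : 0 < Real.sinh (Real.arcosh u) := Real.sinh_pos_iff.2 hτ
  have hc : Continuous (fun y => sinhDefect y ^ (1 / 3 : ℝ)) :=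
    continuous_sinhDefect.rpow_const (fun _ => Or.inr (by norm_num))
  have h := (((hc.integral_hasStrictDerivAt 0 (Real.arcosh u)).hasDerivAt.comp u
    (Real.hasDerivAt_arcosh hu))).const_mul ((1 / 3) * ((1 : ℝ) ^ 2 / 2) ^ (1 / 3 : ℝ))
  refine (h.congr_of_eventuallyEq ?_).congr_deriv ?_
  · filter_upwards with v
    simp [potentialFun, sinhDefect]
  · rw [← Real.sinh_arcosh hu.le, coefA, profile_of_lt hu]
    have hp := (sinhDefect_pos hτ).le
    have e : sinhDefect (Real.arcosh u) / Real.sinh (Real.arcosh u) ^ 3 / 2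
      = sinhDefect (Real.arcosh u) * (1 / 2) * (Real.sinh (Real.arcosh u) ^ 3)⁻¹ := by
      field_simp
    have e2 : (Real.sinh (Real.arcosh u) ^ 3) ^ (1 / 3 : ℝ) = Real.sinh (Real.arcosh u) := by
      rw [← Real.rpow_natCast, ← Real.rpow_mul hs.le]
      norm_num
    rw [e, Real.mul_rpow (by positivity) (by positivity), Real.mul_rpow (by positivity) (by positivity),
      Real.inv_rpow (by positivity), e2, one_pow]
    ring

theorem hasDerivWithinAt_potentialFun_one {u : ℝ} (hu : 1 ≤ u) :
    HasDerivWithinAt (potentialFun 1) (coefA u / 2) (Ici 1) u := by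
  rcases hu.eq_or_lt with rfl | hu
  · have hcA := (hasDerivWithinAt_coefA le_rfl).continuousWithinAt.mono Ioi_subset_Ici_self
    refine hasDerivWithinAt_Ici_of_tendsto_deriv (s := Ioi 1)
      (fun v hv => (hasDerivAt_potentialFun_one hv).differentiableAt.differentiableWithinAt)
      ?_ self_mem_nhdsWithin ?_
    · have hc : Continuous (fun y => sinhDefect y ^ (1 / 3 : ℝ)) :=
        continuous_sinhDefect.rpow_const (fun _ => Or.inr (by norm_num))
      have h1 : Continuous (fun x => ∫ y in (0 : ℝ)..x, sinhDefect y ^ (1 / 3 : ℝ)) :=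
        intervalIntegral.continuous_primitive (fun a b => hc.intervalIntegrable a b) 0
      have h2 : ContinuousWithinAt Real.arcosh (Ioi 1) 1 :=
        (Real.continuousOn_arcosh 1 (mem_Ici.2 le_rfl)).mono Ioi_subset_Ici_self
      have h3 := (h1.continuousAt.comp_continuousWithinAt h2).const_mul
        ((1 / 3) * ((1 : ℝ) ^ 2 / 2) ^ (1 / 3 : ℝ))
      refine h3.congr (fun v _ => ?_) ?_ <;> simp [potentialFun, sinhDefect]
    · refine (hcA.tendsto.div_const 2).congr' ?_
      filter_upwards [self_mem_nhdsWithin] with v hv using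
        (hasDerivAt_potentialFun_one hv).deriv.symm
  · exact (hasDerivAt_potentialFun_one hu).hasDerivWithinAt

/-! ### Power-law bounds and asymptotics of the coefficients. -/

theorem coefA_eq {u : ℝ} (hu : 1 ≤ u) :
    coefA u * u ^ (1 / 3 : ℝ) = 2 / 3 * (profile u * u / 2) ^ (1 / 3 : ℝ) := by
  have := profile_pos hu
  rw [coefA, mul_assoc, ← Real.mul_rpow (by positivity) (by positivity)]
  congr 2; ring

theorem coefB_eq {u : ℝ} (hu : 1 ≤ u) :
    coefB u * u ^ (4 / 3 : ℝ)
      = 1 / 3 * (profileDeriv u * u ^ 2) * (profile u * u / 2) ^ (-2 / 3 : ℝ) := by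
  have := profile_pos hu
  have hu0 : 0 < u := by linarith
  rw [coefB, show profile u * u / 2 = profile u / 2 * u by ring,
    Real.mul_rpow (by positivity) hu0.le, ← Real.rpow_natCast u 2,
    show (4 / 3 : ℝ) = (2 : ℕ) + (-2 / 3) by norm_num, Real.rpow_add hu0]
  ring

theorem coefA_mul_le {u : ℝ} (hu : 1 ≤ u) : coefA u * u ^ (1 / 3 : ℝ) ≤ 2 / 3 := by
  rw [coefA_eq hu]
  have h1 := profile_mul_self_le hu
  have h2 := le_profile_mul_self hu
  have := Real.rpow_le_one (x := profile u * u / 2) (z := 1 / 3) (by linarith) (by linarith)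
    (by norm_num)
  linarith

theorem coefB_nonpos {u : ℝ} (hu : 1 ≤ u) : coefB u ≤ 0 := by
  have := profile_pos hu
  have h := profileDeriv_nonpos hu
  have : 0 ≤ (profile u / 2) ^ (-2 / 3 : ℝ) := by positivity
  rw [coefB]
  exact mul_nonpos_of_nonpos_of_nonneg (by linarith) this

/-- Put q = `profile u * u / 2`, which lies in [2/3, 1]. By `profile_add` the right-hand side
collapses to (4/9) q^(-2/3). The factor u - u⁻¹ is the bound of `norm_sq_inner_le` for |⟨z,v⟩|²/‖v‖²
on V_1 with ‖z‖² = u. -/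
theorem le_coefA_add {u : ℝ} (hu : 1 ≤ u) :
    4 / 9 ≤ (coefA u + coefB u * (u - u⁻¹)) * u ^ (1 / 3 : ℝ) := by
  have hp := profile_pos hu
  have h1 := profile_mul_self_le hu
  have h2 := le_profile_mul_self hu
  have hu0 : 0 < u := by linarith
  have e1 : coefB u * (u - u⁻¹) * u ^ (1 / 3 : ℝ)
      = coefB u * u ^ (4 / 3 : ℝ) * ((u ^ 2 - 1) / u ^ 2) := by
    rw [show (4 / 3 : ℝ) = 1 + 1 / 3 by norm_num, Real.rpow_add hu0, Real.rpow_one]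
    field_simp
  set q := profile u * u / 2 with hq
  have hq0 : 0 < q := by positivity
  have e2 : q ^ (1 / 3 : ℝ) = q * q ^ (-2 / 3 : ℝ) := by
    rw [show (1 / 3 : ℝ) = 1 + (-2 / 3) by norm_num, Real.rpow_add hq0, Real.rpow_one]
  rw [add_mul, e1, coefA_eq hu, coefB_eq hu, e2]
  have h3 := profile_add hu
  have e3 : profileDeriv u * u ^ 2 * ((u ^ 2 - 1) / u ^ 2) = 4 / 3 - 2 * q := by
    rw [hq]; field_simp; linarith
  have e4 : 2 / 3 * (q * q ^ (-2 / 3 : ℝ)) + 1 / 3 * (profileDeriv u * u ^ 2) * q ^ (-2 / 3 : ℝ)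
      * ((u ^ 2 - 1) / u ^ 2) = 4 / 9 * q ^ (-2 / 3 : ℝ) := by
    linear_combination (1 / 3 * q ^ (-2 / 3 : ℝ)) * e3
  rw [e4]
  have := Real.one_le_rpow_of_pos_of_le_one_of_nonpos (z := -2 / 3) hq0 (by linarith) (by norm_num)
  linarith

theorem tendsto_coefA : Tendsto (fun u => coefA u * u ^ (1 / 3 : ℝ)) atTop (𝓝 (2 / 3)) := by
  have h : Tendsto (fun u => 2 / 3 * (profile u * u / 2) ^ (1 / 3 : ℝ)) atTop
      (𝓝 (2 / 3 * (2 / 2 : ℝ) ^ (1 / 3 : ℝ))) :=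
    ((tendsto_profile_mul_self.div_const 2).rpow_const (Or.inl (by norm_num))).const_mul _
  norm_num at h
  refine h.congr' ?_
  filter_upwards [eventually_ge_atTop 1] with u hu
  rw [coefA_eq hu]

theorem tendsto_coefB : Tendsto (fun u => coefB u * u ^ (4 / 3 : ℝ)) atTop (𝓝 (-(2 / 9))) := by
  have h0 : Tendsto (fun u : ℝ => (4 / 3 - profile u * u) * (1 - (u⁻¹) ^ 2)⁻¹) atTop
      (𝓝 ((4 / 3 - 2) * (1 - 0 ^ 2)⁻¹)) :=
    (tendsto_const_nhds.sub tendsto_profile_mul_self).mul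
      ((tendsto_const_nhds.sub (tendsto_inv_atTop_zero.pow 2)).inv₀ (by norm_num))
  have h := ((h0.const_mul (1 / 3)).mul
    ((tendsto_profile_mul_self.div_const 2).rpow_const (p := -2 / 3) (Or.inl (by norm_num))))
  rw [show (1 / 3 * ((4 / 3 - 2) * (1 - 0 ^ 2)⁻¹) * (2 / 2) ^ (-2 / 3 : ℝ) : ℝ) = -(2 / 9) by
    norm_num] at h
  refine h.congr' ?_
  filter_upwards [eventually_gt_atTop 1] with u hu
  rw [coefB_eq hu.le]
  have h3 := profile_add hu.le
  have : u ^ 2 - 1 ≠ 0 := by nlinarith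
  congr 2
  have h4 : 4 / 3 - profile u * u = profileDeriv u * (u ^ 2 - 1) := by linarith
  rw [h4]
  field_simp

end Profile

/-! ### The metric as a quadratic form -/

section Metric

theorem real_inner_eq (z v : C4) : inner ℝ z v = (inner ℂ z v).re := by
  simp [PiLp.inner_apply]

/-- Twice the derivative of `potentialFun t`. -/
def potentialA (t : ℂ) (x : ℝ) : ℝ :=
  open Classical in
  if t = 0 then 2 / 3 * x ^ (-1 / 3 : ℝ) else ‖t‖ ^ (-1 / 3 : ℝ) * coefA (x / ‖t‖)

/-- Twice the second derivative of `potentialFun t`. -/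
def potentialB (t : ℂ) (x : ℝ) : ℝ :=
  open Classical in
  if t = 0 then -(2 / 9) * x ^ (-4 / 3 : ℝ) else ‖t‖ ^ (-4 / 3 : ℝ) * coefB (x / ‖t‖)

/-- Homogeneity of the potential: every statement about f_t reduces to t = 1 at the point x/|t|. -/
theorem potentialFun_eq {t : ℂ} (ht : t ≠ 0) (x : ℝ) :
    potentialFun t x = ‖t‖ ^ (2 / 3 : ℝ) * potentialFun 1 (x / ‖t‖) := by
  have e : (‖t‖ ^ 2 / 2) ^ (1 / 3 : ℝ) = ‖t‖ ^ (2 / 3 : ℝ) * (1 / 2) ^ (1 / 3 : ℝ) := by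
    rw [div_eq_mul_one_div, Real.mul_rpow (by positivity) (by positivity), ← Real.rpow_natCast,
      ← Real.rpow_mul (by positivity)]
    norm_num
  simp only [potentialFun, if_neg ht, if_neg one_ne_zero, e, norm_one, one_pow, div_one]
  ring

theorem hasDerivWithinAt_div_norm {f : ℝ → ℝ} {f' x s : ℝ} (hs : 0 < s)
    (h : HasDerivWithinAt f f' (Ici 1) (x / s)) :
    HasDerivWithinAt (fun y => f (y / s)) (f' / s) (Ici s) x := by
  have := h.comp x ((hasDerivWithinAt_id x (Ici s)).div_const s) (fun y hy => by
    rw [mem_Ici, id, le_div_iff₀ hs]; simpa using hy)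
  refine this.congr_deriv ?_
  ring

theorem hasDerivWithinAt_potentialFun {t : ℂ} {x : ℝ} (hx : ‖t‖ ≤ x) (hx0 : 0 < x) :
    HasDerivWithinAt (potentialFun t) (potentialA t x / 2) (Ici ‖t‖) x := by
  by_cases ht : t = 0
  · subst ht
    have h := ((Real.hasDerivAt_rpow_const (p := 2 / 3) (Or.inl hx0.ne')).div_const 2)
    refine (h.hasDerivWithinAt.congr_of_eventuallyEq ?_ ?_).congr_deriv ?_
    · filter_upwards with y; simp [potentialFun]
    · simp [potentialFun]
    · simp only [potentialA, if_true]; norm_num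
  · have hs : 0 < ‖t‖ := norm_pos_iff.2 ht
    have h := (hasDerivWithinAt_div_norm hs (hasDerivWithinAt_potentialFun_one
      ((one_le_div hs).2 hx))).const_mul (‖t‖ ^ (2 / 3 : ℝ))
    refine (h.congr_of_eventuallyEq ?_ ?_).congr_deriv ?_
    · filter_upwards with y using potentialFun_eq ht y
    · exact potentialFun_eq ht x
    · rw [potentialA, if_neg ht, show (2 / 3 : ℝ) = -1 / 3 + 1 by norm_num,
        Real.rpow_add hs, Real.rpow_one]
      field_simp

theorem hasDerivWithinAt_potentialA {t : ℂ} {x : ℝ} (hx : ‖t‖ ≤ x) (hx0 : 0 < x) :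
    HasDerivWithinAt (potentialA t) (potentialB t x) (Ici ‖t‖) x := by
  by_cases ht : t = 0
  · subst ht
    have h := ((Real.hasDerivAt_rpow_const (p := -1 / 3) (Or.inl hx0.ne')).const_mul (2 / 3))
    refine (h.hasDerivWithinAt.congr_of_eventuallyEq ?_ ?_).congr_deriv ?_
    · filter_upwards with y; simp [potentialA]
    · simp [potentialA]
    · simp only [potentialB, if_true]; norm_num; ring
  · have hs : 0 < ‖t‖ := norm_pos_iff.2 ht
    have h := (hasDerivWithinAt_div_norm hs (hasDerivWithinAt_coefA
      ((one_le_div hs).2 hx))).const_mul (‖t‖ ^ (-1 / 3 : ℝ))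
    refine (h.congr_of_eventuallyEq ?_ ?_).congr_deriv ?_
    · filter_upwards with y; simp only [potentialA, if_neg ht]
    · simp only [potentialA, if_neg ht]
    · rw [potentialB, if_neg ht, show (-1 / 3 : ℝ) = -4 / 3 + 1 by norm_num,
        Real.rpow_add hs, Real.rpow_one]
      field_simp

/-- The region is the complement of an open ball. At z ≠ 0 it contains the half-space of w with
⟨z,w⟩ ≥ ‖z‖², which is convex with nonempty interior, so derivatives within the region are unique
even on the vanishing sphere. -/
theorem uniqueDiffOn_region (t : ℂ) : UniqueDiffOn ℝ (region t) := by
  intro z hz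
  have hz' : ‖t‖ ≤ ‖z‖ ^ 2 := hz
  by_cases h0 : z = 0
  · have ht : t = 0 := by
      rw [h0] at hz'; simpa using hz'
    have : region t = univ := by
      ext w; simp [region, ht]
    rw [this]; exact uniqueDiffWithinAt_univ
  have hz2 : 0 < ‖z‖ ^ 2 := by have := norm_pos_iff.2 h0; positivity
  have hsub : {w : C4 | ‖z‖ ^ 2 ≤ inner ℝ z w} ⊆ region t := by
    intro w hw
    have h1 : ‖z‖ ^ 2 ≤ inner ℝ z w := hw
    have h2 := real_inner_le_norm z w
    have h3 : ‖z‖ ≤ ‖w‖ := by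
      have := norm_pos_iff.2 h0
      nlinarith
    exact hz'.trans (by gcongr)
  refine UniqueDiffWithinAt.mono (uniqueDiffWithinAt_convex ?_ ?_ ?_) hsub
  · exact convex_halfSpace_ge (f := fun w => inner ℝ z w)
      ⟨fun a b => inner_add_right _ _ _, fun c a => by simp [inner_smul_right]⟩ _
  · have hopen : IsOpen {w : C4 | ‖z‖ ^ 2 < inner ℝ z w} :=
      isOpen_lt continuous_const (by fun_prop)
    have hsub' : {w : C4 | ‖z‖ ^ 2 < inner ℝ z w} ⊆ {w : C4 | ‖z‖ ^ 2 ≤ inner ℝ z w} :=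
      fun w (hw : ‖z‖ ^ 2 < inner ℝ z w) => hw.le
    refine ⟨(2 : ℝ) • z, interior_maximal hsub' hopen ?_⟩
    show ‖z‖ ^ 2 < inner ℝ z ((2 : ℝ) • z)
    rw [inner_smul_right, real_inner_self_eq_norm_sq]
    linarith
  · refine subset_closure ?_
    show ‖z‖ ^ 2 ≤ inner ℝ z z
    rw [real_inner_self_eq_norm_sq]

theorem hasFDerivWithinAt_comp_norm_sq {f : ℝ → ℝ} {f' : ℝ} {t : ℂ} {z : C4}
    (h : HasDerivWithinAt f f' (Ici ‖t‖) (‖z‖ ^ 2)) :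
    HasFDerivWithinAt (fun w : C4 => f (‖w‖ ^ 2)) ((2 * f') • innerSL ℝ z) (region t) z := by
  have h1 := (hasStrictFDerivAt_norm_sq (F := C4) z).hasFDerivAt.hasFDerivWithinAt (s := region t)
  have h2 := h.comp_hasFDerivWithinAt z h1 (fun w hw => hw)
  refine h2.congr_fderiv ?_
  ext w
  simp
  ring

theorem fderivWithin_potential {t : ℂ} {z : C4} (hz : z ∈ region t) (h0 : z ≠ 0) :
    fderivWithin ℝ (potential t) (region t) z = potentialA t (‖z‖ ^ 2) • innerSL ℝ z := by
  have hz2 : 0 < ‖z‖ ^ 2 := by have := norm_pos_iff.2 h0; positivity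
  have h := hasFDerivWithinAt_comp_norm_sq (hasDerivWithinAt_potentialFun hz hz2)
  rw [mul_div_cancel₀ _ two_ne_zero] at h
  exact h.fderivWithin (uniqueDiffOn_region t z hz)

theorem iteratedFDerivWithin_potential {t : ℂ} {z : C4} (hz : z ∈ region t) (h0 : z ≠ 0)
    (v w : C4) :
    iteratedFDerivWithin ℝ 2 (potential t) (region t) z ![v, w]
      = potentialA t (‖z‖ ^ 2) * inner ℝ v w
        + 2 * potentialB t (‖z‖ ^ 2) * inner ℝ z v * inner ℝ z w := by
  have hz2 : 0 < ‖z‖ ^ 2 := by have := norm_pos_iff.2 h0; positivity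
  rw [iteratedFDerivWithin_two_apply' _ (uniqueDiffOn_region t) hz]
  have hA := hasFDerivWithinAt_comp_norm_sq (hasDerivWithinAt_potentialA hz hz2)
  have hI : HasFDerivWithinAt (fun y : C4 => innerSL ℝ y) (innerSL ℝ (E := C4)) (region t) z :=
    (innerSL ℝ (E := C4)).hasFDerivWithinAt
  have h := hA.smul hI
  have hev : fderivWithin ℝ (potential t) (region t) =ᶠ[𝓝[region t] z]
      fun y => potentialA t (‖y‖ ^ 2) • innerSL ℝ y := by
    filter_upwards [self_mem_nhdsWithin, mem_nhdsWithin_of_mem_nhds (isOpen_ne.mem_nhds h0)]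
      with y hy hy0 using fderivWithin_potential hy hy0
  rw [(h.congr_of_eventuallyEq hev (fderivWithin_potential hz h0)).fderivWithin
    (uniqueDiffOn_region t z hz)]
  simp
  exact Or.inl rfl

/-- The metric is the mean of the real Hessian on v and on iv, and the squares of the real inner
products of z with v and iv add up to |⟨z,v⟩|². -/
theorem coMetric_eq {t : ℂ} {z : C4} (hz : z ∈ region t) (h0 : z ≠ 0) (v : C4) :
    coMetric t z v v = potentialA t (‖z‖ ^ 2) * ‖v‖ ^ 2
      + potentialB t (‖z‖ ^ 2) * ‖(inner ℂ z v : ℂ)‖ ^ 2 := by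
  rw [coMetric, coForm, ddbar, iteratedFDerivWithin_potential hz h0,
    iteratedFDerivWithin_potential hz h0]
  have hI : ‖Complex.I • v‖ = ‖v‖ := by rw [norm_smul, Complex.norm_I, one_mul]
  simp only [real_inner_eq, inner_smul_right, ← Complex.normSq_eq_norm_sq,
    Complex.normSq_apply, inner_self_eq_norm_sq_to_K]
  simp [hI]
  rw [← Complex.ofReal_pow, Complex.ofReal_re]
  ring

theorem coMetric_smul (t : ℂ) (z v : C4) (k : ℝ) :
    coMetric t z (k • v) (k • v) = k ^ 2 * coMetric t z v v := by
  have key : ∀ a b : C4, iteratedFDerivWithin ℝ 2 (potential t) (region t) z ![k • a, k • b]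
      = k ^ 2 * iteratedFDerivWithin ℝ 2 (potential t) (region t) z ![a, b] := by
    intro a b
    have := (iteratedFDerivWithin ℝ 2 (potential t) (region t) z).map_smul_univ
      (fun _ => k) ![a, b]
    simp only [Fin.prod_univ_two, smul_eq_mul] at this
    rw [sq, ← this]
    congr 1
    ext i
    fin_cases i <;> rfl
  rw [coMetric, coMetric, coForm, coForm, ddbar, ddbar]
  simp only [smul_comm Complex.I k, key]
  ring

theorem coMetric_zero (t : ℂ) (z : C4) : coMetric t z 0 0 = 0 := by
  simpa using coMetric_smul t z 0 0

/-! ### The bilinear form of the quadric and its tangent vectors. -/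

/-- The complex bilinear form `∑ z_i w_i`. -/
def dot (z w : C4) : ℂ := ∑ i, z i * w i

theorem mem_quadric_iff {t : ℂ} {z : C4} : z ∈ quadric t ↔ dot z z = t := by
  simp [quadric, dot, sq]

/-- Coordinatewise complex conjugation, as a real-linear map. -/
def conjC4 : C4 →L[ℝ] C4 :=
  LinearMap.toContinuousLinearMap
    { toFun := fun z => WithLp.toLp 2 fun i => starRingEnd ℂ (z i)
      map_add' := fun z w => by ext i; simp
      map_smul' := fun c z => by ext i; simp }

@[simp] theorem conjC4_apply (z : C4) (i : Fin 4) : conjC4 z i = starRingEnd ℂ (z i) := rfl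

@[simp] theorem conjC4_conjC4 (z : C4) : conjC4 (conjC4 z) = z := by ext i; simp

@[simp] theorem norm_conjC4 (z : C4) : ‖conjC4 z‖ = ‖z‖ := by
  simp [EuclideanSpace.norm_eq]

@[simp] theorem conjC4_smul (c : ℂ) (z : C4) : conjC4 (c • z) = starRingEnd ℂ c • conjC4 z := by
  ext i; simp

theorem inner_conjC4_left (z v : C4) : inner ℂ (conjC4 z) v = dot z v := by
  simp [PiLp.inner_apply, dot, mul_comm]

theorem inner_conjC4_right (z v : C4) : inner ℂ z (conjC4 v) = starRingEnd ℂ (dot z v) := by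
  simp [PiLp.inner_apply, dot, mul_comm]

theorem inner_conjC4_conjC4 (z v : C4) :
    inner ℂ (conjC4 z) (conjC4 v) = starRingEnd ℂ (inner ℂ z v) := by
  simp [PiLp.inner_apply, mul_comm]

theorem norm_dot_le (z v : C4) : ‖dot z v‖ ≤ ‖z‖ * ‖v‖ := by
  rw [← inner_conjC4_left, ← norm_conjC4 z]
  exact norm_inner_le_norm _ _

/-- For `z ∈ V_t` and `v` tangent to `V_t`, the component of `v` along `z` is controlled. -/
theorem norm_sq_inner_le {t : ℂ} {z v : C4} (hz : z ∈ quadric t) (hv : dot z v = 0) (h0 : z ≠ 0) :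
    ‖(inner ℂ z v : ℂ)‖ ^ 2 ≤ (‖z‖ ^ 2 - ‖t‖ ^ 2 / ‖z‖ ^ 2) * ‖v‖ ^ 2 := by
  rw [mem_quadric_iff] at hz
  have hz0 : 0 < ‖z‖ := norm_pos_iff.2 h0
  -- Tangency means that v is orthogonal to z̄. So z may be replaced in ⟨z,v⟩ by its component w
  -- orthogonal to z̄, and ‖w‖² = ‖z‖² - |t|²/‖z‖².
  set c : ℂ := t / (‖z‖ : ℂ) ^ 2 with hc
  set w : C4 := z - starRingEnd ℂ (starRingEnd ℂ c) • conjC4 z with hw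
  have h1 : (inner ℂ w v : ℂ) = inner ℂ z v := by
    rw [hw, inner_sub_left, inner_smul_left, inner_conjC4_left, hv]; simp
  have h2 : ‖w‖ ^ 2 = ‖z‖ ^ 2 - ‖t‖ ^ 2 / ‖z‖ ^ 2 := by
    have h3 : ((‖w‖ ^ 2 : ℝ) : ℂ) = ((‖z‖ ^ 2 - ‖t‖ ^ 2 / ‖z‖ ^ 2 : ℝ) : ℂ) := by
      push_cast
      have e1 : (‖w‖ : ℂ) ^ 2 = inner ℂ w w := (inner_self_eq_norm_sq_to_K w).symm
      have e2 : (‖z‖ : ℂ) ^ 2 = inner ℂ z z := (inner_self_eq_norm_sq_to_K z).symm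
      have e3 : (‖t‖ : ℂ) ^ 2 = t * starRingEnd ℂ t := (Complex.mul_conj' t).symm
      have hne : (‖z‖ : ℂ) ≠ 0 := by exact_mod_cast hz0.ne'
      rw [e1, e3, hw, inner_sub_left, inner_sub_right, inner_sub_right, inner_smul_left,
        inner_smul_left, inner_smul_right, inner_smul_right, inner_conjC4_conjC4,
        inner_conjC4_left, inner_conjC4_right, hz, ← e2, hc]
      simp
      field_simp
      ring
    exact_mod_cast h3
  rw [← h1, ← h2, ← mul_pow]
  gcongr
  exact norm_inner_le_norm _ _

theorem norm_le_norm_sq {t : ℂ} {z : C4} (hz : z ∈ quadric t) : ‖t‖ ≤ ‖z‖ ^ 2 :=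
  quadric_subset_region t hz

/-! ### Two-sided comparison of the metric with ‖v‖²/r. -/

theorem potentialB_nonpos {t : ℂ} {x : ℝ} (hx : ‖t‖ ≤ x) (hx0 : 0 < x) : potentialB t x ≤ 0 := by
  by_cases ht : t = 0
  · simp only [potentialB, if_pos ht]
    have : 0 < x ^ (-4 / 3 : ℝ) := by positivity
    linarith
  · have hs : 0 < ‖t‖ := norm_pos_iff.2 ht
    simp only [potentialB, if_neg ht]
    exact mul_nonpos_of_nonneg_of_nonpos (by positivity) (coefB_nonpos ((one_le_div hs).2 hx))

theorem rpow_neg_third {s x : ℝ} (hs : 0 < s) (hx : 0 < x) :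
    s ^ (-1 / 3 : ℝ) = (x / s) ^ (1 / 3 : ℝ) * x ^ (-1 / 3 : ℝ) := by
  rw [Real.div_rpow hx.le hs.le, neg_div, Real.rpow_neg hs.le, Real.rpow_neg hx.le]
  field_simp

theorem potentialA_le {t : ℂ} {x : ℝ} (hx : ‖t‖ ≤ x) (hx0 : 0 < x) :
    potentialA t x ≤ 2 / 3 * x ^ (-1 / 3 : ℝ) := by
  by_cases ht : t = 0
  · simp only [potentialA, if_pos ht]; rfl
  · have hs : 0 < ‖t‖ := norm_pos_iff.2 ht
    simp only [potentialA, if_neg ht]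
    rw [rpow_neg_third hs hx0]
    have := mul_le_mul_of_nonneg_right (coefA_mul_le ((one_le_div hs).2 hx))
      (show 0 ≤ x ^ (-1 / 3 : ℝ) by positivity)
    linarith

theorem le_potentialA_add {t : ℂ} {x : ℝ} (hx : ‖t‖ ≤ x) (hx0 : 0 < x) :
    4 / 9 * x ^ (-1 / 3 : ℝ) ≤ potentialA t x + potentialB t x * (x - ‖t‖ ^ 2 / x) := by
  by_cases ht : t = 0
  · simp only [potentialA, potentialB, if_pos ht]
    have : x ^ (-1 / 3 : ℝ) = x ^ (-4 / 3 : ℝ) * x := by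
      rw [show (-1 / 3 : ℝ) = -4 / 3 + 1 by norm_num, Real.rpow_add hx0, Real.rpow_one]
    rw [this, ht, norm_zero]
    apply le_of_eq
    ring
  · have hs : 0 < ‖t‖ := norm_pos_iff.2 ht
    simp only [potentialA, potentialB, if_neg ht]
    have e : ‖t‖ ^ (-4 / 3 : ℝ) * coefB (x / ‖t‖) * (x - ‖t‖ ^ 2 / x)
        = ‖t‖ ^ (-1 / 3 : ℝ) * (coefB (x / ‖t‖) * (x / ‖t‖ - (x / ‖t‖)⁻¹)) := by
      rw [show (-1 / 3 : ℝ) = -4 / 3 + 1 by norm_num, Real.rpow_add hs, Real.rpow_one]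
      field_simp
    rw [e, ← mul_add, rpow_neg_third hs hx0]
    have := mul_le_mul_of_nonneg_right (le_coefA_add ((one_le_div hs).2 hx))
      (show 0 ≤ x ^ (-1 / 3 : ℝ) by positivity)
    linarith

theorem coMetric_le {t : ℂ} {z : C4} (hz : z ∈ region t) (h0 : z ≠ 0) (v : C4) :
    coMetric t z v v ≤ 2 / 3 * (‖z‖ ^ 2) ^ (-1 / 3 : ℝ) * ‖v‖ ^ 2 := by
  have hz2 : 0 < ‖z‖ ^ 2 := by have := norm_pos_iff.2 h0; positivity
  rw [coMetric_eq hz h0]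
  have h1 := mul_le_mul_of_nonneg_right (potentialA_le hz hz2) (sq_nonneg ‖v‖)
  have h2 := mul_nonpos_of_nonpos_of_nonneg (potentialB_nonpos hz hz2)
    (sq_nonneg ‖(inner ℂ z v : ℂ)‖)
  linarith

/-- As B ≤ 0, the worst case is the largest |⟨z,v⟩|² that tangency allows. With `coMetric_le` this
makes the metric uniformly comparable to ‖v‖²/r, because (‖z‖²)^(1/3) = r. -/
theorem le_coMetric {t : ℂ} {z v : C4} (hz : z ∈ quadric t) (h0 : z ≠ 0) (hv : dot z v = 0) :
    4 / 9 * (‖z‖ ^ 2) ^ (-1 / 3 : ℝ) * ‖v‖ ^ 2 ≤ coMetric t z v v := by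
  have hz2 : 0 < ‖z‖ ^ 2 := by have := norm_pos_iff.2 h0; positivity
  have hr := quadric_subset_region t hz
  rw [coMetric_eq hr h0]
  have h1 := mul_le_mul_of_nonneg_right (le_potentialA_add hr hz2) (sq_nonneg ‖v‖)
  have h2 := mul_le_mul_of_nonpos_left (norm_sq_inner_le hz hv h0) (potentialB_nonpos hr hz2)
  linarith

/-- The cone metric has the scalar coefficients of the potential `r² / 2`. -/
theorem coMetric_zero_eq {z : C4} (h0 : z ≠ 0) (v : C4) :
    coMetric 0 z v v = 2 / 3 * (‖z‖ ^ 2) ^ (-1 / 3 : ℝ) * ‖v‖ ^ 2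
      - 2 / 9 * (‖z‖ ^ 2) ^ (-4 / 3 : ℝ) * ‖(inner ℂ z v : ℂ)‖ ^ 2 := by
  rw [coMetric_eq (by simp [region]) h0]
  simp only [potentialA, potentialB, if_true]
  ring

/-- Far from the vanishing sphere the coefficients approach those of the cone. -/
theorem exists_potential_asymptotics {ε : ℝ} (hε : 0 < ε) : ∃ K : ℝ, 1 ≤ K ∧ ∀ (t : ℂ) (x : ℝ),
    t ≠ 0 → K * ‖t‖ ≤ x →
    |potentialA t x - 2 / 3 * x ^ (-1 / 3 : ℝ)| ≤ ε * x ^ (-1 / 3 : ℝ) ∧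
    |potentialB t x + 2 / 9 * x ^ (-4 / 3 : ℝ)| ≤ ε * x ^ (-4 / 3 : ℝ) := by
  have hA := Metric.tendsto_nhds.1 tendsto_coefA ε hε
  have hB := Metric.tendsto_nhds.1 tendsto_coefB ε hε
  obtain ⟨K, hK⟩ := eventually_atTop.1 (hA.and hB)
  refine ⟨max K 1, le_max_right _ _, fun t x ht hx => ?_⟩
  have hs : 0 < ‖t‖ := norm_pos_iff.2 ht
  have hx0 : 0 < x := lt_of_lt_of_le (by positivity) hx
  obtain ⟨h1, h2⟩ := hK (x / ‖t‖) (by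
    rw [le_div_iff₀ hs]
    exact (mul_le_mul_of_nonneg_right (le_max_left _ _) hs.le).trans hx)
  rw [Real.dist_eq] at h1 h2
  have e4 : ‖t‖ ^ (-4 / 3 : ℝ) = (x / ‖t‖) ^ (4 / 3 : ℝ) * x ^ (-4 / 3 : ℝ) := by
    rw [Real.div_rpow hx0.le hs.le, neg_div, Real.rpow_neg hs.le, Real.rpow_neg hx0.le]
    field_simp
  simp only [potentialA, potentialB, if_neg ht]
  constructor
  · rw [rpow_neg_third hs hx0]
    have hp : 0 < x ^ (-1 / 3 : ℝ) := by positivity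
    rw [show (x / ‖t‖) ^ (1 / 3 : ℝ) * x ^ (-1 / 3 : ℝ) * coefA (x / ‖t‖) - 2 / 3 * x ^ (-1 / 3 : ℝ)
      = (coefA (x / ‖t‖) * (x / ‖t‖) ^ (1 / 3 : ℝ) - 2 / 3) * x ^ (-1 / 3 : ℝ) by ring, abs_mul,
      abs_of_pos hp]
    gcongr
  · rw [e4]
    have hp : 0 < x ^ (-4 / 3 : ℝ) := by positivity
    rw [show (x / ‖t‖) ^ (4 / 3 : ℝ) * x ^ (-4 / 3 : ℝ) * coefB (x / ‖t‖) + 2 / 9 * x ^ (-4 / 3 : ℝ)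
      = (coefB (x / ‖t‖) * (x / ‖t‖) ^ (4 / 3 : ℝ) - -(2 / 9)) * x ^ (-4 / 3 : ℝ) by ring, abs_mul,
      abs_of_pos hp]
    gcongr

end Metric

/-! ### Lengths and distances -/

theorem PwC1.split {E : Type*} [NormedAddCommGroup E] [NormedSpace ℝ E] {γ : ℝ → E} {a b c : ℝ}
    (h : PwC1 γ a b) (hac : a < c) (hcb : c < b) : PwC1 γ a c ∧ PwC1 γ c b := by
  induction h with
  | single h hγ =>
    exact ⟨.single hac (hγ.mono (Icc_subset_Icc_right hcb.le)),
      .single hcb (hγ.mono (Icc_subset_Icc_left hac.le))⟩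
  | @cons a m b h hγ hbc ih =>
    rcases lt_trichotomy c m with hcm | rfl | hmc
    · exact ⟨.single hac (hγ.mono (Icc_subset_Icc_right hcm.le)),
        .cons hcm (hγ.mono (Icc_subset_Icc_left hac.le)) hbc⟩
    · exact ⟨.single h hγ, hbc⟩
    · exact ⟨.cons h hγ (ih hmc hcb).1, (ih hmc hcb).2⟩

section Length

variable {t : ℂ} {γ : ℝ → C4} {p q w : C4} {a b : ℝ}

/-- The speed of a curve with respect to `g_{co,t}`. -/
def coSpeed (t : ℂ) (γ : ℝ → C4) (s : ℝ) : ℝ≥0∞ :=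
  ENNReal.ofReal √(coMetric t (γ s) (deriv γ s) (deriv γ s))

theorem coLength_eq (t : ℂ) (γ : ℝ → C4) : coLength t γ = ∫⁻ s in Icc 0 1, coSpeed t γ s := rfl

theorem coSpeed_affine (t : ℂ) (γ : ℝ → C4) (k d s : ℝ) :
    coSpeed t (fun s => γ (k * s + d)) s = ENNReal.ofReal |k| * coSpeed t γ (k * s + d) := by
  have h : deriv (fun s => γ (k * s + d)) s = k • deriv γ (k * s + d) := by
    rw [deriv_comp_mul_left k (fun s => γ (s + d)) s, deriv_comp_add_const]
  rw [coSpeed, coSpeed, h, coMetric_smul, Real.sqrt_mul (sq_nonneg k), Real.sqrt_sq_eq_abs,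
    ENNReal.ofReal_mul (abs_nonneg k)]

theorem lintegral_coSpeed_affine (t : ℂ) (γ : ℝ → C4) {k : ℝ} (hk : k ≠ 0) (d : ℝ) (S : Set ℝ)
    (hS : MeasurableSet S) :
    ∫⁻ s in S, coSpeed t (fun s => γ (k * s + d)) s
      = ∫⁻ s in (fun s => k * s + d) '' S, coSpeed t γ s := by
  rw [lintegral_image_eq_lintegral_abs_deriv_mul hS (f' := fun _ => k)]
  · simp only [coSpeed_affine]
  · intro x _
    simpa using (((hasDerivAt_id x).const_mul k).add_const d).hasDerivWithinAt
  · intro x _ y _ hxy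
    simpa [hk] using hxy

theorem lintegral_coSpeed_congr {γ' : ℝ → C4} (h : EqOn γ γ' (Ioo a b)) :
    ∫⁻ s in Icc a b, coSpeed t γ s = ∫⁻ s in Icc a b, coSpeed t γ' s := by
  rw [← Measure.restrict_congr_set (Ioo_ae_eq_Icc (a := a) (b := b))]
  refine setLIntegral_congr_fun measurableSet_Ioo fun s hs => ?_
  have hev : γ =ᶠ[𝓝 s] γ' := by
    filter_upwards [Ioo_mem_nhds hs.1 hs.2] with x hx using h hx
  simp only [coSpeed, hev.deriv_eq, h hs]

theorem lintegral_Icc_split (f : ℝ → ℝ≥0∞) {a b c : ℝ} (hab : a ≤ b) (hbc : b ≤ c) :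
    ∫⁻ s in Icc a c, f s = (∫⁻ s in Icc a b, f s) + ∫⁻ s in Icc b c, f s := by
  rw [← Icc_union_Ioc_eq_Icc hab hbc,
      lintegral_union measurableSet_Ioc
        (by rw [disjoint_left]; rintro x ⟨_, h1⟩ ⟨h2, _⟩; exact absurd h1 (not_le.2 h2)),
      Measure.restrict_congr_set (Ioc_ae_eq_Icc (a := b) (b := c))]

theorem coDist_le_coLength (h : IsCurve t p q γ) : coDist t p q ≤ coLength t γ :=
  iInf₂_le γ h

theorem coDist_comm_le (t : ℂ) (p q : C4) : coDist t p q ≤ coDist t q p := by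
  refine le_iInf₂ fun γ hγ => ?_
  obtain ⟨hpw, hmem, h0, h1⟩ := hγ
  have hcurve : IsCurve t p q (fun s => γ (-1 * s + 1)) := by
    refine ⟨piecewiseC1_iff.2 ?_, ?_, by simpa using h1, by simpa using h0⟩
    · have := (piecewiseC1_iff.1 hpw).comp_neg
      have := PwC1.comp_affine (γ := fun s => γ (-s)) (k := 1) one_pos (-1) (a := 0) (b := 1)
        (by simpa using this)
      exact this.congr (fun s _ => by simp only; congr 1; ring)
    · rintro s ⟨hs0, hs1⟩
      exact hmem _ ⟨by linarith, by linarith⟩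
  refine (coDist_le_coLength hcurve).trans_eq ?_
  rw [coLength_eq, lintegral_coSpeed_affine t γ (by norm_num) 1 _ measurableSet_Icc, coLength_eq]
  have : (fun s : ℝ => -1 * s + 1) '' Icc 0 1 = Icc 0 1 := by
    have : (fun s : ℝ => -1 * s + 1) = fun s => 1 - s := by ext; ring
    rw [this, image_const_sub_Icc]; simp
  rw [this]

theorem coDist_comm (t : ℂ) (p q : C4) : coDist t p q = coDist t q p :=
  le_antisymm (coDist_comm_le t p q) (coDist_comm_le t q p)

theorem coDist_triangle (t : ℂ) (p q w : C4) : coDist t p w ≤ coDist t p q + coDist t q w := by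
  conv_rhs => rw [coDist, coDist]
  simp only [ENNReal.iInf_add, ENNReal.add_iInf]
  refine le_iInf fun γ₂ => le_iInf fun h₂ => le_iInf fun γ₁ => le_iInf fun h₁ => ?_
  obtain ⟨hpw₁, hmem₁, h₁0, h₁1⟩ := h₁
  obtain ⟨hpw₂, hmem₂, h₂0, h₂1⟩ := h₂
  set γ : ℝ → C4 := fun s => if s ≤ 1 / 2 then γ₁ (2 * s + 0) else γ₂ (2 * s + (-1)) with hγ
  have e1 : EqOn γ (fun s => γ₁ (2 * s + 0)) (Icc 0 (1 / 2)) := fun s hs => if_pos hs.2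
  have e2 : EqOn γ (fun s => γ₂ (2 * s + (-1))) (Icc (1 / 2) 1) := by
    intro s hs
    rcases hs.1.eq_or_lt with h | h
    · rw [← h, hγ]
      norm_num [h₁1, h₂0]
    · exact if_neg (not_le.2 h)
  have hcurve : IsCurve t p w γ := by
    refine ⟨piecewiseC1_iff.2 ?_, ?_, ?_, ?_⟩
    · refine PwC1.trans (b := 1 / 2) ?_ ?_
      · refine (PwC1.comp_affine two_pos 0 ?_).congr e1
        norm_num; exact piecewiseC1_iff.1 hpw₁
      · refine (PwC1.comp_affine two_pos (-1) ?_).congr e2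
        norm_num; exact piecewiseC1_iff.1 hpw₂
    · rintro s ⟨hs0, hs1⟩
      rcases le_total s (1 / 2) with h | h
      · rw [e1 ⟨hs0, h⟩]; exact hmem₁ _ ⟨by linarith, by linarith⟩
      · rw [e2 ⟨h, hs1⟩]; exact hmem₂ _ ⟨by linarith, by linarith⟩
    · rw [e1 (by norm_num)]; simpa using h₁0
    · rw [e2 (by norm_num)]; norm_num [h₂1]
  refine (coDist_le_coLength hcurve).trans_eq ?_
  rw [coLength_eq, lintegral_Icc_split _ (show (0 : ℝ) ≤ 1 / 2 by norm_num) (by norm_num),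
    lintegral_coSpeed_congr (e1.mono Ioo_subset_Icc_self),
    lintegral_coSpeed_congr (e2.mono Ioo_subset_Icc_self),
    lintegral_coSpeed_affine _ _ two_ne_zero _ _ measurableSet_Icc,
    lintegral_coSpeed_affine _ _ two_ne_zero _ _ measurableSet_Icc,
    image_affine_Icc' two_pos, image_affine_Icc' two_pos, coLength_eq, coLength_eq]
  norm_num

/-- The speed is bounded on the open interval only: γ is unconstrained outside [0, 1], so `deriv γ`
is not controlled at the endpoints. -/
theorem coDist_le_of_contDiffOn {C : ℝ} (hγ : ContDiffOn ℝ 1 γ (Icc 0 1))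
    (hmem : ∀ s ∈ Icc (0 : ℝ) 1, γ s ∈ quadric t) (h0 : γ 0 = p) (h1 : γ 1 = q) (hC : 0 ≤ C)
    (hsp : ∀ s ∈ Ioo (0 : ℝ) 1, coMetric t (γ s) (deriv γ s) (deriv γ s) ≤ C ^ 2) :
    coDist t p q ≤ ENNReal.ofReal C := by
  have hcurve : IsCurve t p q γ := ⟨piecewiseC1_iff.2 (.single one_pos hγ), hmem, h0, h1⟩
  refine (coDist_le_coLength hcurve).trans ?_
  rw [coLength_eq, ← Measure.restrict_congr_set (Ioo_ae_eq_Icc (a := (0 : ℝ)) (b := 1))]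
  calc _ ≤ ∫⁻ s in Ioo (0 : ℝ) 1, ENNReal.ofReal C := by
        refine setLIntegral_mono' measurableSet_Ioo fun s hs => ENNReal.ofReal_le_ofReal ?_
        rw [Real.sqrt_le_left hC]
        exact hsp s hs
    _ = ENNReal.ofReal C := by simp

theorem coDist_self (hp : p ∈ quadric t) : coDist t p p = 0 := by
  have := coDist_le_of_contDiffOn (t := t) (γ := fun _ => p) (p := p) (q := p) (C := 0)
    contDiffOn_const (fun _ _ => hp) rfl rfl le_rfl (fun s _ => by simp [coMetric_zero])
  simpa using this

/-! ### Lower bounds for lengths by Lipschitz functions. -/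

theorem dot_comm (z v : C4) : dot z v = dot v z := by simp [dot, mul_comm]

theorem hasDerivAt_dot_self {s : ℝ} {v : C4} (h : HasDerivAt γ v s) :
    HasDerivAt (fun s => dot (γ s) (γ s)) (2 * dot (γ s) v) s := by
  have hi : ∀ i, HasDerivAt (fun s => γ s i) (v i) s := fun i =>
    (hasDerivAt_pi.1 ((PiLp.continuousLinearEquiv 2 ℝ (fun _ : Fin 4 => ℂ)).hasFDerivAt.comp_hasDerivAt
      s h)) i
  have := HasDerivAt.fun_sum (u := Finset.univ) (fun i _ => (hi i).mul (hi i))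
  refine this.congr_deriv ?_
  rw [dot, Finset.mul_sum]
  exact Finset.sum_congr rfl fun i _ => by ring

theorem PwC1.ae_tangent (h : PwC1 γ a b) (hmem : ∀ s ∈ Icc a b, γ s ∈ quadric t) :
    ∀ᵐ s ∂volume.restrict (Icc a b),
      s ∈ Ioo a b ∧ HasDerivAt γ (deriv γ s) s ∧ dot (γ s) (deriv γ s) = 0 := by
  have h1 := h.ae_differentiableAt
  rw [← Measure.restrict_congr_set (Ioo_ae_eq_Icc (a := a) (b := b))] at h1 ⊢
  filter_upwards [h1, ae_restrict_mem measurableSet_Ioo] with s hs hs'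
  refine ⟨hs', hs.hasDerivAt, ?_⟩
  have h2 := hasDerivAt_dot_self hs.hasDerivAt
  have h3 : HasDerivAt (fun s => dot (γ s) (γ s)) 0 s := by
    refine (hasDerivAt_const s t).congr_of_eventuallyEq ?_
    filter_upwards [Ioo_mem_nhds hs'.1 hs'.2] with x hx
    exact mem_quadric_iff.1 (hmem x ⟨hx.1.le, hx.2.le⟩)
  have := h2.unique h3
  simpa using this

/-- A function whose differential on tangent vectors is at most C times the metric norm varies along
a curve by at most C times its length; tangency of the velocity holds almost everywhere, which
suffices. -/
theorem PwC1.enorm_sub_comp_le {E : Type*} [NormedAddCommGroup E] [NormedSpace ℝ E]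
    [CompleteSpace E] {f : C4 → E} {f' : C4 → C4 →L[ℝ] E} (hf : ContDiff ℝ 1 f)
    (hf' : ∀ z, HasFDerivAt f (f' z) z) {C : ℝ} (hC : 0 ≤ C)
    (hbound : ∀ z ∈ quadric t, ∀ v, dot z v = 0 → ‖f' z v‖ ≤ C * √(coMetric t z v v))
    (h : PwC1 γ a b) (hmem : ∀ s ∈ Icc a b, γ s ∈ quadric t) :
    ‖f (γ b) - f (γ a)‖ₑ ≤ ENNReal.ofReal C * ∫⁻ s in Icc a b, coSpeed t γ s := by
  have h1 := (h.map hf.contDiffOn (mapsTo_univ γ (Icc a b))).enorm_sub_le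
  refine h1.trans ?_
  rw [← lintegral_const_mul' _ _ ENNReal.ofReal_ne_top]
  refine lintegral_mono_ae ?_
  filter_upwards [h.ae_tangent hmem] with s hs
  obtain ⟨hs', hd, ht⟩ := hs
  have h2 : deriv (f ∘ γ) s = f' (γ s) (deriv γ s) := ((hf' (γ s)).comp_hasDerivAt s hd).deriv
  rw [h2, coSpeed, ← ENNReal.ofReal_mul hC, ← ofReal_norm]
  exact ENNReal.ofReal_le_ofReal (hbound _ (hmem s ⟨hs'.1.le, hs'.2.le⟩) _ ht)

theorem radius_eq (z : C4) : radius z = (‖z‖ ^ 2) ^ (1 / 3 : ℝ) := by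
  rw [radius, ← Real.rpow_natCast, ← Real.rpow_mul (norm_nonneg z)]
  norm_num

theorem radius_nonneg (z : C4) : 0 ≤ radius z := by unfold radius; positivity

theorem le_sqrt_coMetric {z v : C4} (hz : z ∈ quadric t) (h0 : z ≠ 0) (hv : dot z v = 0) :
    2 / 3 * (‖z‖ ^ 2) ^ (-1 / 6 : ℝ) * ‖v‖ ≤ √(coMetric t z v v) := by
  refine Real.le_sqrt_of_sq_le (le_trans (le_of_eq ?_) (le_coMetric hz h0 hv))
  have e : ((‖z‖ ^ 2) ^ (-1 / 6 : ℝ)) ^ 2 = (‖z‖ ^ 2) ^ (-1 / 3 : ℝ) := by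
    rw [← Real.rpow_natCast ((‖z‖ ^ 2) ^ (-1 / 6 : ℝ)) 2, ← Real.rpow_mul (by positivity)]
    norm_num
  rw [mul_pow, mul_pow, e]
  norm_num

/-- The gradient of r is at most (2/3) r^(-1/2), exactly the square root of the lower bound for the
metric, so r has Lipschitz constant 1. Since r is not differentiable at the cone point, the argument
runs with (‖z‖² + δ)^(1/3), and then δ → 0. -/
theorem PwC1.ofReal_abs_radius_sub_le (h : PwC1 γ a b) (hmem : ∀ s ∈ Icc a b, γ s ∈ quadric t) :
    ENNReal.ofReal |radius (γ b) - radius (γ a)| ≤ ∫⁻ s in Icc a b, coSpeed t γ s := by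
  have key : ∀ δ : ℝ, 0 < δ → ENNReal.ofReal |(‖γ b‖ ^ 2 + δ) ^ (1 / 3 : ℝ)
      - (‖γ a‖ ^ 2 + δ) ^ (1 / 3 : ℝ)| ≤ ∫⁻ s in Icc a b, coSpeed t γ s := by
    intro δ hδ
    have hd : ∀ z : C4, HasFDerivAt (fun z : C4 => (‖z‖ ^ 2 + δ) ^ (1 / 3 : ℝ))
        ((1 / 3 * (‖z‖ ^ 2 + δ) ^ (1 / 3 - 1 : ℝ)) • (2 • innerSL ℝ z)) z := by
      intro z
      exact (((hasStrictFDerivAt_norm_sq (F := C4) z).hasFDerivAt).add_const δ).rpow_const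
        (Or.inl (by positivity))
    have := PwC1.enorm_sub_comp_le (t := t) (C := 1)
      (f := fun z : C4 => (‖z‖ ^ 2 + δ) ^ (1 / 3 : ℝ)) ?_ hd zero_le_one ?_ h hmem
    · rw [← ofReal_norm] at this
      simpa using this
    · exact ((contDiff_norm_sq ℝ).add contDiff_const).rpow_const_of_ne
        (fun z => by positivity)
    · intro z hz v hv
      by_cases h0 : z = 0
      · subst h0; simp
      have hz0 : 0 < ‖z‖ := norm_pos_iff.2 h0
      rw [one_mul]
      refine le_trans ?_ (le_sqrt_coMetric hz h0 hv)
      have e : ((1 / 3 * (‖z‖ ^ 2 + δ) ^ (1 / 3 - 1 : ℝ)) • (2 • innerSL ℝ z)) v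
          = 2 / 3 * (‖z‖ ^ 2 + δ) ^ (-2 / 3 : ℝ) * inner ℝ z v := by
        norm_num
        ring
      rw [e, norm_mul, Real.norm_of_nonneg (by positivity)]
      have h1 : (‖z‖ ^ 2 + δ) ^ (-2 / 3 : ℝ) ≤ (‖z‖ ^ 2) ^ (-2 / 3 : ℝ) :=
        Real.rpow_le_rpow_of_nonpos (by positivity) (by linarith) (by norm_num)
      have h2 : ‖inner ℝ z v‖ ≤ ‖z‖ * ‖v‖ := norm_inner_le_norm z v
      have h3 : (‖z‖ ^ 2) ^ (-1 / 6 : ℝ) = (‖z‖ ^ 2) ^ (-2 / 3 : ℝ) * ‖z‖ := by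
        have : ‖z‖ = (‖z‖ ^ 2) ^ (1 / 2 : ℝ) := by
          rw [← Real.sqrt_eq_rpow, Real.sqrt_sq hz0.le]
        nth_rewrite 3 [this]
        rw [← Real.rpow_add (by positivity)]
        norm_num
      rw [h3]
      calc _ ≤ 2 / 3 * (‖z‖ ^ 2) ^ (-2 / 3 : ℝ) * (‖z‖ * ‖v‖) := by gcongr
        _ = _ := by ring
  have hcont : Continuous fun δ : ℝ => ENNReal.ofReal |(‖γ b‖ ^ 2 + δ) ^ (1 / 3 : ℝ)
      - (‖γ a‖ ^ 2 + δ) ^ (1 / 3 : ℝ)| := by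
    refine ENNReal.continuous_ofReal.comp (continuous_abs.comp (Continuous.sub ?_ ?_)) <;>
    exact (continuous_const.add continuous_id).rpow_const (fun _ => Or.inr (by norm_num))
  have hlim := (hcont.tendsto' 0 (ENNReal.ofReal |radius (γ b) - radius (γ a)|)
    (by simp [radius_eq])).mono_left (nhdsWithin_le_nhds (s := Ioi 0))
  exact le_of_tendsto hlim (by filter_upwards [self_mem_nhdsWithin] with δ hδ using key δ hδ)

theorem ofReal_abs_radius_sub_le (t : ℂ) (p q : C4) :
    ENNReal.ofReal |radius p - radius q| ≤ coDist t p q := by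
  refine le_iInf₂ fun γ hγ => ?_
  obtain ⟨hpw, hmem, h0, h1⟩ := hγ
  have := (piecewiseC1_iff.1 hpw).ofReal_abs_radius_sub_le hmem
  rwa [h0, h1, abs_sub_comm] at this

/-- A rescaling of `ℂ⁴`, the Lipschitz constant of which is bounded for every `d_{co,t}`. -/
def sphereEmbedding (z : C4) : C4 := (‖z‖ ^ 2 / (1 + ‖z‖ ^ 2) ^ 2) • z

/-- The factor ‖z‖² makes the differential vanish at the cone point, where the metric has no
meaning, and the denominator makes it decay at infinity faster than the metric norm. The constant is
3 · (3/2) ≤ 5. -/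
theorem enorm_sphereEmbedding_sub_le (t : ℂ) (p q : C4) :
    ‖sphereEmbedding q - sphereEmbedding p‖ₑ ≤ ENNReal.ofReal 5 * coDist t p q := by
  have hscal : ∀ x : ℝ, 0 ≤ x → HasDerivAt (fun x : ℝ => x / (1 + x) ^ 2)
      ((1 - x) / (1 + x) ^ 3) x := by
    intro x hx
    have h := (hasDerivAt_id x).div (((hasDerivAt_id x).const_add 1).fun_pow 2)
      (by simp; positivity)
    refine h.congr_deriv ?_
    simp
    field_simp
    ring
  have hd : ∀ z : C4, HasFDerivAt sphereEmbedding
      ((‖z‖ ^ 2 / (1 + ‖z‖ ^ 2) ^ 2) • ContinuousLinearMap.id ℝ C4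
        + (((1 - ‖z‖ ^ 2) / (1 + ‖z‖ ^ 2) ^ 3) • (2 • innerSL ℝ z)).smulRight z) z := by
    intro z
    have h1 := (hscal (‖z‖ ^ 2) (sq_nonneg _)).comp_hasFDerivAt z
      (hasStrictFDerivAt_norm_sq (F := C4) z).hasFDerivAt
    exact h1.smul (hasFDerivAt_id z)
  have hcd : ContDiff ℝ 1 sphereEmbedding := by
    refine ContDiff.smul (ContDiff.div (contDiff_norm_sq ℝ) ?_ fun z => by positivity) contDiff_id
    exact (contDiff_const.add (contDiff_norm_sq ℝ)).pow 2
  have hbound : ∀ z ∈ quadric t, ∀ v, dot z v = 0 →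
      ‖((‖z‖ ^ 2 / (1 + ‖z‖ ^ 2) ^ 2) • ContinuousLinearMap.id ℝ C4
        + (((1 - ‖z‖ ^ 2) / (1 + ‖z‖ ^ 2) ^ 3) • (2 • innerSL ℝ z)).smulRight z) v‖
        ≤ 5 * √(coMetric t z v v) := by
    intro z hz v hv
    by_cases h0 : z = 0
    · subst h0; simp
    have hz0 : 0 < ‖z‖ := norm_pos_iff.2 h0
    set X := ‖z‖ ^ 2 with hX
    have hX0 : 0 < X := by positivity
    have h1 : ‖((X / (1 + X) ^ 2) • ContinuousLinearMap.id ℝ C4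
        + (((1 - X) / (1 + X) ^ 3) • (2 • innerSL ℝ z)).smulRight z) v‖
        ≤ 3 * (X / (1 + X) ^ 2) * ‖v‖ := by
      have e : ((X / (1 + X) ^ 2) • ContinuousLinearMap.id ℝ C4
        + (((1 - X) / (1 + X) ^ 3) • (2 • innerSL ℝ z)).smulRight z) v
        = (X / (1 + X) ^ 2) • v + ((1 - X) / (1 + X) ^ 3 * (2 * inner ℝ z v)) • z := by
        simp
      rw [e]
      refine (norm_add_le _ _).trans ?_
      rw [norm_smul, norm_smul, Real.norm_of_nonneg (by positivity), norm_mul, norm_mul]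
      have h2 : ‖inner ℝ z v‖ ≤ ‖z‖ * ‖v‖ := norm_inner_le_norm z v
      have h3 : ‖(1 - X) / (1 + X) ^ 3‖ ≤ 1 / (1 + X) ^ 2 := by
        rw [norm_div, Real.norm_of_nonneg (show 0 ≤ (1 + X) ^ 3 by positivity),
          div_le_div_iff₀ (by positivity) (by positivity), Real.norm_eq_abs]
        have : |1 - X| ≤ 1 + X := abs_le.2 ⟨by linarith, by linarith⟩
        calc |1 - X| * (1 + X) ^ 2 ≤ (1 + X) * (1 + X) ^ 2 := by gcongr
          _ = _ := by ring
      calc _ ≤ X / (1 + X) ^ 2 * ‖v‖ + 1 / (1 + X) ^ 2 * (‖(2 : ℝ)‖ * (‖z‖ * ‖v‖)) * ‖z‖ := by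
            gcongr
        _ = _ := by rw [Real.norm_ofNat]; field_simp; rw [hX]; ring
    refine h1.trans ?_
    have h2 := le_sqrt_coMetric hz h0 hv
    have h3 : X / (1 + X) ^ 2 ≤ X ^ (-1 / 6 : ℝ) := by
      rw [div_le_iff₀ (by positivity)]
      have h4 : X ^ (7 / 6 : ℝ) ≤ (1 + X) ^ (2 : ℝ) :=
        (Real.rpow_le_rpow hX0.le (by linarith) (by norm_num)).trans
          (Real.rpow_le_rpow_of_exponent_le (by linarith) (by norm_num))
      have h5 : X = X ^ (-1 / 6 : ℝ) * X ^ (7 / 6 : ℝ) := by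
        rw [← Real.rpow_add hX0]; norm_num
      calc X = X ^ (-1 / 6 : ℝ) * X ^ (7 / 6 : ℝ) := h5
        _ ≤ X ^ (-1 / 6 : ℝ) * (1 + X) ^ (2 : ℝ) := by gcongr
        _ = _ := by norm_num
    have h6 : X / (1 + X) ^ 2 * ‖v‖ ≤ X ^ (-1 / 6 : ℝ) * ‖v‖ := by gcongr
    have h7 : 0 ≤ X ^ (-1 / 6 : ℝ) * ‖v‖ := by positivity
    linarith
  have key : ∀ γ, IsCurve t p q γ →
      ‖sphereEmbedding q - sphereEmbedding p‖ₑ ≤ ENNReal.ofReal 5 * coLength t γ := by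
    rintro γ ⟨hpw, hmem, h0, h1⟩
    have := (piecewiseC1_iff.1 hpw).enorm_sub_comp_le hcd hd (by norm_num) hbound hmem
    rwa [h0, h1] at this
  rw [coDist, ENNReal.mul_iInf_of_ne (by norm_num) ENNReal.ofReal_ne_top]
  refine le_iInf fun γ => ?_
  rw [ENNReal.mul_iInf_of_ne (by norm_num) ENNReal.ofReal_ne_top]
  exact le_iInf fun hγ => key γ hγ

/-- At distance zero the radii agree, hence the norms; then `sphereEmbedding` multiplies both points
by the same positive scalar unless they are 0. -/
theorem eq_of_coDist_eq_zero (h : coDist t p q = 0) : p = q := by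
  have h1 := ofReal_abs_radius_sub_le t p q
  have h2 := enorm_sphereEmbedding_sub_le t p q
  rw [h, nonpos_iff_eq_zero, ENNReal.ofReal_eq_zero] at h1
  rw [h, mul_zero, nonpos_iff_eq_zero, enorm_eq_zero, sub_eq_zero] at h2
  have h3 : radius p = radius q := by
    have := abs_nonpos_iff.1 h1
    linarith
  have h4 : ‖p‖ = ‖q‖ := by
    unfold radius at h3
    exact (Real.rpow_left_inj (norm_nonneg _) (norm_nonneg _) (by norm_num)).1 h3
  by_cases h0 : p = 0
  · subst h0
    rw [norm_zero] at h4
    exact (norm_eq_zero.1 h4.symm).symm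
  · have hp : 0 < ‖p‖ := norm_pos_iff.2 h0
    rw [sphereEmbedding, sphereEmbedding, ← h4] at h2
    exact (smul_right_injective C4 (show ‖p‖ ^ 2 / (1 + ‖p‖ ^ 2) ^ 2 ≠ 0 by positivity) h2).symm

theorem coMetric_zero_radial (z : C4) (k : ℝ) :
    coMetric 0 z (k • z) (k • z) = (2 / 3 * k * radius z) ^ 2 := by
  rw [coMetric_smul]
  by_cases h0 : z = 0
  · subst h0; rw [coMetric_zero]; simp [radius]
  have hz0 : 0 < ‖z‖ := norm_pos_iff.2 h0
  have hX : 0 < ‖z‖ ^ 2 := by positivity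
  have e1 : ‖(inner ℂ z z : ℂ)‖ ^ 2 = (‖z‖ ^ 2) ^ 2 := by
    rw [inner_self_eq_norm_sq_to_K]; simp
  rw [coMetric_zero_eq h0, e1, radius_eq]
  have e2 : (‖z‖ ^ 2) ^ (-1 / 3 : ℝ) * ‖z‖ ^ 2 = ((‖z‖ ^ 2) ^ (1 / 3 : ℝ)) ^ 2 := by
    rw [← Real.rpow_natCast ((‖z‖ ^ 2) ^ (1 / 3 : ℝ)) 2, ← Real.rpow_mul hX.le,
      ← Real.rpow_add_one hX.ne']
    norm_num
  have e3 : (‖z‖ ^ 2) ^ (-4 / 3 : ℝ) * (‖z‖ ^ 2) ^ 2 = ((‖z‖ ^ 2) ^ (1 / 3 : ℝ)) ^ 2 := by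
    rw [← Real.rpow_natCast ((‖z‖ ^ 2) ^ (1 / 3 : ℝ)) 2, ← Real.rpow_mul hX.le,
      ← Real.rpow_natCast (‖z‖ ^ 2) 2, ← Real.rpow_add hX]
    norm_num
  linear_combination k ^ 2 * (2 / 3 * e2 - 2 / 9 * e3)

end Length

/-! ### Comparison of the cone with its smoothings -/

section Comparison

variable {t : ℂ} {z v : C4}

/-- The coefficient `t / (2 ‖z‖²)`. -/
def smoothingCoeff (t : ℂ) (z : C4) : ℂ := t / (2 * ((‖z‖ ^ 2 : ℝ) : ℂ))

/-- The map `z ↦ z + t z̄ / (2 ‖z‖²)` from `V_0 \ {0}` to `V_t`. -/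
def toSmoothing (t : ℂ) (z : C4) : C4 := z + smoothingCoeff t z • conjC4 z

/-- The derivative of `toSmoothing t` at `z` in the direction `v`. -/
def toSmoothingDeriv (t : ℂ) (z v : C4) : C4 :=
  v + (smoothingCoeff t z • conjC4 v
    - (smoothingCoeff t z * ((2 * (inner ℂ z v : ℂ).re / ‖z‖ ^ 2 : ℝ) : ℂ)) • conjC4 z)

theorem norm_smoothingCoeff (t : ℂ) (z : C4) : ‖smoothingCoeff t z‖ = ‖t‖ / (2 * ‖z‖ ^ 2) := by
  simp [smoothingCoeff]

theorem dot_eq_inner (z w : C4) : dot z w = inner ℂ (conjC4 z) w := (inner_conjC4_left z w).symm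

theorem inner_self_eq (z : C4) : (inner ℂ z z : ℂ) = ((‖z‖ ^ 2 : ℝ) : ℂ) := by
  rw [inner_self_eq_norm_sq_to_K]; simp

theorem dot_conjC4_left (z w : C4) : dot (conjC4 z) w = inner ℂ z w := by
  rw [← inner_conjC4_left, conjC4_conjC4]

theorem dot_conjC4_right (z w : C4) : dot z (conjC4 w) = inner ℂ w z := by
  rw [dot_comm, dot_conjC4_left]

theorem toSmoothing_mem (hz : z ∈ quadric 0) (h0 : z ≠ 0) : toSmoothing t z ∈ quadric t := by
  rw [mem_quadric_iff] at hz ⊢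
  have hX : (‖z‖ : ℂ) ≠ 0 := by exact_mod_cast norm_ne_zero_iff.2 h0
  rw [dot_eq_inner, toSmoothing, map_add, conjC4_smul, conjC4_conjC4]
  simp only [inner_add_left, inner_add_right, inner_smul_left, inner_smul_right,
    inner_conjC4_left, inner_conjC4_right, hz, inner_self_eq]
  simp [smoothingCoeff]
  field_simp
  ring

theorem norm_sq_toSmoothing (hz : z ∈ quadric 0) :
    ‖toSmoothing t z‖ ^ 2 = ‖z‖ ^ 2 * (1 + ‖smoothingCoeff t z‖ ^ 2) := by
  rw [mem_quadric_iff] at hz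
  have h : ((‖toSmoothing t z‖ ^ 2 : ℝ) : ℂ)
      = ((‖z‖ ^ 2 * (1 + ‖smoothingCoeff t z‖ ^ 2) : ℝ) : ℂ) := by
    rw [← inner_self_eq, toSmoothing]
    simp only [inner_add_left, inner_add_right, inner_smul_left, inner_smul_right,
      inner_conjC4_left, inner_conjC4_right, hz, inner_self_eq]
    push_cast
    rw [← Complex.conj_mul']
    simp
    ring
  exact_mod_cast h

theorem hasDerivAt_toSmoothing {γ : ℝ → C4} {s : ℝ} (h0 : γ s ≠ 0) (h : HasDerivAt γ v s) :
    HasDerivAt (fun s => toSmoothing t (γ s)) (toSmoothingDeriv t (γ s) v) s := by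
  have hX : ((‖γ s‖ ^ 2 : ℝ) : ℂ) ≠ 0 := by
    have := norm_pos_iff.2 h0
    exact_mod_cast (by positivity : ‖γ s‖ ^ 2 ≠ 0)
  have h1 : HasDerivAt (fun s => ((‖γ s‖ ^ 2 : ℝ) : ℂ)) ((2 * (inner ℂ (γ s) v : ℂ).re : ℝ) : ℂ) s := by
    have := h.norm_sq
    rw [real_inner_eq] at this
    exact this.ofReal_comp
  have h2 : HasDerivAt (fun s => smoothingCoeff t (γ s))
      (-(smoothingCoeff t (γ s) * ((2 * (inner ℂ (γ s) v : ℂ).re / ‖γ s‖ ^ 2 : ℝ) : ℂ))) s := by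
    have := (hasDerivAt_const s t).fun_div (h1.const_mul 2) (mul_ne_zero two_ne_zero hX)
    refine this.congr_deriv ?_
    rw [smoothingCoeff]
    push_cast at hX ⊢
    field_simp
    ring
  have h3 : HasDerivAt (fun s => conjC4 (γ s)) (conjC4 v) s := conjC4.hasFDerivAt.comp_hasDerivAt s h
  refine (h.fun_add (h2.fun_smul h3)).congr_deriv ?_
  rw [toSmoothingDeriv, neg_smul]
  abel

theorem inner_toSmoothingDeriv (hz : z ∈ quadric 0) (h0 : z ≠ 0) (hv : dot z v = 0) :
    inner ℂ (toSmoothing t z) (toSmoothingDeriv t z v)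
      = (1 - (‖smoothingCoeff t z‖ : ℂ) ^ 2) * inner ℂ z v := by
  rw [mem_quadric_iff] at hz
  have hX : (‖z‖ : ℂ) ≠ 0 := by exact_mod_cast norm_ne_zero_iff.2 h0
  rw [toSmoothing, toSmoothingDeriv, ← Complex.conj_mul']
  simp only [inner_add_left, inner_add_right, inner_sub_right, inner_smul_left, inner_smul_right,
      inner_conjC4_left, inner_conjC4_right, dot_conjC4_left, hz, hv, inner_self_eq]
  have h2 := Complex.add_conj (inner ℂ z v)
  push_cast at h2 ⊢
  rw [← h2]
  simp
  field_simp
  ring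

/-- The term multiplying the coefficient a is the conjugate of v - (2 Re⟨z,v⟩/‖z‖²) z, a real
reflection of v, so its norm is ‖v‖. Its z̄ part is orthogonal to v by tangency, so the only cross
term comes from `dot v v`. -/
theorem norm_sq_toSmoothingDeriv (h0 : z ≠ 0) (hv : dot z v = 0) :
    ‖toSmoothingDeriv t z v‖ ^ 2 = (1 + ‖smoothingCoeff t z‖ ^ 2) * ‖v‖ ^ 2
      + 2 * (smoothingCoeff t z * starRingEnd ℂ (dot v v)).re := by
  have hX : (‖z‖ : ℂ) ≠ 0 := by exact_mod_cast norm_ne_zero_iff.2 h0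
  have hv' : dot v z = 0 := by rw [dot_comm, hv]
  have h : ((‖toSmoothingDeriv t z v‖ ^ 2 : ℝ) : ℂ)
      = (((1 + ‖smoothingCoeff t z‖ ^ 2) * ‖v‖ ^ 2
      + 2 * (smoothingCoeff t z * starRingEnd ℂ (dot v v)).re : ℝ) : ℂ) := by
    rw [← inner_self_eq, toSmoothingDeriv]
    have e1 : (inner ℂ v z : ℂ) = starRingEnd ℂ (inner ℂ z v) := (inner_conj_symm v z).symm
    simp only [inner_add_left, inner_add_right, inner_sub_left, inner_sub_right, inner_smul_left,
      inner_smul_right, inner_conjC4_left, inner_conjC4_right, dot_conjC4_left, hv, hv',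
      inner_self_eq, e1]
    have h2 := Complex.add_conj (inner ℂ z v)
    have h3 := Complex.add_conj (smoothingCoeff t z * starRingEnd ℂ (dot v v))
    push_cast at h2 h3 ⊢
    rw [← h2, ← h3, ← Complex.conj_mul']
    simp
    field_simp
    ring
  exact_mod_cast h

theorem norm_sq_toSmoothingDeriv_sub_le (h0 : z ≠ 0) (hv : dot z v = 0) :
    |‖toSmoothingDeriv t z v‖ ^ 2 - ‖v‖ ^ 2|
      ≤ (2 * ‖smoothingCoeff t z‖ + ‖smoothingCoeff t z‖ ^ 2) * ‖v‖ ^ 2 := by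
  rw [norm_sq_toSmoothingDeriv h0 hv]
  have h1 : |(smoothingCoeff t z * starRingEnd ℂ (dot v v)).re|
      ≤ ‖smoothingCoeff t z‖ * (‖v‖ * ‖v‖) := by
    refine (Complex.abs_re_le_norm _).trans ?_
    rw [norm_mul, Complex.norm_conj]
    gcongr
    exact norm_dot_le v v
  have h2 := abs_le.1 h1
  rw [abs_le]
  constructor <;> nlinarith [sq_nonneg (‖smoothingCoeff t z‖ * ‖v‖)]

/-- The metric of the smoothing is bounded by that of the cone. -/
theorem coMetric_toSmoothing_le (hz : z ∈ quadric 0) (h0 : z ≠ 0) (hv : dot z v = 0)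
    (ht : ‖t‖ ≤ 2 * ‖z‖ ^ 2) :
    coMetric t (toSmoothing t z) (toSmoothingDeriv t z v) (toSmoothingDeriv t z v)
      ≤ 3 ^ 2 * coMetric 0 z v v := by
  have hz0 : 0 < ‖z‖ := norm_pos_iff.2 h0
  have hX : 0 < ‖z‖ ^ 2 := by positivity
  have ha : ‖smoothingCoeff t z‖ ≤ 1 := by
    rw [norm_smoothingCoeff]; exact div_le_one_of_le₀ ht (by positivity)
  have ha0 := norm_nonneg (smoothingCoeff t z)
  have hY := norm_sq_toSmoothing (t := t) hz
  have hXY : ‖z‖ ^ 2 ≤ ‖toSmoothing t z‖ ^ 2 := by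
    rw [hY]; nlinarith [sq_nonneg ‖smoothingCoeff t z‖]
  have hne : toSmoothing t z ≠ 0 := by
    intro h; rw [h, norm_zero] at hXY; linarith
  have h1 := coMetric_le (quadric_subset_region t (toSmoothing_mem hz h0)) hne
    (toSmoothingDeriv t z v)
  have h2 := le_coMetric hz h0 hv
  have h3 : (‖toSmoothing t z‖ ^ 2) ^ (-1 / 3 : ℝ) ≤ (‖z‖ ^ 2) ^ (-1 / 3 : ℝ) :=
    Real.rpow_le_rpow_of_nonpos hX hXY (by norm_num)
  have h4 : ‖toSmoothingDeriv t z v‖ ^ 2 ≤ 4 * ‖v‖ ^ 2 := by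
    have h5 := (abs_le.1 (norm_sq_toSmoothingDeriv_sub_le (t := t) h0 hv)).2
    have h6 : (2 * ‖smoothingCoeff t z‖ + ‖smoothingCoeff t z‖ ^ 2) * ‖v‖ ^ 2 ≤ 3 * ‖v‖ ^ 2 := by
      gcongr
      nlinarith
    linarith
  -- This gives (8/3)‖v‖²/r(z), which is six times the lower bound (4/9)‖v‖²/r(z) for the cone
  -- metric; 6 ≤ 3².
  have h7 : 2 / 3 * (‖toSmoothing t z‖ ^ 2) ^ (-1 / 3 : ℝ) * ‖toSmoothingDeriv t z v‖ ^ 2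
      ≤ 2 / 3 * (‖z‖ ^ 2) ^ (-1 / 3 : ℝ) * (4 * ‖v‖ ^ 2) := by gcongr
  have h8 : 0 ≤ (‖z‖ ^ 2) ^ (-1 / 3 : ℝ) * ‖v‖ ^ 2 := by positivity
  linarith

/-- Bookkeeping for the next estimate. Here α is the size of the coefficient of z̄; c and d are the
normalised A and B; q and q' account for the change of ‖z‖², and η for that of ‖v‖². G and M are the
two terms of the cone metric without their constants. -/
theorem abs_metric_sub_le {ε q q' η α c d x y G M : ℝ} (hα0 : 0 ≤ α) (hα : α ≤ ε) (hε : ε ≤ 1 / 10)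
    (hq : q ≤ 1) (hq0 : 1 - 2 * α ≤ q) (hq' : q' ≤ 1) (hq0' : 1 - 2 * α ≤ q')
    (hη : |η| ≤ 2 * α + α ^ 2) (hc : |c - 2 / 3| ≤ ε) (hd : |d + 2 / 9| ≤ ε)
    (hx : x = c * q * (1 + η) * G) (hy : y = d * q' * (1 - α ^ 2) ^ 2 * M) (hM : 0 ≤ M)
    (hMG : M ≤ G) :
    |x + y - (2 / 3 * G - 2 / 9 * M)| ≤ 8 * ε * G := by
  have hε0 : 0 ≤ ε := hα0.trans hα
  have hα2 : α ^ 2 ≤ α / 10 := by nlinarith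
  have hα20 := sq_nonneg α
  have hη' : |η| ≤ 21 / 10 * α := by linarith
  obtain ⟨hη1, hη2⟩ := abs_le.1 hη'
  have hq00 : 0 ≤ q := by linarith
  have hq00' : 0 ≤ q' := by linarith
  have k1 : |c * q * (1 + η) - 2 / 3| ≤ 6 * ε := by
    have e : c * q * (1 + η) - 2 / 3 = (c - 2 / 3) * (q * (1 + η)) + 2 / 3 * (q * η) + 2 / 3 * (q - 1) := by
      ring
    have a1 : |q * (1 + η)| ≤ 2 := by
      rw [abs_of_nonneg (mul_nonneg hq00 (by linarith))]
      nlinarith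
    have a2 : |q * η| ≤ 21 / 10 * α := by
      rw [abs_mul, abs_of_nonneg hq00]
      nlinarith [abs_nonneg η]
    have a3 : |q - 1| ≤ 2 * α := abs_le.2 ⟨by linarith, by linarith⟩
    rw [e]
    refine (abs_add_three _ _ _).trans ?_
    rw [abs_mul, abs_mul (2 / 3), abs_mul (2 / 3), abs_of_pos (show (0 : ℝ) < 2 / 3 by norm_num)]
    have : |c - 2 / 3| * |q * (1 + η)| ≤ ε * 2 := by gcongr
    linarith
  have k2 : |d * q' * (1 - α ^ 2) ^ 2 + 2 / 9| ≤ 2 * ε := by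
    set r := q' * (1 - α ^ 2) ^ 2 with hr
    have b1 : (1 - α ^ 2) ^ 2 ≤ 1 := by nlinarith
    have b2 : 1 - 2 * α ^ 2 ≤ (1 - α ^ 2) ^ 2 := by nlinarith
    have b3 : r ≤ 1 := by nlinarith [sq_nonneg (1 - α ^ 2)]
    have b4 : 1 - 3 * α ≤ r := by
      have : (1 - 2 * α) * (1 - 2 * α ^ 2) ≤ r := by
        rw [hr]; gcongr; nlinarith
      nlinarith
    have b5 : 0 ≤ r := by linarith
    have e : d * q' * (1 - α ^ 2) ^ 2 + 2 / 9 = (d + 2 / 9) * r + 2 / 9 * (1 - r) := by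
      rw [hr]; ring
    rw [e]
    refine (abs_add_le _ _).trans ?_
    rw [abs_mul, abs_mul (2 / 9), abs_of_pos (show (0 : ℝ) < 2 / 9 by norm_num), abs_of_nonneg b5,
      abs_of_nonneg (by linarith : 0 ≤ 1 - r)]
    have : |d + 2 / 9| * r ≤ ε * 1 := by gcongr
    linarith
  have e : x + y - (2 / 3 * G - 2 / 9 * M)
      = (c * q * (1 + η) - 2 / 3) * G + (d * q' * (1 - α ^ 2) ^ 2 + 2 / 9) * M := by
    rw [hx, hy]; ring
  rw [e]
  refine (abs_add_le _ _).trans ?_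
  rw [abs_mul, abs_mul _ M, abs_of_nonneg hM, abs_of_nonneg (hM.trans hMG)]
  have c1 : |c * q * (1 + η) - 2 / 3| * G ≤ 6 * ε * G :=
    mul_le_mul_of_nonneg_right k1 (hM.trans hMG)
  have c2 : |d * q' * (1 - α ^ 2) ^ 2 + 2 / 9| * M ≤ 2 * ε * G :=
    mul_le_mul k2 hMG hM (by linarith)
  linarith

/-- Away from the singularity the metrics of the cone and of its smoothing are close. -/
theorem exists_coMetric_toSmoothing_close {ε : ℝ} (hε : 0 < ε) : ∃ K : ℝ, 1 ≤ K ∧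
    ∀ (t : ℂ) (z v : C4), t ≠ 0 → z ∈ quadric 0 → dot z v = 0 → K * ‖t‖ ≤ ‖z‖ ^ 2 →
      |coMetric t (toSmoothing t z) (toSmoothingDeriv t z v) (toSmoothingDeriv t z v)
        - coMetric 0 z v v| ≤ ε * coMetric 0 z v v := by
  -- The error is 8eG and the cone metric is at least (4/9)G, so e ≤ ε/18 is what is needed.
  -- Enlarging K to at least 1/e makes the coefficient of z̄ at most e.
  set e := min (ε / 18) (1 / 10) with he
  have he0 : 0 < e := by rw [he]; positivity
  obtain ⟨K, hK1, hK⟩ := exists_potential_asymptotics he0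
  refine ⟨max K (1 / e), hK1.trans (le_max_left _ _), fun t z v ht hz hv hX => ?_⟩
  have hs : 0 < ‖t‖ := norm_pos_iff.2 ht
  have hX0 : 0 < ‖z‖ ^ 2 := lt_of_lt_of_le (by positivity) hX
  have h0 : z ≠ 0 := by rintro rfl; norm_num at hX0
  have hX1 : K * ‖t‖ ≤ ‖z‖ ^ 2 :=
    (mul_le_mul_of_nonneg_right (le_max_left _ _) hs.le).trans hX
  have hX2 : 1 / e * ‖t‖ ≤ ‖z‖ ^ 2 :=
    (mul_le_mul_of_nonneg_right (le_max_right _ _) hs.le).trans hX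
  set α := ‖smoothingCoeff t z‖ with hα
  have hα0 : 0 ≤ α := norm_nonneg _
  have hαe : α ≤ e := by
    rw [hα, norm_smoothingCoeff, div_le_iff₀ (by positivity)]
    have : ‖t‖ ≤ e * ‖z‖ ^ 2 := by
      calc ‖t‖ = e * (1 / e * ‖t‖) := by field_simp
        _ ≤ _ := by gcongr
    nlinarith
  have hY := norm_sq_toSmoothing (t := t) hz
  rw [← hα] at hY
  have hXY : ‖z‖ ^ 2 ≤ ‖toSmoothing t z‖ ^ 2 := by rw [hY]; nlinarith [sq_nonneg α]
  have hY0 : 0 < ‖toSmoothing t z‖ ^ 2 := by linarith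
  have hne : toSmoothing t z ≠ 0 := by intro h; rw [h] at hY0; norm_num at hY0
  obtain ⟨hA, hB⟩ := hK t (‖toSmoothing t z‖ ^ 2) ht (hX1.trans hXY)
  have hlow := le_coMetric hz h0 hv
  rw [coMetric_eq (quadric_subset_region t (toSmoothing_mem hz h0)) hne,
    inner_toSmoothingDeriv hz h0 hv]
  rw [coMetric_zero_eq h0] at hlow ⊢
  set X := ‖z‖ ^ 2 with hXdef
  set Y := ‖toSmoothing t z‖ ^ 2 with hYdef
  set m := ‖(inner ℂ z v : ℂ)‖ with hm
  have hm2 : m ^ 2 ≤ X * ‖v‖ ^ 2 := by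
    rw [hXdef, ← mul_pow]; gcongr; exact norm_inner_le_norm z v
  have e13 : X ^ (-1 / 3 : ℝ) = X ^ (-4 / 3 : ℝ) * X := by
    rw [← Real.rpow_add_one hX0.ne']; norm_num
  have hMG : X ^ (-4 / 3 : ℝ) * m ^ 2 ≤ X ^ (-1 / 3 : ℝ) * ‖v‖ ^ 2 := by
    rw [e13, mul_assoc]; gcongr
  have hpow : ∀ r : ℝ, -2 ≤ r → r ≤ 0 → (1 + α ^ 2) ^ r ≤ 1 ∧ 1 - 2 * α ≤ (1 + α ^ 2) ^ r := by
    intro r hr hr0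
    have h1 : 1 ≤ 1 + α ^ 2 := by nlinarith
    refine ⟨Real.rpow_le_one_of_one_le_of_nonpos h1 hr0, ?_⟩
    refine le_trans ?_ (Real.rpow_le_rpow_of_exponent_le h1 hr)
    rw [Real.rpow_neg (by linarith), Real.rpow_two, ← one_div, le_div_iff₀ (by positivity)]
    have h10 : α ≤ 1 / 10 := hαe.trans (min_le_right _ _)
    have h100 : α ^ 2 ≤ α / 10 := by nlinarith
    have h11 : (1 + α ^ 2) ^ 2 ≤ 1 + α := by nlinarith
    nlinarith
  have hsplit : ∀ r : ℝ, Y ^ r = X ^ r * (1 + α ^ 2) ^ r := by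
    intro r; rw [hY, Real.mul_rpow hX0.le (by positivity)]
  obtain ⟨p1, p2⟩ := hpow (-1 / 3) (by norm_num) (by norm_num)
  obtain ⟨p3, p4⟩ := hpow (-4 / 3) (by norm_num) (by norm_num)
  have hYp : ∀ r : ℝ, 0 < Y ^ r := fun r => Real.rpow_pos_of_pos hY0 r
  have hv0 : ∃ η : ℝ, |η| ≤ 2 * α + α ^ 2 ∧ ‖toSmoothingDeriv t z v‖ ^ 2 = (1 + η) * ‖v‖ ^ 2 := by
    have hb := norm_sq_toSmoothingDeriv_sub_le (t := t) h0 hv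
    rw [← hα] at hb
    by_cases hv0 : ‖v‖ = 0
    · refine ⟨0, by simp; positivity, ?_⟩
      rw [hv0] at hb ⊢
      simpa using hb
    · have hvp : 0 < ‖v‖ ^ 2 := by positivity
      refine ⟨‖toSmoothingDeriv t z v‖ ^ 2 / ‖v‖ ^ 2 - 1, ?_, by field_simp; ring⟩
      rw [show ‖toSmoothingDeriv t z v‖ ^ 2 / ‖v‖ ^ 2 - 1
        = (‖toSmoothingDeriv t z v‖ ^ 2 - ‖v‖ ^ 2) / ‖v‖ ^ 2 by field_simp, abs_div,
        abs_of_pos hvp, div_le_iff₀ hvp]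
      exact hb
  obtain ⟨η, hη, hvη⟩ := hv0
  have hin : ‖(1 - (α : ℂ) ^ 2) * inner ℂ z v‖ ^ 2 = (1 - α ^ 2) ^ 2 * m ^ 2 := by
    rw [norm_mul, mul_pow, ← hm]
    congr 1
    rw [← Complex.ofReal_pow, ← Complex.ofReal_one, ← Complex.ofReal_sub, Complex.norm_real,
      Real.norm_eq_abs, sq_abs]
  rw [hin, hvη]
  have key := abs_metric_sub_le (ε := e) (q := (1 + α ^ 2) ^ (-1 / 3 : ℝ))
    (q' := (1 + α ^ 2) ^ (-4 / 3 : ℝ)) (η := η) (α := α)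
    (c := potentialA t Y / Y ^ (-1 / 3 : ℝ)) (d := potentialB t Y / Y ^ (-4 / 3 : ℝ))
    (x := potentialA t Y * ((1 + η) * ‖v‖ ^ 2)) (y := potentialB t Y * ((1 - α ^ 2) ^ 2 * m ^ 2))
    (G := X ^ (-1 / 3 : ℝ) * ‖v‖ ^ 2) (M := X ^ (-4 / 3 : ℝ) * m ^ 2)
    hα0 hαe (min_le_right _ _) p1 p2 p3 p4 hη
    (by
      have := hYp (-1 / 3)
      rw [show potentialA t Y / Y ^ (-1 / 3 : ℝ) - 2 / 3
        = (potentialA t Y - 2 / 3 * Y ^ (-1 / 3 : ℝ)) / Y ^ (-1 / 3 : ℝ) by field_simp, abs_div,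
        abs_of_pos this, div_le_iff₀ this]
      exact hA)
    (by
      have := hYp (-4 / 3)
      rw [show potentialB t Y / Y ^ (-4 / 3 : ℝ) + 2 / 9
        = (potentialB t Y + 2 / 9 * Y ^ (-4 / 3 : ℝ)) / Y ^ (-4 / 3 : ℝ) by field_simp, abs_div,
        abs_of_pos this, div_le_iff₀ this]
      exact hB)
    (by
      have := hYp (-1 / 3)
      have h' := hsplit (-1 / 3)
      have e1 : potentialA t Y = potentialA t Y / Y ^ (-1 / 3 : ℝ)
        * (X ^ (-1 / 3 : ℝ) * (1 + α ^ 2) ^ (-1 / 3 : ℝ)) := by rw [← h']; field_simp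
      linear_combination ((1 + η) * ‖v‖ ^ 2) * e1)
    (by
      have := hYp (-4 / 3)
      have h' := hsplit (-4 / 3)
      have e1 : potentialB t Y = potentialB t Y / Y ^ (-4 / 3 : ℝ)
        * (X ^ (-4 / 3 : ℝ) * (1 + α ^ 2) ^ (-4 / 3 : ℝ)) := by rw [← h']; field_simp
      linear_combination ((1 - α ^ 2) ^ 2 * m ^ 2) * e1)
    (by positivity) hMG
  have he18 : e ≤ ε / 18 := min_le_left _ _
  have hG : 0 ≤ X ^ (-1 / 3 : ℝ) * ‖v‖ ^ 2 := by positivity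
  have hfin : 8 * e * (X ^ (-1 / 3 : ℝ) * ‖v‖ ^ 2) ≤ ε * (4 / 9 * X ^ (-1 / 3 : ℝ) * ‖v‖ ^ 2) := by
    have := mul_le_mul_of_nonneg_right he18 hG
    linarith
  have hmul := mul_le_mul_of_nonneg_left hlow hε.le
  have e5 : 2 / 3 * (X ^ (-1 / 3 : ℝ) * ‖v‖ ^ 2) - 2 / 9 * (X ^ (-4 / 3 : ℝ) * m ^ 2)
      = 2 / 3 * X ^ (-1 / 3 : ℝ) * ‖v‖ ^ 2 - 2 / 9 * X ^ (-4 / 3 : ℝ) * m ^ 2 := by ring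
  rw [e5] at key
  exact key.trans (hfin.trans hmul)

/-- The radius squared of the preimage under `toSmoothing t`. -/
def coneNormSq (t : ℂ) (z : C4) : ℝ := (‖z‖ ^ 2 + √((‖z‖ ^ 2) ^ 2 - ‖t‖ ^ 2)) / 2

/-- The inverse of `toSmoothing t`. -/
def fromSmoothing (t : ℂ) (z : C4) : C4 :=
  (1 - (‖t‖ / (2 * coneNormSq t z)) ^ 2)⁻¹ •
    (z - (t / (2 * (coneNormSq t z : ℂ))) • conjC4 z)

/-- The squared norm x of the preimage solves x + |t|²/(4x) = ‖z‖². It is the larger root, hence at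
least half the sum of the roots. -/
theorem coneNormSq_spec (h : ‖t‖ < ‖z‖ ^ 2) :
    ‖z‖ ^ 2 / 2 ≤ coneNormSq t z ∧
      coneNormSq t z ^ 2 - ‖z‖ ^ 2 * coneNormSq t z + ‖t‖ ^ 2 / 4 = 0 := by
  have h1 : 0 ≤ (‖z‖ ^ 2) ^ 2 - ‖t‖ ^ 2 := by nlinarith [norm_nonneg t]
  have h2 := Real.sq_sqrt h1
  have h3 := Real.sqrt_nonneg ((‖z‖ ^ 2) ^ 2 - ‖t‖ ^ 2)
  constructor
  · rw [coneNormSq]; linarith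
  · rw [coneNormSq]; linear_combination h2 / 4

theorem norm_div_coneNormSq_lt (h : ‖t‖ < ‖z‖ ^ 2) : ‖t‖ / (2 * coneNormSq t z) < 1 := by
  have := (coneNormSq_spec h).1
  rw [div_lt_one (by linarith [norm_nonneg t])]
  linarith

/-- If z = p + a p̄, then z - a z̄ = (1 - |a|²) p. Above the vanishing sphere |a| < 1, so p is
recovered by division. -/
theorem fromSmoothing_spec (hz : z ∈ quadric t) (h : ‖t‖ < ‖z‖ ^ 2) :
    fromSmoothing t z ∈ quadric 0 ∧ ‖fromSmoothing t z‖ ^ 2 = coneNormSq t z ∧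
      toSmoothing t (fromSmoothing t z) = z := by
  obtain ⟨h1, h2⟩ := coneNormSq_spec h
  have hx0 : 0 < coneNormSq t z := by linarith [norm_nonneg t]
  have hlt := norm_div_coneNormSq_lt h
  rw [mem_quadric_iff] at hz
  set x := coneNormSq t z with hx
  set b := ‖t‖ / (2 * x) with hb
  have hb0 : 0 ≤ b := by positivity
  have hk0 : 0 < 1 - b ^ 2 := by nlinarith
  set a : ℂ := t / (2 * (x : ℂ)) with ha
  have hxc : (x : ℂ) ≠ 0 := by exact_mod_cast hx0.ne'
  have hab : starRingEnd ℂ a * a = ((b ^ 2 : ℝ) : ℂ) := by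
    rw [Complex.conj_mul', ← Complex.ofReal_pow]
    congr 2
    rw [ha, hb]; simp [abs_of_pos hx0]
  have hX : ‖z‖ ^ 2 = x * (1 + b ^ 2) := by
    rw [hb]; field_simp; linarith
  have hta : t = 2 * x * a := by rw [ha]; field_simp
  have hdef : fromSmoothing t z = (1 - b ^ 2)⁻¹ • (z - a • conjC4 z) := rfl
  set w : C4 := z - a • conjC4 z with hw
  have hdot : dot w w = 0 := by
    rw [dot_eq_inner, hw, map_sub, conjC4_smul, conjC4_conjC4]
    simp only [inner_sub_left, inner_sub_right, inner_smul_left, inner_smul_right,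
      inner_conjC4_left, inner_conjC4_right, hz, inner_self_eq, norm_conjC4]
    rw [hX]
    simp only [Complex.conj_conj]
    push_cast
    have hab' : starRingEnd ℂ a * a = (b : ℂ) ^ 2 := by rw [hab]; push_cast; rfl
    have hct : starRingEnd ℂ t = 2 * x * starRingEnd ℂ a := by
      rw [hta]; simp [map_ofNat]
    rw [hct, hta]
    linear_combination (2 * (x : ℂ) * a) * hab'
  have hnorm : ‖w‖ ^ 2 = x * (1 - b ^ 2) ^ 2 := by
    have : ((‖w‖ ^ 2 : ℝ) : ℂ) = ((x * (1 - b ^ 2) ^ 2 : ℝ) : ℂ) := by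
      rw [← inner_self_eq, hw]
      simp only [inner_sub_left, inner_sub_right, inner_smul_left, inner_smul_right,
        inner_conjC4_left, inner_conjC4_right, hz, inner_self_eq, norm_conjC4]
      rw [hX]
      push_cast
      have hab' : starRingEnd ℂ a * a = (b : ℂ) ^ 2 := by rw [hab]; push_cast; rfl
      have hct : starRingEnd ℂ t = 2 * x * starRingEnd ℂ a := by
        rw [hta]; simp [map_ofNat]
      rw [hct]
      linear_combination (-starRingEnd ℂ a) * hta + ((x : ℂ) * (1 + (b : ℂ) ^ 2) - 4 * x) * hab'
    exact_mod_cast this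
  have hnorm' : ‖fromSmoothing t z‖ ^ 2 = x := by
    rw [hdef, norm_smul, mul_pow, hnorm, Real.norm_of_nonneg (by positivity)]
    field_simp
  refine ⟨?_, hnorm', ?_⟩
  · rw [mem_quadric_iff, hdef]
    have : dot ((1 - b ^ 2)⁻¹ • w) ((1 - b ^ 2)⁻¹ • w)
        = (((1 - b ^ 2)⁻¹ : ℝ) : ℂ) ^ 2 * dot w w := by
      simp only [dot, Finset.mul_sum]
      refine Finset.sum_congr rfl fun i _ => ?_
      rw [PiLp.smul_apply, Complex.real_smul]
      ring
    rw [this, hdot, mul_zero]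
  · have hcoef : smoothingCoeff t (fromSmoothing t z) = a := by
      rw [smoothingCoeff, hnorm']
    rw [toSmoothing, hcoef, hdef, map_smul, hw, map_sub, conjC4_smul, conjC4_conjC4]
    ext i
    have hkc : (1 - (b : ℂ) ^ 2) ≠ 0 := by exact_mod_cast hk0.ne'
    have hab' : starRingEnd ℂ a * a = (b : ℂ) ^ 2 := by rw [hab]; push_cast; rfl
    simp
    field_simp
    linear_combination (-(z i)) * hab'

theorem contDiffOn_toSmoothing (t : ℂ) : ContDiffOn ℝ 1 (toSmoothing t) {z | z ≠ 0} := by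
  have h1 : ContDiffOn ℝ 1 (fun z : C4 => ((‖z‖ ^ 2 : ℝ) : ℂ)) {z | z ≠ 0} :=
    (Complex.ofRealCLM.contDiff.comp (contDiff_norm_sq ℝ)).contDiffOn
  have h2 : ContDiffOn ℝ 1 (smoothingCoeff t) {z | z ≠ 0} := by
    unfold smoothingCoeff
    simp only [div_eq_mul_inv]
    refine contDiffOn_const.mul ((contDiffOn_const.mul h1).inv ?_)
    intro z hz
    have hz' : 0 < ‖z‖ := norm_pos_iff.2 hz
    refine mul_ne_zero two_ne_zero ?_
    exact_mod_cast (by positivity : ‖z‖ ^ 2 ≠ 0)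
  exact contDiffOn_id.add (h2.smul conjC4.contDiff.contDiffOn)

theorem contDiffOn_fromSmoothing (t : ℂ) :
    ContDiffOn ℝ 1 (fromSmoothing t) {z | ‖t‖ < ‖z‖ ^ 2} := by
  have h1 : ContDiffOn ℝ 1 (coneNormSq t) {z | ‖t‖ < ‖z‖ ^ 2} := by
    refine ContDiffOn.div_const ((contDiff_norm_sq ℝ).contDiffOn.add (ContDiffOn.sqrt ?_ ?_)) _
    · exact (((contDiff_norm_sq ℝ).pow 2).sub contDiff_const).contDiffOn
    · intro z (hz : ‖t‖ < ‖z‖ ^ 2)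
      nlinarith [norm_nonneg t]
  have hpos : ∀ z ∈ {z : C4 | ‖t‖ < ‖z‖ ^ 2}, 0 < coneNormSq t z := by
    intro z (hz : ‖t‖ < ‖z‖ ^ 2)
    linarith [(coneNormSq_spec hz).1, norm_nonneg t]
  have h2 : ContDiffOn ℝ 1 (fun z => 1 - (‖t‖ / (2 * coneNormSq t z)) ^ 2) {z | ‖t‖ < ‖z‖ ^ 2} := by
    refine contDiffOn_const.sub (ContDiffOn.pow (ContDiffOn.div contDiffOn_const
      (contDiffOn_const.mul h1) ?_) 2)
    intro z hz
    exact mul_ne_zero two_ne_zero (hpos z hz).ne'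
  have h3 : ContDiffOn ℝ 1 (fun z => t / (2 * (coneNormSq t z : ℂ))) {z | ‖t‖ < ‖z‖ ^ 2} := by
    simp only [div_eq_mul_inv]
    refine contDiffOn_const.mul
      ((contDiffOn_const.mul (Complex.ofRealCLM.contDiff.comp_contDiffOn h1)).inv ?_)
    intro z hz
    exact mul_ne_zero two_ne_zero (Complex.ofReal_ne_zero.2 (hpos z hz).ne')
  refine (h2.inv ?_).smul (contDiffOn_id.sub (h3.smul conjC4.contDiff.contDiffOn))
  intro z hz
  have h4 := norm_div_coneNormSq_lt hz
  have h5 : 0 ≤ ‖t‖ / (2 * coneNormSq t z) := by have := hpos z hz; positivity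
  nlinarith

end Comparison

/-! ### Special curves -/

section Paths

variable {t : ℂ} {p q z v : C4}

/-- The segment of the ray through `p` from `p` to `σ^{3/2} p`, with constant speed. -/
def rayCurve (p : C4) (σ s : ℝ) : C4 := ((1 - (1 - σ) * s) ^ (3 / 2 : ℝ)) • p

theorem smul_mem_quadric_zero (hp : p ∈ quadric 0) (k : ℝ) : k • p ∈ quadric 0 := by
  rw [mem_quadric_iff] at hp ⊢
  have : dot (k • p) (k • p) = (k : ℂ) ^ 2 * dot p p := by
    simp only [dot, Finset.mul_sum]
    refine Finset.sum_congr rfl fun i _ => ?_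
    rw [PiLp.smul_apply, Complex.real_smul]
    ring
  rw [this, hp, mul_zero]

theorem contDiff_rayCurve (p : C4) (σ : ℝ) : ContDiff ℝ 1 (rayCurve p σ) := by
  have h : ContDiff ℝ 1 fun x : ℝ => x ^ (3 / 2 : ℝ) := by
    have := Real.contDiff_rpow_const_of_le (p := 3 / 2) (n := 1) (by norm_num)
    exact_mod_cast this
  exact (h.comp (by fun_prop : ContDiff ℝ 1 fun s : ℝ => 1 - (1 - σ) * s)).smul contDiff_const

theorem hasDerivAt_rayCurve (p : C4) {σ s : ℝ} (h : 0 < 1 - (1 - σ) * s) :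
    HasDerivAt (rayCurve p σ) ((-(3 / 2 * (1 - σ) / (1 - (1 - σ) * s))) • rayCurve p σ s) s := by
  have h1 : HasDerivAt (fun s : ℝ => 1 - (1 - σ) * s) (-(1 - σ)) s := by
    simpa using ((hasDerivAt_id s).const_mul (1 - σ)).const_sub 1
  have h2 := (h1.rpow_const (p := 3 / 2) (Or.inl h.ne')).smul_const p
  refine h2.congr_deriv ?_
  rw [rayCurve, smul_smul]
  congr 1
  rw [show (3 / 2 - 1 : ℝ) = 1 / 2 by norm_num, show (3 / 2 : ℝ) = 1 / 2 + 1 by norm_num,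
    Real.rpow_add_one h.ne']
  field_simp

theorem radius_rpow_smul {h : ℝ} (hh : 0 ≤ h) (p : C4) :
    radius ((h ^ (3 / 2 : ℝ)) • p) = h * radius p := by
  rw [radius, radius, norm_smul, Real.norm_of_nonneg (by positivity),
    Real.mul_rpow (by positivity) (norm_nonneg p), ← Real.rpow_mul hh]
  norm_num

theorem rayCurve_pos {σ s : ℝ} (hσ : 0 ≤ σ) (hs : s ∈ Ioo (0 : ℝ) 1) :
    0 < 1 - (1 - σ) * s := by
  nlinarith [hs.1, hs.2, mul_nonneg hσ hs.1.le]

theorem coMetric_zero_rayCurve (p : C4) {σ s : ℝ} (hσ : 0 ≤ σ) (hs : s ∈ Ioo (0 : ℝ) 1) :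
    coMetric 0 (rayCurve p σ s) (deriv (rayCurve p σ) s) (deriv (rayCurve p σ) s)
      = ((1 - σ) * radius p) ^ 2 := by
  have h := rayCurve_pos hσ hs
  rw [(hasDerivAt_rayCurve p h).deriv, coMetric_zero_radial]
  nth_rewrite 1 [rayCurve]
  rw [radius_rpow_smul h.le]
  field_simp

theorem coDist_zero_ray_le (hp : p ∈ quadric 0) {σ : ℝ} (hσ : 0 ≤ σ) (hσ1 : σ ≤ 1) :
    coDist 0 p ((σ ^ (3 / 2 : ℝ)) • p) ≤ ENNReal.ofReal ((1 - σ) * radius p) := by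
  refine coDist_le_of_contDiffOn (γ := rayCurve p σ) (contDiff_rayCurve p σ).contDiffOn
    (fun s _ => smul_mem_quadric_zero hp _) (by simp [rayCurve]) (by simp [rayCurve])
    (mul_nonneg (by linarith) (radius_nonneg p)) fun s hs => ?_
  rw [coMetric_zero_rayCurve p hσ hs]

theorem coDist_zero_le_radius (hp : p ∈ quadric 0) : coDist 0 p 0 ≤ ENNReal.ofReal (radius p) := by
  have := coDist_zero_ray_le hp le_rfl zero_le_one
  rwa [Real.zero_rpow (by norm_num), zero_smul, sub_zero, one_mul] at this

theorem coDist_zero_le_add (hp : p ∈ quadric 0) (hq : q ∈ quadric 0) :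
    coDist 0 p q ≤ ENNReal.ofReal (radius p + radius q) := by
  rw [ENNReal.ofReal_add (radius_nonneg p) (radius_nonneg q)]
  refine (coDist_triangle 0 p 0 q).trans (add_le_add (coDist_zero_le_radius hp) ?_)
  rw [coDist_comm]
  exact coDist_zero_le_radius hq

/-- The image of a ray in the smoothing has length comparable to that of the ray. -/
theorem coDist_toSmoothing_ray_le (hp : p ∈ quadric 0) (h0 : p ≠ 0) {σ : ℝ} (hσ : 0 < σ)
    (hσ1 : σ ≤ 1) (ht : ‖t‖ ≤ 2 * (σ ^ 3 * ‖p‖ ^ 2)) :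
    coDist t (toSmoothing t p) (toSmoothing t ((σ ^ (3 / 2 : ℝ)) • p))
      ≤ ENNReal.ofReal (3 * radius p) := by
  have hp0 : 0 < ‖p‖ := norm_pos_iff.2 h0
  have hh : ∀ s ∈ Icc (0 : ℝ) 1, σ ≤ 1 - (1 - σ) * s := by
    intro s hs; nlinarith [hs.1, hs.2]
  have hne : ∀ s ∈ Icc (0 : ℝ) 1, rayCurve p σ s ≠ 0 := by
    intro s hs
    have := hh s hs
    exact smul_ne_zero (Real.rpow_pos_of_pos (by linarith) _).ne' h0
  have hnorm : ∀ s ∈ Icc (0 : ℝ) 1, ‖t‖ ≤ 2 * ‖rayCurve p σ s‖ ^ 2 := by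
    intro s hs
    have h1 := hh s hs
    have h2 : 0 < 1 - (1 - σ) * s := by linarith
    have h3 : ‖rayCurve p σ s‖ ^ 2 = (1 - (1 - σ) * s) ^ 3 * ‖p‖ ^ 2 := by
      rw [rayCurve, norm_smul, Real.norm_of_nonneg (by positivity), mul_pow]
      congr 1
      rw [← Real.rpow_natCast ((1 - (1 - σ) * s) ^ (3 / 2 : ℝ)) 2, ← Real.rpow_mul h2.le,
        ← Real.rpow_natCast _ 3]
      norm_num
    rw [h3]
    refine ht.trans ?_
    gcongr
  refine coDist_le_of_contDiffOn (γ := fun s => toSmoothing t (rayCurve p σ s))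
    ((contDiffOn_toSmoothing t).comp (contDiff_rayCurve p σ).contDiffOn hne)
    (fun s hs => toSmoothing_mem (smul_mem_quadric_zero hp _) (hne s hs)) (by simp [rayCurve])
    (by simp [rayCurve])
    (by have := radius_nonneg p; positivity) fun s hs => ?_
  have hs' : s ∈ Icc (0 : ℝ) 1 := Ioo_subset_Icc_self hs
  have h := rayCurve_pos hσ.le hs
  have hd := hasDerivAt_rayCurve p h
  rw [(hasDerivAt_toSmoothing (t := t) (hne s hs') hd).deriv]
  have hq0 : rayCurve p σ s ∈ quadric 0 := smul_mem_quadric_zero hp _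
  have hdot : ∀ k : ℝ, dot (rayCurve p σ s) (k • rayCurve p σ s) = 0 := by
    intro k
    rw [dot_eq_inner, ← Complex.coe_smul, inner_smul_right, ← dot_eq_inner,
      mem_quadric_iff.1 hq0, mul_zero]
  refine (coMetric_toSmoothing_le hq0 (hne s hs') (hdot _) (hnorm s hs')).trans ?_
  rw [← hd.deriv, coMetric_zero_rayCurve p hσ.le hs, mul_pow]
  have hr := radius_nonneg p
  have : ((1 - σ) * radius p) ^ 2 ≤ radius p ^ 2 := by
    apply pow_le_pow_left₀ (mul_nonneg (by linarith) hr)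
    nlinarith
  linarith

theorem contDiff_dot : ContDiff ℝ 1 fun z : C4 => dot z z := by
  unfold dot
  exact ContDiff.sum fun i _ => by fun_prop

/-- Nearby points of `V_t` are joined by short curves, except near the cone point. -/
theorem tendsto_coDist_of_ne_zero (hp : p ∈ quadric t) (h0 : p ≠ 0) :
    Tendsto (coDist t p) (𝓝[quadric t] p) (𝓝 0) := by
  have hp0 : 0 < ‖p‖ := norm_pos_iff.2 h0
  have hpc : ((‖p‖ ^ 2 : ℝ) : ℂ) ≠ 0 := by exact_mod_cast (by positivity : ‖p‖ ^ 2 ≠ 0)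
  have hdotp : ∀ z : C4, ∀ c : ℂ, dot p (z + c • conjC4 p) = dot p z + c * ((‖p‖ ^ 2 : ℝ) : ℂ) := by
    intro z c
    rw [dot_eq_inner, inner_add_right, inner_smul_right, inner_conjC4_left, inner_conjC4_left,
      dot_conjC4_right, inner_self_eq]
  -- A chart that straightens V_t near p: it moves z along p̄ so that dot p (G z - p) becomes (dot z
  -- z - t)/2. Thus V_t corresponds to a linear subspace through p, and the derivative of G at p is
  -- the identity.
  set G : C4 → C4 := fun z => z + (((dot z z - t) / 2 - dot p (z - p)) / ((‖p‖ ^ 2 : ℝ) : ℂ)) • conjC4 p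
    with hG
  have hGp : G p = p := by
    simp only [hG, mem_quadric_iff.1 hp, sub_self]
    simp [dot]
  have hGdot : ∀ z, dot p (G z - p) = (dot z z - t) / 2 := by
    intro z
    have e : G z - p = (z - p) + (((dot z z - t) / 2 - dot p (z - p)) / ((‖p‖ ^ 2 : ℝ) : ℂ)) • conjC4 p := add_sub_right_comm _ _ _
    rw [e, hdotp, div_mul_cancel₀ _ hpc]
    ring
  have hGc : ContDiff ℝ 1 G := by
    refine contDiff_id.add (ContDiff.smul (ContDiff.div_const (ContDiff.sub
      ((contDiff_dot.sub contDiff_const).div_const _) ?_) _) contDiff_const)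
    unfold dot
    exact ContDiff.sum fun i _ => by fun_prop
  have hGd : HasFDerivAt G (ContinuousLinearMap.id ℝ C4) p := by
    have key : ∀ z, G z - p - (z - p)
        = ((dot (z - p) (z - p)) / 2 / ((‖p‖ ^ 2 : ℝ) : ℂ)) • conjC4 p := by
      intro z
      have e : dot z z - t = dot (z - p) (z - p) + 2 * dot p (z - p) := by
        rw [← mem_quadric_iff.1 hp]
        simp only [dot, Finset.mul_sum, ← Finset.sum_add_distrib, ← Finset.sum_sub_distrib]
        refine Finset.sum_congr rfl fun i _ => ?_
        simp
        ring
      simp only [hG, e]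
      rw [add_div, mul_div_cancel_left₀ _ two_ne_zero, add_sub_cancel_right]
      abel
    rw [hasFDerivAt_iff_isLittleO_nhds_zero]
    have : (fun h : C4 => G (p + h) - G p - (ContinuousLinearMap.id ℝ C4) h)
        =O[𝓝 0] fun h : C4 => ‖h‖ ^ 2 := by
      refine Asymptotics.IsBigO.of_bound (1 / 2 / ‖p‖ ^ 2 * ‖p‖) (Eventually.of_forall fun h => ?_)
      have k := key (p + h)
      rw [add_sub_cancel_left] at k
      rw [hGp, ContinuousLinearMap.id_apply, k, norm_smul, norm_conjC4, norm_div, norm_div]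
      have := norm_dot_le h h
      simp only [Complex.norm_real, norm_pow, norm_norm, Complex.norm_ofNat]
      calc ‖dot h h‖ / 2 / ‖p‖ ^ 2 * ‖p‖ ≤ ‖h‖ * ‖h‖ / 2 / ‖p‖ ^ 2 * ‖p‖ := by gcongr
        _ = _ := by ring
    refine this.trans_isLittleO ?_
    exact Asymptotics.isLittleO_norm_pow_id one_lt_two
  have hGd' : HasFDerivAt G (ContinuousLinearEquiv.refl ℝ C4 : C4 →L[ℝ] C4) p := hGd
  set Gi : C4 → C4 := hGc.contDiffAt.localInverse hGd' one_ne_zero with hGi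
  have hGic : ContDiffAt ℝ 1 Gi p := by
    have := hGc.contDiffAt.to_localInverse hGd' one_ne_zero
    rwa [hGp] at this
  have hGip : Gi p = p := by
    have := hGc.contDiffAt.localInverse_apply_image hGd' one_ne_zero
    rwa [hGp] at this
  have hstrict := hGc.contDiffAt.hasStrictFDerivAt' hGd' one_ne_zero
  have hleft : ∀ᶠ z in 𝓝 p, Gi (G z) = z := hstrict.eventually_left_inverse
  have hright : ∀ᶠ z in 𝓝 p, G (Gi z) = z := by
    have := hstrict.eventually_right_inverse
    rwa [hGp] at this
  have hcd : ∀ᶠ z in 𝓝 p, ContDiffAt ℝ 1 Gi z := hGic.eventually (by simp)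
  have hfd : ∀ᶠ z in 𝓝 p, ‖fderiv ℝ Gi z‖ < ‖fderiv ℝ Gi p‖ + 1 := by
    have hc : ContinuousAt (fderiv ℝ Gi) p := hGic.continuousAt_fderiv one_ne_zero
    exact hc.norm.eventually (gt_mem_nhds (by linarith))
  have hnm : ∀ᶠ z in 𝓝 p, ‖p‖ / 2 < ‖Gi z‖ := by
    have hc : ContinuousAt (fun z => ‖Gi z‖) p := hGic.continuousAt.norm
    refine hc.eventually (lt_mem_nhds ?_)
    simp only [hGip]; linarith
  obtain ⟨ε, hε, hball⟩ := Metric.eventually_nhds_iff_ball.1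
    (hright.and (hcd.and (hfd.and hnm)))
  set K := ‖fderiv ℝ Gi p‖ + 1 with hK
  have hK0 : 0 < K := by positivity
  -- The metric is at most (2/3)‖v‖²/r, and near p the local inverse has norm above ‖p‖/2 and
  -- derivative of norm below K.
  set M : ℝ := √(2 / 3 * ((‖p‖ / 2) ^ 2) ^ (-1 / 3 : ℝ)) * K with hM
  have hbound : ∀ᶠ z in 𝓝[quadric t] p, coDist t p z ≤ ENNReal.ofReal (M * ‖G z - p‖) := by
    have hGcont : ∀ᶠ z in 𝓝 p, G z ∈ Metric.ball p ε := by
      have : Tendsto G (𝓝 p) (𝓝 p) := by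
        have := hGc.continuous.tendsto p
        rwa [hGp] at this
      exact this (Metric.ball_mem_nhds p hε)
    filter_upwards [self_mem_nhdsWithin, mem_nhdsWithin_of_mem_nhds hleft,
      mem_nhdsWithin_of_mem_nhds hGcont] with z hz hzl hzb
    have hseg : ∀ s ∈ Icc (0 : ℝ) 1, p + s • (G z - p) ∈ Metric.ball p ε := by
      intro s hs
      rw [Metric.mem_ball, dist_eq_norm] at hzb ⊢
      rw [add_sub_cancel_left, norm_smul, Real.norm_of_nonneg hs.1]
      nlinarith [hs.2, norm_nonneg (G z - p)]
    have hmemq : ∀ s ∈ Icc (0 : ℝ) 1, Gi (p + s • (G z - p)) ∈ quadric t := by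
      intro s hs
      have h1 := (hball _ (hseg s hs)).1
      have h2 := hGdot (Gi (p + s • (G z - p)))
      rw [h1, add_sub_cancel_left, ← Complex.coe_smul, dot_eq_inner, inner_smul_right,
        ← dot_eq_inner, hGdot, mem_quadric_iff.1 hz, sub_self, zero_div, mul_zero] at h2
      rw [mem_quadric_iff]
      linear_combination (-2) * h2
    have hline : ∀ s : ℝ, HasDerivAt (fun s : ℝ => p + s • (G z - p)) (G z - p) s := by
      intro s
      simpa using ((hasDerivAt_id s).smul_const (G z - p)).const_add p
    -- The curve is the preimage of the straight segment from p to G z under the chart; it stays in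
    -- V_t because the segment stays in the linear subspace.
    refine coDist_le_of_contDiffOn (γ := fun s => Gi (p + s • (G z - p))) ?_ ?_ ?_ ?_
      (by positivity) ?_
    · intro s hs
      have h1 := (hball _ (hseg s hs)).2.1
      exact (h1.comp s (by fun_prop :
        ContDiffAt ℝ 1 (fun s : ℝ => p + s • (G z - p)) s)).contDiffWithinAt
    · exact hmemq
    · simp [hGip]
    · simp [hzl]
    · intro s hs
      have hs' := Ioo_subset_Icc_self hs
      obtain ⟨-, h1, h2, h3⟩ := hball _ (hseg s hs')
      have h4 := (h1.differentiableAt one_ne_zero).hasFDerivAt.comp_hasDerivAt s (hline s)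
      have h5 : deriv (fun s => Gi (p + s • (G z - p))) s
        = fderiv ℝ Gi (p + s • (G z - p)) (G z - p) := h4.deriv
      rw [h5]
      have h6 := hmemq s hs'
      have h7 : Gi (p + s • (G z - p)) ≠ 0 := by
        intro h; rw [h, norm_zero] at h3; linarith
      refine (coMetric_le (quadric_subset_region t h6) h7 _).trans ?_
      rw [hM, mul_pow, mul_pow, Real.sq_sqrt (by positivity), mul_assoc _ (K ^ 2), ← mul_pow K]
      have h8 : ‖fderiv ℝ Gi (p + s • (G z - p)) (G z - p)‖ ≤ K * ‖G z - p‖ :=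
        (ContinuousLinearMap.le_opNorm _ _).trans (by gcongr)
      have h9 : (‖Gi (p + s • (G z - p))‖ ^ 2) ^ (-1 / 3 : ℝ) ≤ ((‖p‖ / 2) ^ 2) ^ (-1 / 3 : ℝ) :=
        Real.rpow_le_rpow_of_nonpos (by positivity) (by gcongr) (by norm_num)
      gcongr
  have hlim : Tendsto (fun z => ENNReal.ofReal (M * ‖G z - p‖)) (𝓝[quadric t] p) (𝓝 0) := by
    have hc : Continuous fun z => ENNReal.ofReal (M * ‖G z - p‖) :=
      ENNReal.continuous_ofReal.comp
        (continuous_const.mul ((hGc.continuous.sub continuous_const).norm))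
    exact (hc.tendsto' p 0 (by simp [hGp])).mono_left nhdsWithin_le_nhds
  exact tendsto_of_tendsto_of_tendsto_of_le_of_le' tendsto_const_nhds hlim
    (Eventually.of_forall fun _ => zero_le) hbound

theorem tendsto_coDist (hp : p ∈ quadric t) :
    Tendsto (coDist t p) (𝓝[quadric t] p) (𝓝 0) := by
  by_cases h0 : p = 0
  · subst h0
    have ht : t = 0 := by
      have := mem_quadric_iff.1 hp
      simpa [dot] using this.symm
    subst ht
    have hlim : Tendsto (fun z => ENNReal.ofReal (radius z)) (𝓝[quadric 0] (0 : C4)) (𝓝 0) := by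
      have hc : Continuous fun z : C4 => ENNReal.ofReal (radius z) :=
        ENNReal.continuous_ofReal.comp
          (continuous_norm.rpow_const fun _ => Or.inr (by norm_num))
      exact (hc.tendsto' 0 0 (by simp [radius])).mono_left nhdsWithin_le_nhds
    refine tendsto_of_tendsto_of_tendsto_of_le_of_le' tendsto_const_nhds hlim
      (Eventually.of_forall fun _ => zero_le) ?_
    filter_upwards [self_mem_nhdsWithin] with z hz
    rw [coDist_comm]
    exact coDist_zero_le_radius hz
  · exact tendsto_coDist_of_ne_zero hp h0

end Paths

/-! ### The metric spaces `(D_t(R), d_{co,t})` -/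

section Spaces

variable {t : ℂ} {p q z v : C4}

theorem smul_mem_quadric (c : ℂ) (hp : p ∈ quadric t) : c • p ∈ quadric (c ^ 2 * t) := by
  rw [mem_quadric_iff] at hp ⊢
  rw [← hp, dot, dot, Finset.mul_sum]
  refine Finset.sum_congr rfl fun i _ => ?_
  rw [PiLp.smul_apply, smul_eq_mul]
  ring

/-- The two-sided bounds are homogeneous under z ↦ cz and lose only a factor 3/2 ≤ 2², so exact
homogeneity of the metric is not needed. -/
theorem coMetric_smul_le {c : ℂ} (hz : z ∈ quadric t) (h0 : z ≠ 0) (hv : dot z v = 0)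
    (hc : c ≠ 0) :
    coMetric (c ^ 2 * t) (c • z) (c • v) (c • v)
      ≤ (2 * ‖c‖ ^ (2 / 3 : ℝ)) ^ 2 * coMetric t z v v := by
  have hc0 : 0 < ‖c‖ := norm_pos_iff.2 hc
  have hz0 : 0 < ‖z‖ := norm_pos_iff.2 h0
  have h1 := coMetric_le (quadric_subset_region _ (smul_mem_quadric c hz)) (smul_ne_zero hc h0)
    (c • v)
  have h2 := le_coMetric hz h0 hv
  have e : (‖c • z‖ ^ 2) ^ (-1 / 3 : ℝ) * ‖c • v‖ ^ 2
      = (‖c‖ ^ (2 / 3 : ℝ)) ^ 2 * ((‖z‖ ^ 2) ^ (-1 / 3 : ℝ) * ‖v‖ ^ 2) := by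
    have e1 : (‖c‖ ^ (2 / 3 : ℝ)) ^ 2 = (‖c‖ ^ 2) ^ (-1 / 3 : ℝ) * ‖c‖ ^ 2 := by
      rw [← Real.rpow_natCast, ← Real.rpow_natCast, ← Real.rpow_mul hc0.le, ← Real.rpow_mul hc0.le,
        ← Real.rpow_add hc0]
      norm_num
    rw [norm_smul, norm_smul, mul_pow, mul_pow, Real.mul_rpow (by positivity) (by positivity), e1]
    ring
  have h3 : 0 ≤ (‖c‖ ^ (2 / 3 : ℝ)) ^ 2 := by positivity
  have h4 := mul_le_mul_of_nonneg_left h2 h3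
  have h5 : 0 ≤ (‖c‖ ^ (2 / 3 : ℝ)) ^ 2 * ((‖z‖ ^ 2) ^ (-1 / 3 : ℝ) * ‖v‖ ^ 2) := by positivity
  rw [mul_pow]
  linarith

theorem coDist_smul_le {c : ℂ} (ht : t ≠ 0) (hc : c ≠ 0) (p q : C4) :
    coDist (c ^ 2 * t) (c • p) (c • q)
      ≤ ENNReal.ofReal (2 * ‖c‖ ^ (2 / 3 : ℝ)) * coDist t p q := by
  have hc0 : 0 < ‖c‖ := norm_pos_iff.2 hc
  have hpos : 0 < 2 * ‖c‖ ^ (2 / 3 : ℝ) := by positivity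
  rw [coDist, coDist, ENNReal.mul_iInf_of_ne (ENNReal.ofReal_pos.2 hpos).ne' ENNReal.ofReal_ne_top]
  refine le_iInf fun γ => ?_
  rw [ENNReal.mul_iInf_of_ne (ENNReal.ofReal_pos.2 hpos).ne' ENNReal.ofReal_ne_top]
  refine le_iInf fun hγ => ?_
  obtain ⟨hpw, hmem, h0, h1⟩ := hγ
  have hpw' := piecewiseC1_iff.1 hpw
  have hcurve : IsCurve (c ^ 2 * t) (c • p) (c • q) (fun s => c • γ s) := by
    refine ⟨piecewiseC1_iff.2 ?_, fun s hs => smul_mem_quadric c (hmem s hs), by simp [h0], by simp [h1]⟩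
    exact hpw'.map (Φ := fun z => c • z) (U := univ) (contDiff_const_smul c).contDiffOn
      (mapsTo_univ _ _)
  refine (coDist_le_coLength hcurve).trans ?_
  rw [coLength_eq, coLength_eq, ← lintegral_const_mul' _ _ ENNReal.ofReal_ne_top]
  refine lintegral_mono_ae ?_
  filter_upwards [hpw'.ae_tangent hmem] with s hs
  obtain ⟨hs', hd, hdot⟩ := hs
  have hq := hmem s ⟨hs'.1.le, hs'.2.le⟩
  have hne : γ s ≠ 0 := by
    intro h
    rw [h, mem_quadric_iff] at hq
    exact ht (by simpa [dot] using hq.symm)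
  have hd' : HasDerivAt (fun s => c • γ s) (c • deriv γ s) s := hd.const_smul c
  rw [coSpeed, coSpeed, ← ENNReal.ofReal_mul hpos.le, hd'.deriv]
  refine ENNReal.ofReal_le_ofReal ?_
  rw [Real.sqrt_le_left (by positivity), mul_pow,
    Real.sq_sqrt (le_trans (by positivity) (le_coMetric hq hne hdot))]
  exact coMetric_smul_le hq hne hdot hc

/-- The inclusion `ℝ⁴ → ℂ⁴`. -/
def ofRealC4 (x : EuclideanSpace ℝ (Fin 4)) : C4 := WithLp.toLp 2 fun i => (x i : ℂ)

/-- The conditions ∑ z_i² = 1 and ∑ |z_i|² = 1 together force all imaginary parts to vanish: the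
vanishing sphere of V_1 is the real S³. -/
theorem exists_ofRealC4_eq (hz : z ∈ quadric 1) (hn : ‖z‖ = 1) :
    ∃ x ∈ Metric.sphere (0 : EuclideanSpace ℝ (Fin 4)) 1, ofRealC4 x = z := by
  have h1 : ∑ i, ((z i).re * (z i).re - (z i).im * (z i).im) = 1 := by
    have hz' : ∑ i, z i ^ 2 = 1 := hz
    have := congrArg Complex.re hz'
    simpa [sq] using this
  have h2 : ∑ i, ((z i).re * (z i).re + (z i).im * (z i).im) = 1 := by
    have := EuclideanSpace.norm_sq_eq z
    rw [hn] at this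
    simp only [← Complex.normSq_eq_norm_sq, Complex.normSq_apply] at this
    linarith
  have h3 : ∑ i, (z i).im * (z i).im = 0 := by
    rw [Finset.sum_add_distrib] at h2
    rw [Finset.sum_sub_distrib] at h1
    linarith
  have him : ∀ i, (z i).im = 0 := by
    intro i
    have := (Finset.sum_eq_zero_iff_of_nonneg (fun i _ => mul_self_nonneg (z i).im)).1 h3 i
      (Finset.mem_univ i)
    exact mul_self_eq_zero.1 this
  refine ⟨WithLp.toLp 2 fun i => (z i).re, ?_, ?_⟩
  · rw [mem_sphere_zero_iff_norm, EuclideanSpace.norm_eq]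
    simp only [him, mul_zero, add_zero] at h2
    simp [sq, h2]
  · ext i
    simp [ofRealC4, Complex.ext_iff, him]

theorem ofRealC4_mem {x : EuclideanSpace ℝ (Fin 4)} (hx : x ∈ Metric.sphere 0 1) :
    ofRealC4 x ∈ quadric 1 := by
  rw [mem_sphere_zero_iff_norm, EuclideanSpace.norm_eq, Real.sqrt_eq_one] at hx
  simp only [Real.norm_eq_abs, sq_abs] at hx
  have : (∑ i, (x i : ℂ) ^ 2) = 1 := by exact_mod_cast hx
  exact this

theorem continuous_ofRealC4 : Continuous ofRealC4 := by
  unfold ofRealC4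
  fun_prop

/-- Being at finite distance is a transitive relation that holds locally by `tendsto_coDist`, and S³
is connected. -/
theorem coDist_sphere_lt_top (hp : p ∈ quadric 1) (hp1 : ‖p‖ = 1) (hq : q ∈ quadric 1)
    (hq1 : ‖q‖ = 1) : coDist 1 p q < ⊤ := by
  obtain ⟨x, hx, rfl⟩ := exists_ofRealC4_eq hp hp1
  obtain ⟨y, hy, rfl⟩ := exists_ofRealC4_eq hq hq1
  have hrank : 1 < Module.rank ℝ (EuclideanSpace ℝ (Fin 4)) := by
    rw [rank_eq_card_basis (EuclideanSpace.basisFun (Fin 4) ℝ).toBasis]; norm_num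
  have hconn := isPreconnected_sphere hrank (0 : EuclideanSpace ℝ (Fin 4)) 1
  refine hconn.induction₂' (fun x y => coDist 1 (ofRealC4 x) (ofRealC4 y) < ⊤) ?_ ?_ hx hy
  · intro x hx
    have h := (tendsto_coDist (ofRealC4_mem hx)).eventually (gt_mem_nhds ENNReal.zero_lt_top)
    have hc : Tendsto ofRealC4 (𝓝[Metric.sphere 0 1] x) (𝓝[quadric 1] (ofRealC4 x)) :=
      continuous_ofRealC4.continuousWithinAt.tendsto_nhdsWithin fun y hy => ofRealC4_mem hy
    filter_upwards [hc.eventually h] with y hy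
    exact ⟨hy, by rwa [coDist_comm]⟩
  · intro x y z _ _ _ hxy hyz
    exact (coDist_triangle 1 _ _ _).trans_lt (ENNReal.add_lt_top.2 ⟨hxy, hyz⟩)

theorem radius_le_radius (h : ‖p‖ ≤ ‖q‖) : radius p ≤ radius q := by
  unfold radius; gcongr

/-- Every point of `V_t` is joined to the vanishing sphere by a curve of controlled length. -/
theorem exists_vanishing_sphere_near (ht : t ≠ 0) (hp : p ∈ quadric t) :
    ∃ w ∈ quadric t, ‖w‖ ^ 2 = ‖t‖ ∧ coDist t p w ≤ ENNReal.ofReal (3 * radius p) := by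
  have hs : 0 < ‖t‖ := norm_pos_iff.2 ht
  rcases (norm_le_norm_sq hp).eq_or_lt with h | h
  · exact ⟨p, hp, h.symm, by rw [coDist_self hp]; exact zero_le⟩
  obtain ⟨h1, h2, h3⟩ := fromSmoothing_spec hp h
  obtain ⟨h4, h5⟩ := coneNormSq_spec h
  set z := fromSmoothing t p with hz
  set x := coneNormSq t p with hx
  have hx0 : 0 < x := by linarith
  have hz0 : z ≠ 0 := by
    intro hz; rw [hz, norm_zero] at h2; norm_num at h2; linarith
  set σ : ℝ := (‖t‖ / (2 * x)) ^ (1 / 3 : ℝ) with hσ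
  have hσ0 : 0 < σ := by positivity
  have hσ3 : σ ^ 3 = ‖t‖ / (2 * x) := by
    rw [hσ, ← Real.rpow_natCast, ← Real.rpow_mul (by positivity)]; norm_num
  have hσ1 : σ ≤ 1 := by
    refine Real.rpow_le_one (by positivity) ?_ (by norm_num)
    rw [div_le_one (by positivity)]; linarith
  have hσz : ‖(σ ^ (3 / 2 : ℝ)) • z‖ ^ 2 = ‖t‖ / 2 := by
    rw [norm_smul, Real.norm_of_nonneg (by positivity), mul_pow, h2,
      ← Real.rpow_natCast (σ ^ (3 / 2 : ℝ)) 2, ← Real.rpow_mul hσ0.le,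
      show (3 / 2 * ((2 : ℕ) : ℝ) : ℝ) = (3 : ℕ) by norm_num, Real.rpow_natCast, hσ3]
    field_simp
  have hσq := smul_mem_quadric_zero h1 (σ ^ (3 / 2 : ℝ))
  have hray := coDist_toSmoothing_ray_le (t := t) h1 hz0 hσ0 hσ1 (by
    rw [hσ3, h2]; apply le_of_eq; field_simp)
  refine ⟨toSmoothing t ((σ ^ (3 / 2 : ℝ)) • z), toSmoothing_mem hσq
    (smul_ne_zero (by positivity) hz0), ?_, ?_⟩
  · rw [norm_sq_toSmoothing hσq, norm_smoothingCoeff, hσz]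
    field_simp
    norm_num
  · rw [h3] at hray
    refine hray.trans (ENNReal.ofReal_le_ofReal ?_)
    have : radius z ≤ radius p := by
      refine radius_le_radius ?_
      have h6 : ‖z‖ ^ 2 ≤ ‖p‖ ^ 2 := by
        rw [h2]; nlinarith
      exact (sq_le_sq₀ (norm_nonneg _) (norm_nonneg _)).1 h6
    linarith

theorem exists_smul_of_vanishing_sphere (ht : t ≠ 0) : ∃ c : ℂ, c ≠ 0 ∧ c ^ 2 = t ∧
    ∀ w ∈ quadric t, ‖w‖ ^ 2 = ‖t‖ → ∃ w' ∈ quadric 1, ‖w'‖ = 1 ∧ w = c • w' := by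
  obtain ⟨c, hc⟩ := IsAlgClosed.exists_pow_nat_eq t (n := 2) two_pos
  have hc0 : c ≠ 0 := by rintro rfl; exact ht (by simpa using hc.symm)
  refine ⟨c, hc0, hc, fun w hw hwn => ⟨c⁻¹ • w, ?_, ?_, ?_⟩⟩
  · have := smul_mem_quadric c⁻¹ hw
    rwa [← hc, inv_pow, inv_mul_cancel₀ (pow_ne_zero 2 hc0)] at this
  · have h1 : ‖w‖ ^ 2 = ‖c‖ ^ 2 := by rw [hwn, ← hc, norm_pow]
    have h2 : ‖w‖ = ‖c‖ := (sq_eq_sq₀ (norm_nonneg _) (norm_nonneg _)).1 h1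
    rw [norm_smul, norm_inv, h2, inv_mul_cancel₀ (norm_ne_zero_iff.2 hc0)]
  · rw [smul_inv_smul₀ hc0]

/-- Multiplication by c with c² = t carries the vanishing sphere of V_1 onto that of V_t, and
|c|^(2/3) is the radius of the latter. -/
theorem coDist_le_of_sphere {D : ℝ≥0∞} (hD : ∀ p ∈ quadric 1, ∀ q ∈ quadric 1, ‖p‖ = 1 → ‖q‖ = 1 →
    coDist 1 p q ≤ D) (ht : t ≠ 0) (hp : p ∈ quadric t) (hq : q ∈ quadric t) (hpn : ‖p‖ ^ 2 = ‖t‖)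
    (hqn : ‖q‖ ^ 2 = ‖t‖) :
    coDist t p q ≤ ENNReal.ofReal (2 * radius p) * D := by
  obtain ⟨c, hc0, hc, h⟩ := exists_smul_of_vanishing_sphere ht
  have hpc : ‖p‖ = ‖c‖ := by
    have h1 : ‖p‖ ^ 2 = ‖c‖ ^ 2 := by rw [hpn, ← hc, norm_pow]
    exact (sq_eq_sq₀ (norm_nonneg _) (norm_nonneg _)).1 h1
  obtain ⟨p', hp', hpn', hpe⟩ := h p hp hpn
  obtain ⟨q', hq', hqn', hqe⟩ := h q hq hqn
  have := coDist_smul_le (t := 1) one_ne_zero hc0 p' q'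
  rw [mul_one, hc, ← hpe, ← hqe] at this
  refine this.trans ?_
  rw [radius, hpc]
  gcongr
  exact hD p' hp' q' hq' hpn' hqn'

theorem coDist_ne_top (hp : p ∈ quadric t) (hq : q ∈ quadric t) : coDist t p q ≠ ⊤ := by
  by_cases ht : t = 0
  · subst ht
    exact ne_top_of_le_ne_top ENNReal.ofReal_ne_top (coDist_zero_le_add hp hq)
  obtain ⟨w, hw, hwn, hpw⟩ := exists_vanishing_sphere_near ht hp
  obtain ⟨w', hw', hwn', hqw⟩ := exists_vanishing_sphere_near ht hq
  have hww : coDist t w w' < ⊤ := by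
    obtain ⟨c, hc0, hc, h⟩ := exists_smul_of_vanishing_sphere ht
    obtain ⟨a, ha, han, hae⟩ := h w hw hwn
    obtain ⟨b, hb, hbn, hbe⟩ := h w' hw' hwn'
    have := coDist_smul_le (t := 1) one_ne_zero hc0 a b
    rw [mul_one, hc, ← hae, ← hbe] at this
    exact this.trans_lt (ENNReal.mul_lt_top ENNReal.ofReal_lt_top (coDist_sphere_lt_top ha han hb hbn))
  have h1 := (coDist_triangle t p w w').trans_lt
    (ENNReal.add_lt_top.2 ⟨hpw.trans_lt ENNReal.ofReal_lt_top, hww⟩)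
  refine ((coDist_triangle t p w' q).trans_lt (ENNReal.add_lt_top.2 ⟨h1, ?_⟩)).ne
  rw [coDist_comm]
  exact hqw.trans_lt ENNReal.ofReal_lt_top

/-- The set `D_t(R)` as a type, to be equipped with the distance `d_{co,t}`. -/
def Disc (t : ℂ) (R : ℝ) : Type := disc t R

instance (t : ℂ) (R : ℝ) : EMetricSpace (Disc t R) where
  edist p q := coDist t p.1 q.1
  edist_self p := coDist_self p.2.1
  edist_comm p q := coDist_comm t p.1 q.1
  edist_triangle p q w := coDist_triangle t p.1 q.1 w.1
  eq_of_edist_eq_zero h := Subtype.ext (eq_of_coDist_eq_zero h)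

instance (t : ℂ) (R : ℝ) : MetricSpace (Disc t R) :=
  EMetricSpace.toMetricSpace fun p q => coDist_ne_top p.2.1 q.2.1

theorem continuous_radius : Continuous radius :=
  continuous_norm.rpow_const fun _ => Or.inr (by norm_num)

theorem isCompact_disc (t : ℂ) (R : ℝ) : IsCompact (disc t R) := by
  refine Metric.isCompact_of_isClosed_isBounded ?_ ?_
  · have h1 : IsClosed {z : C4 | dot z z = t} :=
      isClosed_eq contDiff_dot.continuous continuous_const
    have h2 : IsClosed {z : C4 | radius z ≤ R} := isClosed_le continuous_radius continuous_const
    have h3 : disc t R = {z : C4 | dot z z = t} ∩ {z : C4 | radius z ≤ R} := by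
      ext z
      exact and_congr mem_quadric_iff Iff.rfl
    rw [h3]
    exact h1.inter h2
  · refine (Metric.isBounded_closedBall (x := (0 : C4)) (r := R ^ (3 / 2 : ℝ))).subset ?_
    intro z hz
    rw [mem_closedBall_zero_iff]
    have h := Real.rpow_le_rpow (radius_nonneg z) hz.2 (show (0 : ℝ) ≤ 3 / 2 by norm_num)
    rw [radius, ← Real.rpow_mul (norm_nonneg z)] at h
    norm_num at h
    exact h

/-- By `tendsto_coDist` the identity from the Euclidean disc, which is compact, is continuous for
d_{co,t}. -/
instance (t : ℂ) (R : ℝ) : CompactSpace (Disc t R) := by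
  have hcs : CompactSpace (disc t R) := isCompact_iff_compactSpace.1 (isCompact_disc t R)
  let f : disc t R → Disc t R := fun p => p
  have hf : Continuous f := by
    rw [continuous_iff_continuousAt]
    intro p
    rw [ContinuousAt, tendsto_iff_edist_tendsto_0]
    have h1 : Tendsto (fun q : disc t R => (q : C4)) (𝓝 p) (𝓝[quadric t] (p : C4)) :=
      tendsto_nhdsWithin_iff.2
        ⟨continuous_subtype_val.tendsto p, Eventually.of_forall fun q => q.2.1⟩
    refine ((tendsto_coDist p.2.1).comp h1).congr fun q => ?_
    exact coDist_comm t p.1 q.1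
  have hs : Function.Surjective f := fun p => ⟨p, rfl⟩
  exact hs.compactSpace hf

/-- Distances in `V_t` are controlled by the radii, uniformly in `t`. -/
theorem exists_coDist_le_radius : ∃ C : ℝ, 0 < C ∧ ∀ (t : ℂ) (p q : C4), t ≠ 0 → p ∈ quadric t →
    q ∈ quadric t → coDist t p q ≤ ENNReal.ofReal (C * (radius p + radius q)) := by
  -- The vanishing sphere of V_1 lies in the compact space `Disc 1 1`, so its intrinsic diameter is
  -- bounded by the finite number D.
  set D := Metric.diam (univ : Set (Disc 1 1)) with hD
  have hD0 : 0 ≤ D := Metric.diam_nonneg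
  have hsph : ∀ p ∈ quadric 1, ∀ q ∈ quadric 1, ‖p‖ = 1 → ‖q‖ = 1 →
      coDist 1 p q ≤ ENNReal.ofReal D := by
    intro p hp q hq hpn hqn
    let p' : Disc 1 1 := ⟨p, hp, by simp [radius, hpn]⟩
    let q' : Disc 1 1 := ⟨q, hq, by simp [radius, hqn]⟩
    have h := Metric.dist_le_diam_of_mem (isCompact_univ : IsCompact (univ : Set (Disc 1 1))).isBounded
      (mem_univ p') (mem_univ q')
    exact (ENNReal.le_ofReal_iff_toReal_le (coDist_ne_top hp hq) hD0).2 h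
  refine ⟨3 + 2 * D, by positivity, fun t p q ht hp hq => ?_⟩
  obtain ⟨w, hw, hwn, hpw⟩ := exists_vanishing_sphere_near ht hp
  obtain ⟨w', hw', hwn', hqw⟩ := exists_vanishing_sphere_near ht hq
  have hww := coDist_le_of_sphere hsph ht hw hw' hwn hwn'
  have hrw : radius w ≤ radius p := by
    refine radius_le_radius ?_
    have : ‖w‖ ^ 2 ≤ ‖p‖ ^ 2 := by rw [hwn]; exact norm_le_norm_sq hp
    exact (sq_le_sq₀ (norm_nonneg _) (norm_nonneg _)).1 this
  have hrp := radius_nonneg p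
  have hrq := radius_nonneg q
  have hrw0 := radius_nonneg w
  rw [coDist_comm] at hqw
  calc coDist t p q ≤ coDist t p w + (coDist t w w' + coDist t w' q) :=
        (coDist_triangle t p w q).trans (by gcongr; exact coDist_triangle t w w' q)
    _ ≤ ENNReal.ofReal (3 * radius p) + (ENNReal.ofReal (2 * radius w) * ENNReal.ofReal D
        + ENNReal.ofReal (3 * radius q)) := by gcongr
    _ = ENNReal.ofReal (3 * radius p + (2 * radius w * D + 3 * radius q)) := by
        rw [← ENNReal.ofReal_mul (by positivity), ← ENNReal.ofReal_add (by positivity) (by positivity),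
          ← ENNReal.ofReal_add (by positivity) (by positivity)]
    _ ≤ _ := by
        refine ENNReal.ofReal_le_ofReal ?_
        nlinarith [mul_le_mul_of_nonneg_right hrw hD0, mul_nonneg hrq hD0]

end Spaces

/-! ### Gromov-Hausdorff convergence -/

section Convergence

variable {t : ℂ} {p q z v : C4}

theorem radius_pow_three (z : C4) : radius z ^ 3 = ‖z‖ ^ 2 := by
  rw [radius_eq, ← Real.rpow_natCast, ← Real.rpow_mul (by positivity)]
  norm_num

theorem radius_le_iff {R : ℝ} (hR : 0 ≤ R) : radius z ≤ R ↔ ‖z‖ ^ 2 ≤ R ^ 3 := by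
  rw [← radius_pow_three, pow_le_pow_iff_left₀ (radius_nonneg z) hR (by norm_num)]

theorem le_radius_iff {R : ℝ} (hR : 0 ≤ R) : R ≤ radius z ↔ R ^ 3 ≤ ‖z‖ ^ 2 := by
  rw [← radius_pow_three, pow_le_pow_iff_left₀ hR (radius_nonneg z) (by norm_num)]

theorem beta_pow_three (t : ℂ) : beta t 1 ^ 3 = 1 + ‖t‖ ^ 2 / 4 := by
  rw [beta, ← Real.rpow_natCast, ← Real.rpow_mul (by positivity)]
  norm_num

theorem beta_nonneg (t : ℂ) : 0 ≤ beta t 1 := by unfold beta; positivity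

theorem fromSmoothing_toSmoothing (hz : z ∈ quadric 0) (h : ‖t‖ < 2 * ‖z‖ ^ 2) :
    ‖t‖ < ‖toSmoothing t z‖ ^ 2 ∧ fromSmoothing t (toSmoothing t z) = z := by
  have hX : 0 < ‖z‖ ^ 2 := by linarith [norm_nonneg t]
  have ha : ‖smoothingCoeff t z‖ < 1 := by
    rw [norm_smoothingCoeff, div_lt_one (by positivity)]; exact h
  have ha0 := norm_nonneg (smoothingCoeff t z)
  have hs : ‖t‖ = 2 * ‖z‖ ^ 2 * ‖smoothingCoeff t z‖ := by
    rw [norm_smoothingCoeff, mul_div_cancel₀ _ (by positivity)]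
  have hY := norm_sq_toSmoothing (t := t) hz
  set α := ‖smoothingCoeff t z‖ with hα
  have hlt : ‖t‖ < ‖toSmoothing t z‖ ^ 2 := by
    rw [hs, hY]
    have : 0 < ‖z‖ ^ 2 * (1 - α) ^ 2 := mul_pos hX (pow_pos (by linarith) 2)
    linarith
  have hx : coneNormSq t (toSmoothing t z) = ‖z‖ ^ 2 := by
    have e : (‖toSmoothing t z‖ ^ 2) ^ 2 - ‖t‖ ^ 2 = (‖z‖ ^ 2 * (1 - α ^ 2)) ^ 2 := by
      rw [hY, hs]; ring
    rw [coneNormSq, e, Real.sqrt_sq (mul_nonneg hX.le (by nlinarith)), hY]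
    ring
  refine ⟨hlt, ?_⟩
  have hcoef : t / (2 * ((‖z‖ ^ 2 : ℝ) : ℂ)) = smoothingCoeff t z := rfl
  have hα' : ‖t‖ / (2 * ‖z‖ ^ 2) = α := by rw [hα, norm_smoothingCoeff]
  rw [fromSmoothing, hx, hcoef, hα', toSmoothing, map_add, conjC4_smul, conjC4_conjC4]
  have hk : 1 - α ^ 2 ≠ 0 := by nlinarith
  rw [inv_smul_eq_iff₀ hk, smul_add, smul_smul, Complex.mul_conj', ← hα, sub_smul, one_smul,
    ← Complex.ofReal_pow, Complex.coe_smul]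
  abel

/-- Comparison of the lengths of a curve in the cone and of its image in the smoothing. -/
theorem coLength_toSmoothing {ε κ : ℝ} {γ : ℝ → C4} (hε : 0 < ε) (hε1 : ε ≤ 1 / 4) (hκ : 0 < κ)
    (H : ∀ z v, z ∈ quadric 0 → dot z v = 0 → κ ≤ ‖z‖ ^ 2 →
      |coMetric t (toSmoothing t z) (toSmoothingDeriv t z v) (toSmoothingDeriv t z v)
        - coMetric 0 z v v| ≤ ε * coMetric 0 z v v)
    (hγ : PwC1 γ 0 1) (hmem : ∀ s ∈ Icc (0 : ℝ) 1, γ s ∈ quadric 0)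
    (hb : ∀ s ∈ Icc (0 : ℝ) 1, κ ≤ ‖γ s‖ ^ 2) :
    coLength t (fun s => toSmoothing t (γ s)) ≤ ENNReal.ofReal (1 + 2 * ε) * coLength 0 γ ∧
      coLength 0 γ ≤ ENNReal.ofReal (1 + 2 * ε) * coLength t (fun s => toSmoothing t (γ s)) := by
  have hpos : 0 ≤ 1 + 2 * ε := by linarith
  have key : ∀ᵐ s ∂volume.restrict (Icc (0 : ℝ) 1),
      coSpeed t (fun s => toSmoothing t (γ s)) s ≤ ENNReal.ofReal (1 + 2 * ε) * coSpeed 0 γ s ∧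
      coSpeed 0 γ s ≤ ENNReal.ofReal (1 + 2 * ε) * coSpeed t (fun s => toSmoothing t (γ s)) s := by
    filter_upwards [hγ.ae_tangent hmem] with s hs
    obtain ⟨hs', hd, hdot⟩ := hs
    have hsI : s ∈ Icc (0 : ℝ) 1 := Ioo_subset_Icc_self hs'
    have hne : γ s ≠ 0 := by
      intro h
      have := hb s hsI
      rw [h, norm_zero] at this
      norm_num at this
      linarith
    have h1 := abs_le.1 (H (γ s) (deriv γ s) (hmem s hsI) hdot (hb s hsI))
    have h2 : 0 ≤ coMetric 0 (γ s) (deriv γ s) (deriv γ s) :=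
      le_trans (by positivity) (le_coMetric (hmem s hsI) hne hdot)
    have hsq : ∀ x y : ℝ, 0 ≤ x → y ≤ (1 + 2 * ε) * x →
        ENNReal.ofReal √y ≤ ENNReal.ofReal (1 + 2 * ε) * ENNReal.ofReal √x := by
      intro x y hx hxy
      rw [← ENNReal.ofReal_mul hpos]
      refine ENNReal.ofReal_le_ofReal ?_
      rw [Real.sqrt_le_left (by positivity), mul_pow, Real.sq_sqrt hx]
      nlinarith [mul_nonneg hε.le hx, mul_nonneg (sq_nonneg ε) hx]
    rw [coSpeed, coSpeed, (hasDerivAt_toSmoothing (t := t) hne hd).deriv]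
    set g := coMetric 0 (γ s) (deriv γ s) (deriv γ s)
    have hεg := mul_nonneg hε.le h2
    have h14 := mul_le_mul_of_nonneg_right hε1 h2
    -- The second bound rests on (1 + 2ε)(1 - ε) ≥ 1, valid since ε ≤ 1/4.
    refine ⟨hsq _ _ h2 (by linarith), hsq _ _ (by linarith) ?_⟩
    nlinarith
  rw [coLength_eq, coLength_eq, ← lintegral_const_mul' _ _ ENNReal.ofReal_ne_top,
    ← lintegral_const_mul' _ _ ENNReal.ofReal_ne_top]
  exact ⟨lintegral_mono_ae (key.mono fun s hs => hs.1), lintegral_mono_ae (key.mono fun s hs => hs.2)⟩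

theorem isCurve_toSmoothing {γ : ℝ → C4} (hγ : IsCurve 0 p q γ)
    (hne : ∀ s ∈ Icc (0 : ℝ) 1, γ s ≠ 0) :
    IsCurve t (toSmoothing t p) (toSmoothing t q) (fun s => toSmoothing t (γ s)) := by
  obtain ⟨hpw, hmem, h0, h1⟩ := hγ
  refine ⟨piecewiseC1_iff.2 ((piecewiseC1_iff.1 hpw).map (Φ := toSmoothing t) (U := {z | z ≠ 0})
    (contDiffOn_toSmoothing t) hne),
    fun s hs => toSmoothing_mem (hmem s hs) (hne s hs), by simp [h0], by simp [h1]⟩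

/-- A curve through a point of small radius is at least as long as the two radii. -/
theorem radius_add_le_coLength {γ : ℝ → C4} (hγ : IsCurve t p q γ) {c δ : ℝ}
    (hc : c ∈ Icc (0 : ℝ) 1) (hδ : radius (γ c) ≤ δ) :
    ENNReal.ofReal (radius p + radius q - 2 * δ) ≤ coLength t γ := by
  obtain ⟨hpw, hmem, h0, h1⟩ := hγ
  have hpw' := piecewiseC1_iff.1 hpw
  have hrp := radius_nonneg p
  have hrq := radius_nonneg q
  have htri : ENNReal.ofReal (radius p + radius q - 2 * δ)
      ≤ ENNReal.ofReal |radius (γ c) - radius p| + ENNReal.ofReal |radius q - radius (γ c)| := by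
    rw [← ENNReal.ofReal_add (abs_nonneg _) (abs_nonneg _)]
    refine ENNReal.ofReal_le_ofReal ?_
    have h2 := neg_abs_le (radius (γ c) - radius p)
    have h3 := le_abs_self (radius q - radius (γ c))
    linarith
  refine htri.trans ?_
  rw [coLength_eq, lintegral_Icc_split _ hc.1 hc.2, ← h0, ← h1]
  refine add_le_add ?_ ?_
  · rcases hc.1.eq_or_lt with h | h
    · simp [← h]
    rcases hc.2.eq_or_lt with h' | h'
    · subst h'; exact hpw'.ofReal_abs_radius_sub_le hmem
    exact (hpw'.split h h').1.ofReal_abs_radius_sub_le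
      fun s hs => hmem s ⟨hs.1, hs.2.trans hc.2⟩
  · rcases hc.2.eq_or_lt with h' | h'
    · simp [h']
    rcases hc.1.eq_or_lt with h | h
    · subst h; exact hpw'.ofReal_abs_radius_sub_le hmem
    exact (hpw'.split h h').2.ofReal_abs_radius_sub_le
      fun s hs => hmem s ⟨hc.1.trans hs.1, hs.2⟩

theorem coLength_rayCurve_le (p : C4) {σ : ℝ} (hσ : 0 ≤ σ) (hσ1 : σ ≤ 1) :
    coLength 0 (rayCurve p σ) ≤ ENNReal.ofReal (radius p) := by
  rw [coLength_eq, ← Measure.restrict_congr_set (Ioo_ae_eq_Icc (a := (0 : ℝ)) (b := 1))]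
  calc _ ≤ ∫⁻ s in Ioo (0 : ℝ) 1, ENNReal.ofReal (radius p) := by
        refine setLIntegral_mono' measurableSet_Ioo fun s hs => ENNReal.ofReal_le_ofReal ?_
        rw [coMetric_zero_rayCurve p hσ hs,
          Real.sqrt_sq (mul_nonneg (by linarith) (radius_nonneg p))]
        nlinarith [radius_nonneg p]
    _ = ENNReal.ofReal (radius p) := by simp

theorem isCurve_rayCurve (hp : p ∈ quadric 0) (σ : ℝ) :
    IsCurve 0 p ((σ ^ (3 / 2 : ℝ)) • p) (rayCurve p σ) :=
  ⟨piecewiseC1_iff.2 (.single one_pos (contDiff_rayCurve p σ).contDiffOn),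
    fun _ _ => smul_mem_quadric_zero hp _, by simp [rayCurve], by simp [rayCurve]⟩

theorem radius_toSmoothing_le (hz : z ∈ quadric 0) (h0 : z ≠ 0) (h : ‖t‖ ≤ 2 * ‖z‖ ^ 2) :
    radius (toSmoothing t z) ≤ 2 * radius z := by
  have hz0 : 0 < ‖z‖ := norm_pos_iff.2 h0
  have ha : ‖smoothingCoeff t z‖ ≤ 1 := by
    rw [norm_smoothingCoeff]; exact div_le_one_of_le₀ h (by positivity)
  have ha0 := norm_nonneg (smoothingCoeff t z)
  rw [radius_le_iff (by have := radius_nonneg z; positivity), mul_pow, radius_pow_three,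
    norm_sq_toSmoothing hz]
  have : ‖smoothingCoeff t z‖ ^ 2 ≤ 1 := by nlinarith
  nlinarith [sq_nonneg ‖z‖]

theorem radius_le_toSmoothing (hz : z ∈ quadric 0) : radius z ≤ radius (toSmoothing t z) := by
  rw [le_radius_iff (radius_nonneg z), radius_pow_three, norm_sq_toSmoothing hz]
  nlinarith [sq_nonneg ‖z‖, sq_nonneg ‖smoothingCoeff t z‖,
    mul_nonneg (sq_nonneg ‖z‖) (sq_nonneg ‖smoothingCoeff t z‖)]

/-! ### The map from the cone as an approximate isometry outside the core. -/

/-- The hypotheses under which `toSmoothing t` is an approximate isometry outside radius `δ`. -/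
structure IsCloseAt (t : ℂ) (δ C : ℝ) : Prop where
  pos : 0 < δ
  le : δ ≤ 1 / 4
  norm_le : ‖t‖ ≤ δ ^ 3
  nonneg : 0 ≤ C
  core : ∀ p q : C4, p ∈ quadric t → q ∈ quadric t →
    coDist t p q ≤ ENNReal.ofReal (C * (radius p + radius q))
  metric : ∀ z v : C4, z ∈ quadric 0 → dot z v = 0 → δ ^ 3 ≤ ‖z‖ ^ 2 →
    |coMetric t (toSmoothing t z) (toSmoothingDeriv t z v) (toSmoothingDeriv t z v)
      - coMetric 0 z v v| ≤ δ * coMetric 0 z v v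

variable {δ C : ℝ}

theorem IsCloseAt.ne_of_le (h : IsCloseAt t δ C) (hz : δ ^ 3 ≤ ‖z‖ ^ 2) : z ≠ 0 := by
  rintro rfl
  have := pow_pos h.pos 3
  rw [norm_zero] at hz
  norm_num at hz
  linarith

theorem IsCloseAt.norm_lt (h : IsCloseAt t δ C) (hz : δ ^ 3 ≤ ‖z‖ ^ 2) : ‖t‖ < 2 * ‖z‖ ^ 2 := by
  have := h.norm_le
  have := pow_pos h.pos 3
  linarith

theorem IsCloseAt.coDist_ray_le (h : IsCloseAt t δ C) (hp : p ∈ quadric 0) (hpδ : δ ≤ radius p) :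
    ∃ w ∈ quadric 0, w ≠ 0 ∧ radius w = δ ∧ coDist t (toSmoothing t p) (toSmoothing t w)
      ≤ ENNReal.ofReal ((1 + 2 * δ) * radius p) := by
  have hδ := h.pos
  have hr : 0 < radius p := hδ.trans_le hpδ
  have hpos : 0 < δ / radius p := div_pos hδ hr
  have hσ1 : δ / radius p ≤ 1 := (div_le_one hr).2 hpδ
  have hrad : ∀ s ∈ Icc (0 : ℝ) 1, δ ^ 3 ≤ ‖rayCurve p (δ / radius p) s‖ ^ 2 := by
    intro s hs
    rw [← le_radius_iff hδ.le, rayCurve]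
    have h1 : δ / radius p ≤ 1 - (1 - δ / radius p) * s := by nlinarith [hs.1, hs.2]
    rw [radius_rpow_smul (by linarith)]
    calc δ = δ / radius p * radius p := by field_simp
      _ ≤ _ := by gcongr
  have hcurve := isCurve_rayCurve hp (δ / radius p)
  have hr1 : radius (((δ / radius p) ^ (3 / 2 : ℝ)) • p) = δ := by
    rw [radius_rpow_smul hpos.le]; field_simp
  refine ⟨((δ / radius p) ^ (3 / 2 : ℝ)) • p, smul_mem_quadric_zero hp _, ?_, hr1, ?_⟩
  · exact h.ne_of_le ((le_radius_iff hδ.le).1 hr1.ge)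
  · have h1 := coDist_le_coLength (isCurve_toSmoothing (t := t) hcurve
      fun s hs => h.ne_of_le (hrad s hs))
    have h2 := (coLength_toSmoothing hδ h.le (pow_pos hδ 3) h.metric (piecewiseC1_iff.1 hcurve.1)
      hcurve.2.1 hrad).1
    refine h1.trans (h2.trans ?_)
    rw [ENNReal.ofReal_mul (by linarith)]
    gcongr
    exact coLength_rayCurve_le p hpos.le hσ1

/-- Follow the image of the ray from p inward to radius δ, cross the core, and return along the ray
to q. The crossing costs at most C(2δ + 2δ), because the images of points of radius δ have radius at
most 2δ. -/
theorem IsCloseAt.coDist_le_add (h : IsCloseAt t δ C) (hp : p ∈ quadric 0) (hpδ : δ ≤ radius p)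
    (hq : q ∈ quadric 0) (hqδ : δ ≤ radius q) :
    coDist t (toSmoothing t p) (toSmoothing t q)
      ≤ ENNReal.ofReal ((1 + 2 * δ) * (radius p + radius q) + 4 * C * δ) := by
  have hδ := h.pos
  have hC := h.nonneg
  obtain ⟨w, hw, hw0, hwr, hpw⟩ := h.coDist_ray_le hp hpδ
  obtain ⟨w', hw', hw0', hwr', hqw⟩ := h.coDist_ray_le hq hqδ
  have hb : ∀ u ∈ quadric 0, u ≠ 0 → radius u = δ → radius (toSmoothing t u) ≤ 2 * δ := by
    intro u hu hu0 hur
    rw [← hur]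
    exact radius_toSmoothing_le hu hu0 (h.norm_lt ((le_radius_iff hδ.le).1 hur.ge)).le
  have h1 := hb w hw hw0 hwr
  have h2 := hb w' hw' hw0' hwr'
  have hww := h.core _ _ (toSmoothing_mem (t := t) hw hw0) (toSmoothing_mem (t := t) hw' hw0')
  have hww' : coDist t (toSmoothing t w) (toSmoothing t w') ≤ ENNReal.ofReal (4 * C * δ) := by
    refine hww.trans (ENNReal.ofReal_le_ofReal ?_)
    calc C * (radius (toSmoothing t w) + radius (toSmoothing t w')) ≤ C * (2 * δ + 2 * δ) := by
          gcongr
      _ = _ := by ring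
  rw [coDist_comm] at hqw
  have hrp := radius_nonneg p
  have hrq := radius_nonneg q
  calc _ ≤ coDist t (toSmoothing t p) (toSmoothing t w)
        + (coDist t (toSmoothing t w) (toSmoothing t w')
          + coDist t (toSmoothing t w') (toSmoothing t q)) :=
        (coDist_triangle t _ (toSmoothing t w) _).trans (by gcongr; exact coDist_triangle t _ _ _)
    _ ≤ ENNReal.ofReal ((1 + 2 * δ) * radius p) + (ENNReal.ofReal (4 * C * δ)
        + ENNReal.ofReal ((1 + 2 * δ) * radius q)) := by gcongr
    _ = _ := by
        rw [← ENNReal.ofReal_add (by positivity) (by positivity),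
          ← ENNReal.ofReal_add (by positivity) (by positivity)]
        congr 1; ring

/-- Upper bound for distances in the smoothing. -/
theorem IsCloseAt.coDist_toSmoothing_le (h : IsCloseAt t δ C) (hp : p ∈ quadric 0)
    (hpδ : δ ≤ radius p) (hq : q ∈ quadric 0) (hqδ : δ ≤ radius q) :
    (coDist t (toSmoothing t p) (toSmoothing t q)).toReal
      ≤ (1 + 2 * δ) * ((coDist 0 p q).toReal + 2 * δ) + 4 * C * δ := by
  have hδ := h.pos
  have hC := h.nonneg
  have hdt : coDist 0 p q ≠ ⊤ := coDist_ne_top hp hq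
  refine ENNReal.toReal_le_of_le_ofReal (by positivity) ?_
  have hrhs : ENNReal.ofReal ((1 + 2 * δ) * ((coDist 0 p q).toReal + 2 * δ) + 4 * C * δ)
      = ENNReal.ofReal (1 + 2 * δ) * (coDist 0 p q + ENNReal.ofReal (2 * δ))
        + ENNReal.ofReal (4 * C * δ) := by
    rw [ENNReal.ofReal_add (by positivity) (by positivity), ENNReal.ofReal_mul (by positivity),
      ENNReal.ofReal_add (p := (coDist 0 p q).toReal) ENNReal.toReal_nonneg (by positivity),
      ENNReal.ofReal_toReal hdt]
  have hne : ENNReal.ofReal (1 + 2 * δ) ≠ 0 := (ENNReal.ofReal_pos.2 (by positivity)).ne'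
  rw [hrhs, coDist, coDist.eq_1 0]
  simp only [ENNReal.iInf_add, ENNReal.mul_iInf_of_ne hne ENNReal.ofReal_ne_top]
  refine le_iInf fun γ => le_iInf fun hγ => ?_
  change coDist t (toSmoothing t p) (toSmoothing t q) ≤ _
  -- Either the curve avoids the core and is mapped forward, or it enters the core. In the latter
  -- case its length is at least r(p) + r(q) - 2δ, and the route through the core is nearly as
  -- short.
  by_cases hstay : ∀ s ∈ Icc (0 : ℝ) 1, δ ^ 3 ≤ ‖γ s‖ ^ 2
  · have h1 := coDist_le_coLength (isCurve_toSmoothing (t := t) hγ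
      fun s hs => h.ne_of_le (hstay s hs))
    have h2 := (coLength_toSmoothing hδ h.le (pow_pos hδ 3) h.metric (piecewiseC1_iff.1 hγ.1)
      hγ.2.1 hstay).1
    refine h1.trans (h2.trans (le_add_right ?_))
    gcongr
    exact le_self_add
  · push Not at hstay
    obtain ⟨c, hc, hcδ⟩ := hstay
    have h1 : radius (γ c) ≤ δ := (radius_le_iff hδ.le).2 hcδ.le
    have h2 := radius_add_le_coLength hγ hc h1
    have hr := h.coDist_le_add hp hpδ hq hqδ
    have hrp := radius_nonneg p
    have hrq := radius_nonneg q
    rw [ENNReal.ofReal_add (mul_nonneg (by linarith) (by linarith)) (by positivity),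
      ENNReal.ofReal_mul (by linarith)] at hr
    refine hr.trans ?_
    gcongr
    calc ENNReal.ofReal (radius p + radius q)
        = ENNReal.ofReal (radius p + radius q - 2 * δ) + ENNReal.ofReal (2 * δ) := by
          rw [← ENNReal.ofReal_add (by linarith) (by positivity)]; congr 1; ring
      _ ≤ _ := by gcongr

/-- Upper bound for distances in the cone. -/
theorem IsCloseAt.coDist_zero_le (h : IsCloseAt t δ C) (hp : p ∈ quadric 0)
    (hpδ : δ ≤ radius p) (hq : q ∈ quadric 0) (hqδ : δ ≤ radius q) :
    (coDist 0 p q).toReal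
      ≤ (1 + 2 * δ) * (coDist t (toSmoothing t p) (toSmoothing t q)).toReal + 4 * δ := by
  have hδ := h.pos
  have hδ3 := pow_pos hδ 3
  have hpδ' := (le_radius_iff hδ.le).1 hpδ
  have hqδ' := (le_radius_iff hδ.le).1 hqδ
  have hdt : coDist t (toSmoothing t p) (toSmoothing t q) ≠ ⊤ :=
    coDist_ne_top (toSmoothing_mem hp (h.ne_of_le hpδ')) (toSmoothing_mem hq (h.ne_of_le hqδ'))
  refine ENNReal.toReal_le_of_le_ofReal (by positivity) ?_
  have hrhs : ENNReal.ofReal ((1 + 2 * δ) * (coDist t (toSmoothing t p) (toSmoothing t q)).toReal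
      + 4 * δ) = ENNReal.ofReal (1 + 2 * δ) * coDist t (toSmoothing t p) (toSmoothing t q)
        + ENNReal.ofReal (4 * δ) := by
    rw [ENNReal.ofReal_add (by positivity) (by positivity), ENNReal.ofReal_mul (by positivity),
      ENNReal.ofReal_toReal hdt]
  have hne : ENNReal.ofReal (1 + 2 * δ) ≠ 0 := (ENNReal.ofReal_pos.2 (by positivity)).ne'
  rw [hrhs, coDist.eq_1 t]
  simp only [ENNReal.iInf_add, ENNReal.mul_iInf_of_ne hne ENNReal.ofReal_ne_top]
  refine le_iInf fun γ => le_iInf fun hγ => ?_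
  -- The threshold is 2δ rather than δ because pulling back can halve the squared norm: (2δ)³/2 ≥
  -- δ³. A curve that goes below it is compared with the two rays through the cone point.
  by_cases hstay : ∀ s ∈ Icc (0 : ℝ) 1, (2 * δ) ^ 3 ≤ ‖γ s‖ ^ 2
  · have hpw := piecewiseC1_iff.1 hγ.1
    have hlt : ∀ s ∈ Icc (0 : ℝ) 1, ‖t‖ < ‖γ s‖ ^ 2 := by
      intro s hs
      have := hstay s hs
      have := h.norm_le
      nlinarith
    have hspec := fun s hs => fromSmoothing_spec (hγ.2.1 s hs) (hlt s hs)
    have hκ : ∀ s ∈ Icc (0 : ℝ) 1, δ ^ 3 ≤ ‖fromSmoothing t (γ s)‖ ^ 2 := by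
      intro s hs
      have h1 := hstay s hs
      have h2 := (coneNormSq_spec (hlt s hs)).1
      rw [(hspec s hs).2.1]
      nlinarith
    have hpw0 : PwC1 (fun s => fromSmoothing t (γ s)) 0 1 :=
      hpw.map (Φ := fromSmoothing t) (U := {z | ‖t‖ < ‖z‖ ^ 2}) (contDiffOn_fromSmoothing t) hlt
    have hmem0 : ∀ s ∈ Icc (0 : ℝ) 1, fromSmoothing t (γ s) ∈ quadric 0 :=
      fun s hs => (hspec s hs).1
    have hcurve : IsCurve 0 p q (fun s => fromSmoothing t (γ s)) := by
      refine ⟨piecewiseC1_iff.2 hpw0, hmem0, ?_, ?_⟩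
      · simp only [hγ.2.2.1]
        exact (fromSmoothing_toSmoothing hp (h.norm_lt hpδ')).2
      · simp only [hγ.2.2.2]
        exact (fromSmoothing_toSmoothing hq (h.norm_lt hqδ')).2
    have h2 := (coLength_toSmoothing hδ h.le hδ3 h.metric hpw0 hmem0 hκ).2
    have h3 : coLength t (fun s => toSmoothing t (fromSmoothing t (γ s))) = coLength t γ :=
      lintegral_coSpeed_congr fun s hs => (hspec s (Ioo_subset_Icc_self hs)).2.2
    rw [h3] at h2
    exact (coDist_le_coLength hcurve).trans (h2.trans le_self_add)
  · push Not at hstay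
    obtain ⟨c, hc, hcδ⟩ := hstay
    have h1 : radius (γ c) ≤ 2 * δ := (radius_le_iff (by positivity)).2 hcδ.le
    have h2 := radius_add_le_coLength hγ hc h1
    refine (coDist_zero_le_add hp hq).trans ?_
    have h3 := radius_le_toSmoothing (t := t) hp
    have h4 := radius_le_toSmoothing (t := t) hq
    have h5 : (1 : ℝ≥0∞) ≤ ENNReal.ofReal (1 + 2 * δ) := by
      rw [← ENNReal.ofReal_one]; exact ENNReal.ofReal_le_ofReal (by linarith)
    calc ENNReal.ofReal (radius p + radius q)
        ≤ ENNReal.ofReal (radius (toSmoothing t p) + radius (toSmoothing t q) - 2 * (2 * δ)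
          + 4 * δ) := ENNReal.ofReal_le_ofReal (by linarith)
      _ ≤ ENNReal.ofReal (radius (toSmoothing t p) + radius (toSmoothing t q) - 2 * (2 * δ))
          + ENNReal.ofReal (4 * δ) := ENNReal.ofReal_add_le
      _ ≤ coLength t γ + ENNReal.ofReal (4 * δ) := by gcongr
      _ ≤ _ := by
        gcongr
        exact le_mul_of_one_le_left zero_le h5

/-- On the unit disc of the cone distances are at most 2, so the multiplicative errors become
additive. The constant 16 comes from the crude bound 6 + 4C for distances in the smoothing. -/
theorem IsCloseAt.abs_sub_le (h : IsCloseAt t δ C) (hp : p ∈ quadric 0)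
    (hpδ : δ ≤ radius p) (hp1 : radius p ≤ 1) (hq : q ∈ quadric 0) (hqδ : δ ≤ radius q)
    (hq1 : radius q ≤ 1) :
    |(coDist 0 p q).toReal - (coDist t (toSmoothing t p) (toSmoothing t q)).toReal|
      ≤ (16 + 12 * C) * δ := by
  have hδ := h.pos
  have hδ1 := h.le
  have hC := h.nonneg
  have h1 := h.coDist_toSmoothing_le hp hpδ hq hqδ
  have h2 := h.coDist_zero_le hp hpδ hq hqδ
  have h3 : (coDist 0 p q).toReal ≤ 2 :=
    ENNReal.toReal_le_of_le_ofReal (by norm_num)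
      ((coDist_zero_le_add hp hq).trans (ENNReal.ofReal_le_ofReal (by linarith)))
  have h0 : 0 ≤ (coDist 0 p q).toReal := ENNReal.toReal_nonneg
  set a := (coDist 0 p q).toReal
  set b := (coDist t (toSmoothing t p) (toSmoothing t q)).toReal
  have hCδ := mul_nonneg hC hδ.le
  have h4 : b ≤ 6 + 4 * C := by nlinarith
  rw [abs_le]
  constructor <;> nlinarith

/-- The cone contains points of every radius. -/
theorem exists_mem_quadric_zero_radius_eq {R : ℝ} (hR : 0 ≤ R) : ∃ p ∈ quadric 0, radius p = R := by
  set e : C4 := WithLp.toLp 2 ![1, Complex.I, 0, 0] with he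
  have hemem : e ∈ quadric 0 := by
    rw [mem_quadric_iff, dot, Fin.sum_univ_four]
    simp [he]
  have hne : e ≠ 0 := by
    intro h
    have := congrArg (fun z : C4 => z 0) h
    simp [he] at this
  have hr : 0 < radius e := by
    have := norm_pos_iff.2 hne
    unfold radius; positivity
  refine ⟨((R / radius e) ^ (3 / 2 : ℝ)) • e, smul_mem_quadric_zero hemem _, ?_⟩
  rw [radius_rpow_smul (by positivity)]
  field_simp

instance (t : ℂ) : Nonempty (Disc t (beta t 1)) := by
  obtain ⟨c, hc⟩ := IsAlgClosed.exists_pow_nat_eq t (n := 2) two_pos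
  set e : C4 := EuclideanSpace.single 0 c with he
  refine ⟨⟨e, ?_, ?_⟩⟩
  · rw [mem_quadric_iff, dot, Fin.sum_univ_four]
    simp [he, ← hc, sq]
  · rw [radius_le_iff (beta_nonneg t), beta_pow_three, he, PiLp.norm_single, ← hc,
      norm_pow]
    nlinarith [sq_nonneg (‖c‖ ^ 2 - 2)]

instance : Nonempty (Disc 0 1) := by
  obtain ⟨p, hp, hpr⟩ := exists_mem_quadric_zero_radius_eq zero_le_one
  exact ⟨⟨p, hp, hpr.le⟩⟩

theorem toSmoothing_mem_disc (h : IsCloseAt t δ C) (hp : p ∈ disc 0 1) (hpδ : δ ≤ radius p) :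
    toSmoothing t p ∈ disc t (beta t 1) := by
  have hδ := h.pos
  have hpδ' := (le_radius_iff hδ.le).1 hpδ
  refine ⟨toSmoothing_mem hp.1 (h.ne_of_le hpδ'), ?_⟩
  have hX1 : ‖p‖ ^ 2 ≤ 1 := by simpa using (radius_le_iff zero_le_one).1 hp.2
  rw [radius_le_iff (beta_nonneg t), beta_pow_three, norm_sq_toSmoothing hp.1, norm_smoothingCoeff]
  have hX : 0 < ‖p‖ ^ 2 := lt_of_lt_of_le (pow_pos hδ 3) hpδ'
  have hts : ‖t‖ ≤ ‖p‖ ^ 2 := h.norm_le.trans hpδ'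
  set X := ‖p‖ ^ 2
  have e : X * (1 + (‖t‖ / (2 * X)) ^ 2) = X + ‖t‖ ^ 2 / (4 * X) := by field_simp; ring
  rw [e]
  have h2 : ‖t‖ ^ 2 ≤ X * 1 := by nlinarith [norm_nonneg t]
  -- The difference between the values of x ↦ x + |t|²/(4x) at 1 and at X factors; both factors are
  -- nonnegative since |t|²/4 ≤ X ≤ 1.
  have h3 : X + ‖t‖ ^ 2 / (4 * X) = 1 + ‖t‖ ^ 2 / 4 - (1 - X) * (1 - ‖t‖ ^ 2 / (4 * X)) := by
    field_simp; ring
  have h4 : ‖t‖ ^ 2 / (4 * X) ≤ 1 := by rw [div_le_one (by positivity)]; linarith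
  rw [h3]
  have := mul_nonneg (sub_nonneg.2 hX1) (sub_nonneg.2 h4)
  linarith

/-- If z has a preimage of radius at least δ, that preimage is taken and the distance is 0.
Otherwise ‖z‖² ≤ 2δ³, so z lies in the core and is close to the image of any point of radius δ. -/
theorem IsCloseAt.exists_near (h : IsCloseAt t δ C) (hz : z ∈ disc t (beta t 1)) :
    ∃ p ∈ disc 0 1, δ ≤ radius p ∧ (coDist t z (toSmoothing t p)).toReal ≤ 4 * C * δ := by
  have hδ := h.pos
  have hδ3 := pow_pos hδ 3
  have hC := h.nonneg
  have hts := h.norm_le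
  by_cases hbig : ‖t‖ < ‖z‖ ^ 2 ∧ δ ^ 3 ≤ coneNormSq t z
  · obtain ⟨hlt, hcone⟩ := hbig
    obtain ⟨h1, h2, h3⟩ := fromSmoothing_spec hz.1 hlt
    obtain ⟨h4, h5⟩ := coneNormSq_spec hlt
    refine ⟨fromSmoothing t z, ⟨h1, ?_⟩, ?_, ?_⟩
    · rw [radius_le_iff zero_le_one, h2, one_pow]
      have h6 := (radius_le_iff (beta_nonneg t)).1 hz.2
      rw [beta_pow_three] at h6
      by_contra! hx
      have h7 : ‖t‖ ≤ 1 := hts.trans (pow_le_one₀ hδ.le (by linarith [h.le]))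
      have h8 : ‖t‖ ^ 2 ≤ 1 := pow_le_one₀ (norm_nonneg t) h7
      set x := coneNormSq t z
      have h9 : ‖z‖ ^ 2 * x ≤ (1 + ‖t‖ ^ 2 / 4) * x := by gcongr
      nlinarith [mul_pos (sub_pos.2 hx) (sub_pos.2 (lt_of_le_of_lt (by linarith : ‖t‖ ^ 2 / 4 ≤ 1) hx))]
    · rw [le_radius_iff hδ.le, h2]; exact hcone
    · rw [h3, coDist_self hz.1]; simp; positivity
  · have hsmall : ‖z‖ ^ 2 ≤ 2 * δ ^ 3 := by
      by_cases hlt : ‖t‖ < ‖z‖ ^ 2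
      · have h1 : coneNormSq t z < δ ^ 3 := by
          by_contra! hc; exact hbig ⟨hlt, hc⟩
        linarith [(coneNormSq_spec hlt).1]
      · linarith
    have hzr : radius z ≤ 2 * δ := by
      rw [radius_le_iff (by positivity)]; nlinarith
    obtain ⟨p, hp, hpr⟩ := exists_mem_quadric_zero_radius_eq hδ.le
    have hpδ := (le_radius_iff hδ.le).1 hpr.ge
    refine ⟨p, ⟨hp, by rw [hpr]; linarith [h.le]⟩, hpr.ge, ?_⟩
    have h1 := radius_toSmoothing_le hp (h.ne_of_le hpδ) (h.norm_lt hpδ).le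
    rw [hpr] at h1
    refine ENNReal.toReal_le_of_le_ofReal (by positivity)
      ((h.core _ _ hz.1 (toSmoothing_mem hp (h.ne_of_le hpδ))).trans
        (ENNReal.ofReal_le_ofReal ?_))
    calc _ ≤ C * (2 * δ + 2 * δ) := by gcongr
      _ = _ := by ring

theorem IsCloseAt.ghDist_le (h : IsCloseAt t δ C) :
    GromovHausdorff.ghDist (Disc 0 1) (Disc t (beta t 1)) ≤ (10 + 10 * C) * δ := by
  have hδ := h.pos
  have hC := h.nonneg
  let S : Set (Disc 0 1) := {p | δ ≤ radius p.1}
  let Φ : S → Disc t (beta t 1) :=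
    fun p => ⟨toSmoothing t p.1.1, toSmoothing_mem_disc h p.1.2 p.2⟩
  -- The resulting bound is ε₁ + ε₂/2 + ε₃ = 2δ + (8 + 6C)δ + 4Cδ. Here ε₁ is the density of {r ≥ δ}
  -- in the cone disc, ε₂ the distortion, and ε₃ the density of the image.
  have := GromovHausdorff.ghDist_le_of_approx_subsets (s := S) Φ (ε₁ := 2 * δ)
    (ε₂ := (16 + 12 * C) * δ) (ε₃ := 4 * C * δ) ?_ ?_ ?_
  · refine this.trans (le_of_eq ?_)
    ring
  · intro x
    by_cases hx : δ ≤ radius x.1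
    · exact ⟨x, hx, by rw [dist_self]; positivity⟩
    obtain ⟨p, hp, hpr⟩ := exists_mem_quadric_zero_radius_eq hδ.le
    let y : Disc 0 1 := ⟨p, hp, by rw [hpr]; linarith [h.le]⟩
    refine ⟨y, hpr.ge, ?_⟩
    change (coDist 0 x.1 p).toReal ≤ 2 * δ
    refine ENNReal.toReal_le_of_le_ofReal (by positivity)
      ((coDist_zero_le_add x.2.1 hp).trans (ENNReal.ofReal_le_ofReal ?_))
    push Not at hx
    rw [hpr]
    linarith
  · intro z
    obtain ⟨p, hp, hpδ, hle⟩ := h.exists_near z.2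
    exact ⟨⟨⟨p, hp⟩, hpδ⟩, hle⟩
  · intro x y
    exact h.abs_sub_le x.1.2.1 x.2 x.1.2.2 y.1.2.1 y.2 y.1.2.2

/-- It matters that C is chosen before δ: the final bound is a constant times δ. The choice η = δ³/K
puts all of {r ≥ δ} in the range ‖z‖² ≥ K|t|. -/
theorem exists_isCloseAt : ∃ C : ℝ, 0 ≤ C ∧ ∀ δ : ℝ, 0 < δ → δ ≤ 1 / 4 →
    ∃ η > 0, ∀ t : ℂ, t ≠ 0 → ‖t‖ < η → IsCloseAt t δ C := by
  obtain ⟨C, hC, hcore⟩ := exists_coDist_le_radius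
  refine ⟨C, hC.le, fun δ hδ hδ1 => ?_⟩
  obtain ⟨K, hK1, hK⟩ := exists_coMetric_toSmoothing_close hδ
  have hK0 : 0 < K := by linarith
  refine ⟨δ ^ 3 / K, by positivity, fun t ht htη => ?_⟩
  have hKt : K * ‖t‖ ≤ δ ^ 3 := by
    rw [lt_div_iff₀ hK0] at htη; linarith
  refine ⟨hδ, hδ1, ?_, hC.le, fun p q hp hq => hcore t p q ht hp hq,
    fun z v hz hv hzδ => hK t z v ht hz hv (hKt.trans hzδ)⟩
  nlinarith [norm_nonneg t]

theorem tendsto_toGHSpace :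
    Tendsto (fun t => GromovHausdorff.toGHSpace (Disc t (beta t 1))) (𝓝[≠] 0)
      (𝓝 (GromovHausdorff.toGHSpace (Disc 0 1))) := by
  obtain ⟨C, hC, hclose⟩ := exists_isCloseAt
  rw [Metric.tendsto_nhdsWithin_nhds]
  intro ε hε
  obtain ⟨η, hη, h⟩ := hclose (min (1 / 4) (ε / 2 / (10 + 10 * C))) (by positivity) (min_le_left _ _)
  refine ⟨η, hη, fun {t} ht htη => ?_⟩
  rw [dist_zero_right] at htη
  rw [dist_comm]
  have h1 := (h t ht htη).ghDist_le
  have h2 : (10 + 10 * C) * min (1 / 4) (ε / 2 / (10 + 10 * C)) ≤ ε / 2 := by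
    calc _ ≤ (10 + 10 * C) * (ε / 2 / (10 + 10 * C)) := by gcongr; exact min_le_right _ _
      _ = ε / 2 := by field_simp
  have h3 : dist (GromovHausdorff.toGHSpace (Disc 0 1))
      (GromovHausdorff.toGHSpace (Disc t (beta t 1)))
      = GromovHausdorff.ghDist (Disc 0 1) (Disc t (beta t 1)) := rfl
  rw [h3]
  linarith

theorem hasGHClass_disc (t : ℂ) (R : ℝ) [Nonempty (Disc t R)] :
    HasGHClass (disc t R) (coDist t) (GromovHausdorff.toGHSpace (Disc t R)) := by
  obtain ⟨e⟩ := GromovHausdorff.toGHSpace_eq_toGHSpace_iff_isometryEquiv.1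
    (GromovHausdorff.toGHSpace (Disc t R)).toGHSpace_rep
  exact ⟨e.toEquiv, fun p q => (e.isometry.edist_eq p q).symm⟩

end Convergence

end Conifold
end

theorem mainTheorem4 :
    ∃ (X : ℂ → GromovHausdorff.GHSpace) (X₀ : GromovHausdorff.GHSpace),
      (∀ t : ℂ, t ≠ 0 →
        Conifold.HasGHClass (Conifold.disc t (Conifold.beta t 1)) (Conifold.coDist t) (X t)) ∧
      Conifold.HasGHClass (Conifold.disc 0 1) (Conifold.coDist 0) X₀ ∧
      Tendsto X (𝓝[≠] 0) (𝓝 X₀) :=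
  ⟨fun t => GromovHausdorff.toGHSpace (Conifold.Disc t (Conifold.beta t 1)),
    GromovHausdorff.toGHSpace (Conifold.Disc 0 1),
    fun t _ => Conifold.hasGHClass_disc t _, Conifold.hasGHClass_disc 0 1,
    Conifold.tendsto_toGHSpace⟩
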